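/- Let $n\ge 0$ be an integer, $p\in(0,1)$ and $q=\frac{p}{p-1}<0$. For a nonnegative measurable $f:\mathbb{R}^n\to[0,\infty)$ put $$Lf(y)=\int_{\mathbb{R}^n} f(x)\,e^{x\cdot y}\,dx\in[0,\infty]\quad(y\in\mathbb{R}^n),\qquad \tau_zf(x)=f(x-z)\quad (z\in\mathbb{R}^n),$$ and for measurable $g:\mathbb{R}^n\to[0,\infty]$ put $\|g\|_q=\big(\int_{\mathbb{R}^n} g^q\,dx\big)^{1/q}\in[0,\infty]$, with $0^r=\infty$ and $\infty^r=0$ for $r<0$. Let also $\|f\|_p=\big(\int_{\mathbb{R}^n} f^p\,dx\big)^{1/p}$, let $$C_p=\Big[p^{1/p}(-q)^{-1/q}\Big]^{n/2}(2\pi)^{n/q},$$ and let $\gamma_\sigma(x)=e^{-|x|^2/(2\sigma)}$ for $\sigma>0$. 1. For every nonnegative $f\in L^p(\mathbb{R}^n)$, $$\sup_{z\in\mathbb{R}^n}\|L(\tau_zf)\|_q\ \ge\ C_p\,\|f\|_p,$$ with equality when $f=\tau_a(\lambda\gamma_\sigma)$ with $\lambda,\sigma>0$ and $a\in\mathbb{R}^n$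 (in particular when $f=\lambda\gamma_\sigma$ is a centered Gaussian). 2. Let $f\in L^p(\mathbb{R}^n)$ be nonnegative and not almost everywhere zero. If $\sup_z\|L(\tau_zf)\|_q<\infty$, then this supremum is attained at exactly one point $z\in\mathbb{R}^n$. This point is $z=0$ if $\int_{\mathbb{R}^n}|x|\,(Lf(x))^q\,dx<\infty$ and $\int_{\mathbb{R}^n}x\,(Lf(x))^q\,dx=0$. 3. For every nonnegative $f\in L^p(\mathbb{R}^n)$ with $\int_{\mathbb{R}^n}|x|\,f(x)^p\,dx<\infty$ and $\int_{\mathbb{R}^n}x\,f(x)^p\,dx=0$, $$\|Lf\|_q\ \ge\ C_p\,\|f\|_p,$$ with equality when $f=\lambda\gamma_\sigma$ with $\lambda,\sigma>0$. -/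

import Mathlib

open MeasureTheory
open scoped ENNReal

noncomputable section

namespace LaplaceLp

/-- The Laplace transform `Lf(y) = ∫ f(x) exp(x·y) dx ∈ [0, ∞]` of a nonnegative function
`f` on Euclidean space. -/
def laplace {n : ℕ} (f : EuclideanSpace ℝ (Fin n) → ℝ) (y : EuclideanSpace ℝ (Fin n)) : ℝ≥0∞ :=
  ∫⁻ x, ENNReal.ofReal (f x * Real.exp (inner ℝ x y))

/-- The translate `τ_a f (x) = f (x - a)`. -/
def translate {n : ℕ} (a : EuclideanSpace ℝ (Fin n)) (f : EuclideanSpace ℝ (Fin n) → ℝ) :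
    EuclideanSpace ℝ (Fin n) → ℝ :=
  fun x => f (x - a)

/-- The `L^q` "norm" `(∫ g^q)^(1/q) ∈ [0, ∞]` of `g : ℝⁿ → [0, ∞]` for a real exponent `q ≠ 0`
(used here for `q < 0`), with the conventions `0 ^ q = ∞` and `∞ ^ q = 0` for `q < 0`. -/
def lqNorm {n : ℕ} (q : ℝ) (g : EuclideanSpace ℝ (Fin n) → ℝ≥0∞) : ℝ≥0∞ :=
  (∫⁻ x, g x ^ q) ^ (1 / q)

/-- The Gaussian function `γ_σ(x) = exp(-|x|² / (2σ))`. -/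
def gaussian (n : ℕ) (σ : ℝ) : EuclideanSpace ℝ (Fin n) → ℝ :=
  fun x => Real.exp (-‖x‖ ^ 2 / (2 * σ))

/-- The constant `C_p = [p^(1/p) (-q)^(-1/q)]^(n/2) (2π)^(n/q)`, where `q = p / (p - 1)`. -/
def sharpConst (n : ℕ) (p q : ℝ) : ℝ :=
  (p ^ (1 / p) * (-q) ^ (-1 / q)) ^ ((n : ℝ) / 2) * (2 * Real.pi) ^ ((n : ℝ) / q)

end LaplaceLp

end

open MeasureTheory Filter Topology
open scoped ENNReal

set_option linter.unusedSectionVars false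

noncomputable section

namespace LaplaceLp

/-! By reverse Hölder and its converse (`reverse_holder`, `le_nrm_of_forall_le`), a lower bound for
`‖Lf‖_q` is a lower bound for the symmetric form `form f g`, the double integral of `f(x) g(y)
exp(x·y)`, by a multiple of `‖f‖_p ‖g‖_p`. Let `I = evenInf` be the best constant over even
functions.

Doubling. Rotating by 45 degrees in both pairs of variables preserves `x·y + u·v`, so `form f g ^ 2`
is the integral of `exp(x·y) form (twist f x) (twist g y)` (`form_sq`). The twists are even in `u`
whether or not `f` is even, so the even inequality applies inside and gives `I * form (doubled f)
(doubled g) ≤ form f g ^ 2`; here `doubled f ^ p` is a rescaled self-convolution of `f ^ p`.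

The value of `I`. Replacing `f` by `(Lf)^(q-1)` does not increase the quotient, and the `p`-th power
of the new function, `(Lf)^q`, is even and log-concave. A linear change of variables puts it in a
fixed compact class, so a minimizer exists (`exists_minimizer`). For a minimizer and its dual
function, doubling is an equality; the equality case of reverse Hölder then makes `twist ((Lf)^q) y
v` a product `A(y) B(v)`. For log-concave functions this is the parallelogram law for the logarithm,
so the dual function is Gaussian and `I` is the Gaussian quotient (`evenInf_eq_sharpConst`).

Beyond even functions. If `f` and `g` have bounded support and `f ^ p` is centered, the doubling
inequality is iterated `k` times from a crude bound. Its loss grows like `b ^ k` and disappears in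
the `2 ^ k`-th root (`evenInf_mul_le_form`). Moving the barycenter to the origin and truncating
gives the bound for the supremum over translations. The centered inequality in general follows from
that supremum bound applied to the dual variable `g`, since a translation of `g` is compensated by
an exponential tilt of `f`.

Uniqueness. `‖L(τ_z f)‖_q` is the power `1/q` of the Laplace transform of `(Lf)^q` at `q z`
(`nrm_lap_translate`). Maximizing it means minimizing a Laplace transform bounded away from zero,
which is coercive, lower semicontinuous and strictly convex (`exists_unique_lap_min`). -/

/-- Exponents `0 < p < 1` and `q = p / (p - 1) < 0`, conjugate in the sense `1/p + 1/q = 1`. -/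
structure ReverseConjugate (p q : ℝ) : Prop where
  pos : 0 < p
  lt_one : p < 1
  eq : q = p / (p - 1)

namespace ReverseConjugate

variable {p q : ℝ}

theorem q_neg (h : ReverseConjugate p q) : q < 0 := by
  rw [h.eq]; exact div_neg_of_pos_of_neg h.pos (by linarith [h.lt_one])

theorem one_div_q (h : ReverseConjugate p q) : 1 / q = 1 - 1 / p := by
  have h1 := h.pos
  have h2 : p - 1 ≠ 0 := by linarith [h.lt_one]
  rw [h.eq]; field_simp

theorem one_div_q_neg (h : ReverseConjugate p q) : 1 / q < 0 := one_div_neg.2 h.q_neg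

theorem one_lt_one_div_p (h : ReverseConjugate p q) : 1 < 1 / p := by
  rw [lt_div_iff₀ h.pos]; linarith [h.lt_one]

theorem sub_one_mul (h : ReverseConjugate p q) : (q - 1) * p = q := by
  have h1 := h.pos
  have h2 : p - 1 ≠ 0 := by linarith [h.lt_one]
  rw [h.eq]; field_simp; ring

theorem mul_one_sub (h : ReverseConjugate p q) : q * (1 - p) = -p := by
  have h1 := h.pos
  have h2 : p - 1 ≠ 0 := by linarith [h.lt_one]
  rw [h.eq]; field_simp; ring

end ReverseConjugate

/-! ### The reverse Hölder inequality and its equality case. -/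

section General

variable {α : Type*} [MeasurableSpace α] {μ : Measure α} {p q : ℝ}

/-- The reverse Hölder inequality for exponents `p ∈ (0, 1)` and `q < 0`. -/
theorem reverse_holder (hpq : ReverseConjugate p q) {f h : α → ℝ≥0∞} (hf : AEMeasurable f μ)
    (hh : AEMeasurable h μ) :
    (∫⁻ x, f x ^ p ∂μ) ^ (1 / p) * (∫⁻ x, h x ^ q ∂μ) ^ (1 / q) ≤ ∫⁻ x, f x * h x ∂μ := by
  have hq := hpq.q_neg
  have hp := hpq.pos
  by_cases hAtop : ∫⁻ x, h x ^ q ∂μ = ∞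
  · rw [hAtop, ENNReal.top_rpow_of_neg hpq.one_div_q_neg, mul_zero]
    exact zero_le
  -- Here `h` is infinite almost everywhere, so the right side is infinite unless `f` vanishes
  -- almost everywhere.
  by_cases hA0 : ∫⁻ x, h x ^ q ∂μ = 0
  · rw [lintegral_eq_zero_iff' (hh.pow_const q)] at hA0
    have hht : ∀ᵐ x ∂μ, h x = ∞ := by
      filter_upwards [hA0] with x hx
      rcases ENNReal.rpow_eq_zero_iff.1 hx with hx | hx
      · exact absurd hx.2 (not_lt.2 hq.le)
      · exact hx.1
    have h1 : ∫⁻ x, f x * h x ∂μ = (∫⁻ x, f x ∂μ) * ∞ := by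
      rw [← lintegral_mul_const'' _ hf]
      refine lintegral_congr_ae ?_
      filter_upwards [hht] with x hx
      rw [hx]
    by_cases hf0 : ∫⁻ x, f x ∂μ = 0
    · rw [lintegral_eq_zero_iff' hf] at hf0
      have : ∫⁻ x, f x ^ p ∂μ = 0 := by
        rw [lintegral_eq_zero_iff' (hf.pow_const p)]
        filter_upwards [hf0] with x hx
        simp [hx, hp]
      rw [this, ENNReal.zero_rpow_of_pos (one_div_pos.2 hp), zero_mul]
      exact zero_le
    · rw [h1, ENNReal.mul_top hf0]
      exact le_top
  by_cases hB : ∫⁻ x, f x * h x ∂μ = ∞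
  · rw [hB]; exact le_top
  -- Ordinary Hölder with weights `p` and `1 - p` for `f h` and `h ^ q`: since `q (1 - p) = -p`, the
  -- powers of `h` cancel.
  have key : ∫⁻ x, f x ^ p ∂μ ≤ (∫⁻ x, f x * h x ∂μ) ^ p * (∫⁻ x, h x ^ q ∂μ) ^ (1 - p) := by
    refine le_trans (le_of_eq ?_) (ENNReal.lintegral_mul_norm_pow_le (hf.mul hh) (hh.pow_const q)
      hp.le (by linarith [hpq.lt_one]) (by ring))
    refine lintegral_congr_ae ?_
    filter_upwards [ae_lt_top' (hf.mul hh) hB, ae_lt_top' (hh.pow_const q) hAtop] with x h1 h2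
    have hx0 : h x ≠ 0 := by
      intro h0
      rw [h0, ENNReal.zero_rpow_of_neg hq] at h2
      exact lt_irrefl _ h2
    rw [← ENNReal.rpow_mul, hpq.mul_one_sub, Pi.mul_apply, ENNReal.mul_rpow_of_nonneg _ _ hp.le,
      mul_assoc]
    by_cases hxt : h x = ∞
    · have : f x = 0 := by
        by_contra hfx
        simp only [Pi.mul_apply, hxt, ENNReal.mul_top hfx, lt_self_iff_false] at h1
      simp [this, hp]
    · rw [← ENNReal.rpow_add _ _ hx0 hxt]; simp
  have hA : (∫⁻ x, h x ^ q ∂μ) ^ ((1 - p) * (1 / p)) * (∫⁻ x, h x ^ q ∂μ) ^ (1 / q) = 1 := by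
    rw [← ENNReal.rpow_add _ _ hA0 hAtop, hpq.one_div_q]
    have : (1 - p) * (1 / p) + (1 - 1 / p) = 0 := by field_simp; ring
    rw [this, ENNReal.rpow_zero]
  calc _ ≤ ((∫⁻ x, f x * h x ∂μ) ^ p * (∫⁻ x, h x ^ q ∂μ) ^ (1 - p)) ^ (1 / p)
        * (∫⁻ x, h x ^ q ∂μ) ^ (1 / q) := by
        gcongr
    _ = _ := by
      rw [ENNReal.mul_rpow_of_nonneg _ _ (one_div_pos.2 hp).le, ← ENNReal.rpow_mul,
        ← ENNReal.rpow_mul, mul_assoc, hA, mul_one_div_cancel hp.ne', ENNReal.rpow_one, mul_one]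

/-- Division by `y` turns this into Bernoulli's inequality with exponent `1/p > 1` at `1 + w = x /
y`, which is strict unless `w = 0`. -/
theorem real_young (hpq : ReverseConjugate p q) {x y : ℝ} (hx : 0 ≤ x) (hy : 0 < y) :
    (1 / p) * x ≤ x ^ (1 / p) * y ^ (1 / q) + (-(1 / q)) * y ∧
      ((1 / p) * x = x ^ (1 / p) * y ^ (1 / q) + (-(1 / q)) * y → x = y) := by
  have h1 : x ^ (1 / p) * y ^ (1 / q) = y * (x / y) ^ (1 / p) := by
    rw [Real.div_rpow hx hy.le, hpq.one_div_q, Real.rpow_sub hy, Real.rpow_one]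
    field_simp
  have hw : -1 ≤ x / y - 1 := by
    have := div_nonneg hx hy.le
    linarith
  by_cases hxy : x = y
  · subst hxy
    refine ⟨?_, fun _ => rfl⟩
    rw [h1, div_self hy.ne', Real.one_rpow, hpq.one_div_q]
    linarith
  · have hne : x / y - 1 ≠ 0 := by
      rw [sub_ne_zero]
      intro h
      exact hxy ((div_eq_one_iff_eq hy.ne').1 h)
    have hB := one_add_mul_self_lt_rpow_one_add hw hne hpq.one_lt_one_div_p
    rw [add_sub_cancel] at hB
    have hB' := mul_lt_mul_of_pos_left hB hy
    have hs : (1 / p) * x < x ^ (1 / p) * y ^ (1 / q) + (-(1 / q)) * y := by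
      rw [h1, hpq.one_div_q]
      have : y * (1 + 1 / p * (x / y - 1)) = y + 1 / p * x - 1 / p * y := by
        field_simp; ring
      rw [this] at hB'
      linarith
    exact ⟨hs.le, fun h => absurd h hs.ne⟩

theorem ennreal_young (hpq : ReverseConjugate p q) {X Y : ℝ≥0∞} (hX : X ≠ ∞) (hY0 : Y ≠ 0)
    (hY : Y ≠ ∞) :
    ENNReal.ofReal (1 / p) * X ≤ X ^ (1 / p) * Y ^ (1 / q) + ENNReal.ofReal (-(1 / q)) * Y ∧
      (ENNReal.ofReal (1 / p) * X = X ^ (1 / p) * Y ^ (1 / q) + ENNReal.ofReal (-(1 / q)) * Y →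
        X = Y) := by
  have hp := hpq.pos
  have hx : 0 ≤ X.toReal := ENNReal.toReal_nonneg
  have hy : 0 < Y.toReal := ENNReal.toReal_pos hY0 hY
  obtain ⟨h1, h2⟩ := real_young hpq hx hy
  have e1 : ENNReal.ofReal (1 / p) * X = ENNReal.ofReal ((1 / p) * X.toReal) := by
    rw [ENNReal.ofReal_mul (one_div_pos.2 hp).le, ENNReal.ofReal_toReal hX]
  have e2 : X ^ (1 / p) * Y ^ (1 / q) + ENNReal.ofReal (-(1 / q)) * Y =
      ENNReal.ofReal (X.toReal ^ (1 / p) * Y.toReal ^ (1 / q) + (-(1 / q)) * Y.toReal) := by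
    have hq : 0 ≤ -(1 / q) := by linarith [hpq.one_div_q_neg]
    rw [ENNReal.ofReal_add (by positivity) (by positivity), ENNReal.ofReal_mul (by positivity),
      ENNReal.ofReal_mul hq, ENNReal.ofReal_toReal hY,
      ← ENNReal.ofReal_rpow_of_nonneg hx (one_div_pos.2 hp).le, ENNReal.ofReal_toReal hX,
      ← ENNReal.ofReal_rpow_of_pos hy, ENNReal.ofReal_toReal hY]
  rw [e1, e2]
  refine ⟨ENNReal.ofReal_le_ofReal h1, fun h => ?_⟩
  have h3 := (ENNReal.ofReal_eq_ofReal_iff (by positivity) (le_trans (by positivity) h1)).1 h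
  exact (ENNReal.toReal_eq_toReal_iff' hX hY).1 (h2 h3)

/-- The equality case of the reverse Hölder inequality. -/
theorem ae_eq_of_reverse_holder_eq (hpq : ReverseConjugate p q) {f h : α → ℝ≥0∞}
    (hf : AEMeasurable f μ) (hh : AEMeasurable h μ) (hf0 : ∫⁻ x, f x ^ p ∂μ ≠ 0)
    (hft : ∫⁻ x, f x ^ p ∂μ ≠ ∞) (hh0 : ∫⁻ x, h x ^ q ∂μ ≠ 0) (hht : ∫⁻ x, h x ^ q ∂μ ≠ ∞)
    (heq : ∫⁻ x, f x * h x ∂μ = (∫⁻ x, f x ^ p ∂μ) ^ (1 / p) * (∫⁻ x, h x ^ q ∂μ) ^ (1 / q)) :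
    ∀ᵐ x ∂μ, f x ^ p / ∫⁻ x, f x ^ p ∂μ = h x ^ q / ∫⁻ x, h x ^ q ∂μ := by
  set a := ∫⁻ x, f x ^ p ∂μ
  set b := ∫⁻ x, h x ^ q ∂μ
  have hp := hpq.pos
  have hq := hpq.q_neg
  have hp' : 0 < 1 / p := one_div_pos.2 hp
  have hq' := hpq.one_div_q_neg
  have ha1 : a ^ (1 / p) ≠ 0 := by simp [ENNReal.rpow_eq_zero_iff, hf0, hft]
  have ha2 : a ^ (1 / p) ≠ ∞ := by simp [ENNReal.rpow_eq_top_iff, hf0, hft]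
  have hb1 : b ^ (1 / q) ≠ 0 := by simp [ENNReal.rpow_eq_zero_iff, hh0, hht]
  have hb2 : b ^ (1 / q) ≠ ∞ := by simp [ENNReal.rpow_eq_top_iff, hh0, hht]
  have hBt : ∫⁻ x, f x * h x ∂μ ≠ ∞ := by rw [heq]; exact ENNReal.mul_ne_top ha2 hb2
  -- Young's inequality will be applied to the normalized densities `f ^ p / a` and `h ^ q / b`.
  -- Where the second vanishes, `h` is infinite, and finiteness of the integral of `f h` forces `f =
  -- 0`.
  have hpt : ∀ᵐ x ∂μ,
      f x ^ p / a ≠ ∞ ∧ (h x ^ q / b = 0 → f x ^ p / a = 0) ∧ h x ^ q / b ≠ ∞ ∧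
      (h x ^ q / b ≠ 0 → f x * h x * (a ^ (1 / p) * b ^ (1 / q))⁻¹ =
        (f x ^ p / a) ^ (1 / p) * (h x ^ q / b) ^ (1 / q)) := by
    filter_upwards [ae_lt_top' (hf.mul hh) hBt, ae_lt_top' (hf.pow_const p) hft,
      ae_lt_top' (hh.pow_const q) hht] with x h1 h2 h3
    refine ⟨ENNReal.div_ne_top h2.ne hf0, fun h0 => ?_, ENNReal.div_ne_top h3.ne hh0, fun h0 => ?_⟩
    · have : h x ^ q = 0 := by simpa [hht] using h0
      have hxt : h x = ∞ := by
        rcases ENNReal.rpow_eq_zero_iff.1 this with hx | hx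
        · exact absurd hx.2 (not_lt.2 hq.le)
        · exact hx.1
      have : f x = 0 := by
        by_contra hfx
        simp only [Pi.mul_apply, hxt, ENNReal.mul_top hfx, lt_self_iff_false] at h1
      simp [this, hp]
    · rw [ENNReal.mul_inv (Or.inl ha1) (Or.inl ha2), ENNReal.div_eq_inv_mul, ENNReal.div_eq_inv_mul,
        ENNReal.mul_rpow_of_nonneg _ _ hp'.le, ENNReal.mul_rpow_of_ne_top (by simp [hh0]) h3.ne,
        ← ENNReal.rpow_mul, ← ENNReal.rpow_mul, mul_one_div_cancel hp.ne',
        mul_one_div_cancel hq.ne, ENNReal.rpow_one, ENNReal.rpow_one, ENNReal.inv_rpow,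
        ENNReal.inv_rpow]
      ring
  have hle : ∀ᵐ x ∂μ, ENNReal.ofReal (1 / p) * (f x ^ p / a) ≤
      f x * h x * (a ^ (1 / p) * b ^ (1 / q))⁻¹ + ENNReal.ofReal (-(1 / q)) * (h x ^ q / b) := by
    filter_upwards [hpt] with x ⟨h1, h2, h3, h4⟩
    by_cases h0 : h x ^ q / b = 0
    · rw [h2 h0, mul_zero]; exact zero_le
    · rw [h4 h0]
      exact (ennreal_young hpq h1 h0 h3).1
  have hIa : ∫⁻ x, ENNReal.ofReal (1 / p) * (f x ^ p / a) ∂μ = ENNReal.ofReal (1 / p) := by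
    simp_rw [div_eq_mul_inv]
    rw [lintegral_const_mul'' _ ((hf.pow_const p).mul_const _),
      lintegral_mul_const'' _ (hf.pow_const p), ENNReal.mul_inv_cancel hf0 hft, mul_one]
  have hIb : ∫⁻ x, f x * h x * (a ^ (1 / p) * b ^ (1 / q))⁻¹ +
      ENNReal.ofReal (-(1 / q)) * (h x ^ q / b) ∂μ = ENNReal.ofReal (1 / p) := by
    have hm : AEMeasurable (fun x => f x * h x) μ := hf.mul hh
    have hm' : AEMeasurable (fun x => f x * h x * (a ^ (1 / p) * b ^ (1 / q))⁻¹) μ :=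
      hm.mul_const _
    rw [lintegral_add_left' hm', lintegral_mul_const'' _ hm, heq,
      ENNReal.mul_inv_cancel (mul_ne_zero ha1 hb1) (ENNReal.mul_ne_top ha2 hb2)]
    simp_rw [div_eq_mul_inv (h _ ^ q)]
    rw [lintegral_const_mul'' _ ((hh.pow_const q).mul_const _),
      lintegral_mul_const'' _ (hh.pow_const q), ENNReal.mul_inv_cancel hh0 hht, mul_one,
      ← ENNReal.ofReal_one, ← ENNReal.ofReal_add zero_le_one (by linarith), hpq.one_div_q]
    congr 1
    ring
  -- Both sides of the pointwise inequality integrate to `1/p`, as `1 - 1/q = 1/p` is what the right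
  -- side yields with `1/q = 1 - 1/p` negated: its coefficient of the unit mass is `1 + (-(1/q))`.
  -- Hence equality holds almost everywhere.
  have hae := ae_eq_of_ae_le_of_lintegral_le hle (by rw [hIa]; exact ENNReal.ofReal_ne_top)
    (((hf.mul hh).mul_const _).add (((hh.pow_const q).div_const _).const_mul _)) (by rw [hIa, hIb])
  filter_upwards [hpt, hae] with x ⟨h1, h2, h3, h4⟩ h5
  by_cases h0 : h x ^ q / b = 0
  · rw [h2 h0, h0]
  · rw [h4 h0] at h5
    exact (ennreal_young hpq h1 h0 h3).2 h5

end General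

/-! ### Real powers of extended nonnegative numbers. -/

theorem mul_rpow_of_left_finite {c : ℝ≥0∞} (hc : c ≠ 0) (hc' : c ≠ ∞) (x : ℝ≥0∞) (r : ℝ) :
    (c * x) ^ r = c ^ r * x ^ r := by
  rcases eq_or_ne x 0 with rfl | hx
  · rcases lt_trichotomy r 0 with h | rfl | h
    · simp [ENNReal.zero_rpow_of_neg h, ENNReal.rpow_eq_zero_iff, hc, hc', ENNReal.mul_top]
    · simp
    · simp [ENNReal.zero_rpow_of_pos h]
  · exact ENNReal.mul_rpow_of_ne_zero hc hx r

theorem rpow_le_rpow_of_nonpos {x y : ℝ≥0∞} {r : ℝ} (hr : r ≤ 0) (hxy : x ≤ y) :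
    y ^ r ≤ x ^ r := by
  rw [← neg_neg r, ENNReal.rpow_neg y, ENNReal.rpow_neg x]
  exact ENNReal.inv_le_inv.2 (ENNReal.rpow_le_rpow hxy (neg_nonneg.2 hr))

theorem rpow_ne_zero_of_finite {c : ℝ≥0∞} (hc : c ≠ 0) (hc' : c ≠ ∞) (r : ℝ) : c ^ r ≠ 0 := by
  simp [ENNReal.rpow_eq_zero_iff, hc, hc']

theorem rpow_ne_top_of_finite {c : ℝ≥0∞} (hc : c ≠ 0) (hc' : c ≠ ∞) (r : ℝ) : c ^ r ≠ ∞ := by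
  simp [ENNReal.rpow_eq_top_iff, hc, hc']

/-! ### The Laplace transform, its bilinear form, duality and linear invariance. -/

section

variable {E : Type*} [NormedAddCommGroup E] [InnerProductSpace ℝ E]

/-- The kernel `exp(x·y)` as an extended nonnegative real number. -/
def expInner (x y : E) : ℝ≥0∞ := ENNReal.ofReal (Real.exp (inner ℝ x y))

theorem expInner_ne_zero (x y : E) : expInner x y ≠ 0 := by
  simp [expInner, Real.exp_pos]

theorem expInner_ne_top (x y : E) : expInner x y ≠ ∞ := ENNReal.ofReal_ne_top

theorem expInner_comm (x y : E) : expInner x y = expInner y x := by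
  rw [expInner, real_inner_comm, expInner]

theorem expInner_add_left (x x' y : E) : expInner (x + x') y = expInner x y * expInner x' y := by
  rw [expInner, inner_add_left, Real.exp_add, ENNReal.ofReal_mul (Real.exp_pos _).le]; rfl

theorem expInner_add_right (x y y' : E) : expInner x (y + y') = expInner x y * expInner x y' := by
  rw [expInner_comm, expInner_add_left, expInner_comm y, expInner_comm y']

theorem expInner_zero_left (y : E) : expInner 0 y = 1 := by simp [expInner]

theorem expInner_zero_right (y : E) : expInner y 0 = 1 := by simp [expInner]

theorem expInner_neg_neg (x y : E) : expInner (-x) (-y) = expInner x y := by simp [expInner]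

theorem expInner_mul_neg (x y : E) : expInner x y * expInner (-x) y = 1 := by
  rw [← expInner_add_left, add_neg_cancel, expInner_zero_left]

theorem expInner_rpow (x y : E) (r : ℝ) : expInner x y ^ r = expInner x (r • y) := by
  rw [expInner, ENNReal.ofReal_rpow_of_pos (Real.exp_pos _), ← Real.exp_mul, expInner,
    inner_smul_right, mul_comm]

theorem det_adjoint [FiniteDimensional ℝ E] (T : E →ₗ[ℝ] E) :
    LinearMap.det (LinearMap.adjoint T) = LinearMap.det T := by
  let b := stdOrthonormalBasis ℝ E
  rw [← LinearMap.det_toMatrix b.toBasis, LinearMap.toMatrix_adjoint, Matrix.det_conjTranspose,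
    LinearMap.det_toMatrix]
  simp

variable [FiniteDimensional ℝ E] [MeasurableSpace E] [BorelSpace E]

theorem measurable_expInner : Measurable fun z : E × E => expInner z.1 z.2 := by
  unfold expInner; fun_prop

theorem measurable_expInner_left (y : E) : Measurable fun x : E => expInner x y := by
  unfold expInner; fun_prop

/-- The Laplace transform of a function with values in `[0, ∞]`. -/
def lap (f : E → ℝ≥0∞) (y : E) : ℝ≥0∞ := ∫⁻ x, f x * expInner x y

/-- The `L^r` "norm" of a function with values in `[0, ∞]`, for a real exponent `r ≠ 0`. -/
def nrm (r : ℝ) (f : E → ℝ≥0∞) : ℝ≥0∞ := (∫⁻ x, f x ^ r) ^ (1 / r)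

/-- The bilinear form `∫∫ f(x) g(y) exp(x·y) dx dy`. -/
def form (f g : E → ℝ≥0∞) : ℝ≥0∞ := ∫⁻ x, f x * lap g x

variable {f g h : E → ℝ≥0∞} {p q : ℝ}

theorem measurable_mul_expInner (hf : Measurable f) (y : E) :
    Measurable fun x => f x * expInner x y := hf.mul (measurable_expInner_left y)

theorem measurable_lap (hf : Measurable f) : Measurable (lap f) := by
  have : Measurable fun z : E × E => f z.2 * expInner z.2 z.1 :=
    (hf.comp measurable_snd).mul (measurable_expInner.comp measurable_swap)
  exact this.lintegral_prod_right'

theorem lap_mono (hfg : ∀ x, f x ≤ g x) (y : E) : lap f y ≤ lap g y :=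
  lintegral_mono fun x => by gcongr; exact hfg x

theorem form_eq (f g : E → ℝ≥0∞) (hg : Measurable g) :
    form f g = ∫⁻ x, ∫⁻ y, f x * g y * expInner x y := by
  unfold form lap
  refine lintegral_congr fun x => ?_
  rw [← lintegral_const_mul _ (measurable_mul_expInner hg x)]
  refine lintegral_congr fun y => ?_
  rw [expInner_comm, mul_assoc]

theorem form_comm (hf : Measurable f) (hg : Measurable g) : form f g = form g f := by
  rw [form_eq f g hg, form_eq g f hf, lintegral_lintegral_swap]
  · refine lintegral_congr fun y => lintegral_congr fun x => ?_
    rw [expInner_comm, mul_comm (g y)]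
  · exact (((hf.comp measurable_fst).mul (hg.comp measurable_snd)).mul
      measurable_expInner).aemeasurable

theorem nrm_mul_nrm_le_form (hpq : ReverseConjugate p q) (hf : Measurable f) (hg : Measurable g) :
    nrm p f * nrm q (lap g) ≤ form f g :=
  reverse_holder hpq hf.aemeasurable (measurable_lap hg).aemeasurable

theorem lap_ne_zero (hf : Measurable f) (h0 : ∫⁻ x, f x ^ p ≠ 0) (hp : 0 < p) (y : E) :
    lap f y ≠ 0 := by
  intro h
  apply h0
  unfold lap at h
  rw [lintegral_eq_zero_iff (measurable_mul_expInner hf y)] at h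
  rw [lintegral_eq_zero_iff (hf.pow_const p)]
  filter_upwards [h] with x hx
  have : f x = 0 := by simpa [expInner_ne_zero] using hx
  simp [this, hp]

theorem lap_const_mul (c : ℝ≥0∞) (hf : Measurable f) (y : E) :
    lap (fun x => c * f x) y = c * lap f y := by
  unfold lap
  rw [← lintegral_const_mul _ (measurable_mul_expInner hf y)]
  simp_rw [mul_assoc]

theorem lap_translate (f : E → ℝ≥0∞) (z y : E) :
    lap (fun x => f (x - z)) y = expInner z y * lap f y := by
  unfold lap
  rw [← lintegral_add_right_eq_self _ z, ← lintegral_const_mul' _ _ (expInner_ne_top z y)]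
  refine lintegral_congr fun x => ?_
  simp only [add_sub_cancel_right, expInner_add_left]
  ring

theorem lap_neg (heven : ∀ x, f (-x) = f x) (y : E) : lap f (-y) = lap f y := by
  unfold lap
  rw [← lintegral_neg_eq_self]
  simp_rw [heven, expInner_neg_neg]

/-- The Laplace transform is log-convex. -/
theorem lap_logConvex (hf : Measurable f) {a b : ℝ} (ha : 0 ≤ a) (hb : 0 ≤ b) (hab : a + b = 1)
    (x y : E) : lap f (a • x + b • y) ≤ lap f x ^ a * lap f y ^ b := by
  refine le_trans (le_of_eq ?_) (ENNReal.lintegral_mul_norm_pow_le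
    (hf.mul (measurable_expInner_left x)).aemeasurable
    (hf.mul (measurable_expInner_left y)).aemeasurable ha hb hab)
  refine lintegral_congr fun z => ?_
  simp only [Pi.mul_apply]
  rw [ENNReal.mul_rpow_of_nonneg _ _ ha, ENNReal.mul_rpow_of_nonneg _ _ hb, expInner_rpow,
    expInner_rpow, expInner_add_right]
  have : f z = f z ^ a * f z ^ b := by
    rw [← ENNReal.rpow_add_of_nonneg _ _ ha hb, hab, ENNReal.rpow_one]
  conv_lhs => rw [this]
  ring

/-- The converse of the reverse Hölder inequality. -/
theorem le_nrm_of_forall_le (hpq : ReverseConjugate p q) (hh : Measurable h) {c : ℝ≥0∞}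
    (H : ∀ g : E → ℝ≥0∞, Measurable g → ∫⁻ x, g x ^ p ≠ ∞ →
      (∃ R : ℝ, ∀ x, g x ≠ 0 → ‖x‖ ≤ R) → c * nrm p g ≤ ∫⁻ x, g x * h x) : c ≤ nrm q h := by
  have hp := hpq.pos
  have hq := hpq.q_neg
  rcases eq_or_ne c 0 with rfl | hc0
  · exact zero_le
  have hbd : ∀ j : ℕ, MeasurableSet {x : E | ‖x‖ ≤ j} :=
    fun j => measurableSet_le measurable_norm measurable_const
  have hfin : ∀ j : ℕ, volume {x : E | ‖x‖ ≤ j} ≠ ∞ := fun j => by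
    have : {x : E | ‖x‖ ≤ j} = Metric.closedBall 0 j := by ext; simp
    rw [this]; exact measure_closedBall_lt_top.ne
  -- Testing with the indicator of a bounded piece of the zero set of `h` makes the right side of
  -- `H` zero, so that piece is null.
  have hpos : ∀ᵐ x, h x ≠ 0 := by
    have key : ∀ j : ℕ, volume ({x | h x = 0} ∩ {x : E | ‖x‖ ≤ j}) = 0 := by
      intro j
      set S := {x | h x = 0} ∩ {x : E | ‖x‖ ≤ j} with hS
      have hSm : MeasurableSet S := (hh (measurableSet_singleton 0)).inter (hbd j)
      have hSp : ∀ x, S.indicator (fun _ => (1 : ℝ≥0∞)) x ^ p = S.indicator (fun _ => 1) x := by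
        intro x
        by_cases hx : x ∈ S <;> simp [hx, hp]
      have hint : ∫⁻ x, S.indicator (fun _ => (1 : ℝ≥0∞)) x ^ p = volume S := by
        simp_rw [hSp]
        rw [lintegral_indicator hSm]; simp
      have h1 := H (S.indicator fun _ => 1) (measurable_const.indicator hSm)
        (by rw [hint]; exact ((measure_mono Set.inter_subset_right).trans_lt
              (hfin j).lt_top).ne)
        ⟨j, fun x hx => by
          by_contra hcon
          exact hx (Set.indicator_of_notMem (fun h => hcon h.2) _)⟩
      have h2 : ∫⁻ x, S.indicator (fun _ => (1 : ℝ≥0∞)) x * h x = 0 := by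
        refine lintegral_eq_zero_of_ae_eq_zero (Filter.Eventually.of_forall fun x => ?_)
        by_cases hx : x ∈ S
        · have : h x = 0 := hx.1
          simp [this]
        · simp [hx]
      rw [h2, nonpos_iff_eq_zero, mul_eq_zero, or_iff_right hc0, nrm, hint,
        ENNReal.rpow_eq_zero_iff] at h1
      rcases h1 with h1 | h1
      · exact h1.1
      · exact absurd h1.2 (not_lt.2 (one_div_pos.2 hp).le)
    have : {x | h x = 0} = ⋃ j : ℕ, {x | h x = 0} ∩ {x : E | ‖x‖ ≤ j} := by
      ext x
      simp only [Set.mem_ofPred_eq, Set.mem_iUnion, Set.mem_inter_iff, exists_and_left,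
        iff_self_and]
      exact fun _ => exists_nat_ge _
    rw [ae_iff]
    simp only [not_not]
    rw [this]
    exact measure_iUnion_null key
  -- Truncation in space and in the size of `h ^ q` keeps the integral `A` finite, so that it can be
  -- cancelled.
  set S : ℕ → Set E := fun j => {x | ‖x‖ ≤ j} ∩ {x | h x ^ q ≤ j} with hSdef
  have hSm : ∀ j, MeasurableSet (S j) := fun j =>
    (hbd j).inter (measurableSet_le (hh.pow_const q) measurable_const)
  have hmono : Monotone S := by
    intro i j hij x hx
    have : (i : ℝ≥0∞) ≤ j := by exact_mod_cast hij
    have h1 : ‖x‖ ≤ i := hx.1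
    have h2 : h x ^ q ≤ i := hx.2
    exact ⟨h1.trans (by exact_mod_cast hij), h2.trans this⟩
  have hA : ∀ j, ∫⁻ x in S j, h x ^ q ≤ c ^ q := by
    intro j
    set A := ∫⁻ x in S j, h x ^ q with hAdef
    have hAt : A ≠ ∞ := by
      refine ((lintegral_mono_ae (g := fun _ => (j : ℝ≥0∞)) ?_).trans_lt ?_).ne
      · exact (ae_restrict_iff' (hSm j)).2 (Filter.Eventually.of_forall fun x hx => hx.2)
      · rw [lintegral_const, Measure.restrict_apply_univ]
        exact ENNReal.mul_lt_top (by simp)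
          ((measure_mono Set.inter_subset_left).trans_lt (hfin j).lt_top)
    rcases eq_or_ne A 0 with hA0 | hA0
    · rw [hA0]; exact zero_le
    -- The equality case of reverse Hölder on `S j`: both `g ^ p` and `g h` equal `h ^ q` there, up
    -- to a null set.
    set g := (S j).indicator fun x => h x ^ (q - 1) with hg
    have hgm : Measurable g := (hh.pow_const _).indicator (hSm j)
    have hgp : ∫⁻ x, g x ^ p = A := by
      rw [hAdef, ← lintegral_indicator (hSm j)]
      refine lintegral_congr fun x => ?_
      by_cases hx : x ∈ S j
      · simp only [hg, Set.indicator_of_mem hx]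
        rw [← ENNReal.rpow_mul, hpq.sub_one_mul]
      · simp [hg, hx, hp]
    have hgh : ∫⁻ x, g x * h x = A := by
      rw [hAdef, ← lintegral_indicator (hSm j)]
      refine lintegral_congr_ae ?_
      filter_upwards [hpos] with x hx0
      by_cases hx : x ∈ S j
      · simp only [hg, Set.indicator_of_mem hx]
        rcases eq_or_ne (h x) ∞ with ht | ht
        · rw [ht, ENNReal.top_rpow_of_neg (by linarith), ENNReal.top_rpow_of_neg hq, zero_mul]
        · conv_lhs => rw [← ENNReal.rpow_one (h x)]
          rw [← ENNReal.rpow_mul, one_mul, ← ENNReal.rpow_add _ _ hx0 ht, sub_add_cancel]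
      · simp [hg, hx]
    have h1 := H g hgm (by rw [hgp]; exact hAt) ⟨j, fun x hx => by
      by_contra hcon
      exact hx (Set.indicator_of_notMem (fun h => hcon h.1) _)⟩
    rw [nrm, hgp, hgh] at h1
    have h2 : c ≤ A ^ (1 / q) := by
      calc c = c * A ^ (1 / p) * A ^ (-(1 / p)) := by
            rw [mul_assoc, ← ENNReal.rpow_add _ _ hA0 hAt]; simp
        _ ≤ A * A ^ (-(1 / p)) := by gcongr
        _ = A ^ (1 / q) := by
            rw [hpq.one_div_q]
            nth_rw 1 [← ENNReal.rpow_one A]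
            rw [← ENNReal.rpow_add _ _ hA0 hAt]; ring_nf
    calc A = (A ^ (1 / q)) ^ q := by
          rw [← ENNReal.rpow_mul, one_div_mul_cancel hq.ne, ENNReal.rpow_one]
      _ ≤ c ^ q := rpow_le_rpow_of_nonpos hq.le h2
  have hall : ∫⁻ x, h x ^ q ≤ c ^ q := by
    have hU : ∫⁻ x in ⋃ j, S j, h x ^ q = ∫⁻ x, h x ^ q := by
      rw [Measure.restrict_eq_self_of_ae_mem]
      filter_upwards [hpos] with x hx
      have ht : h x ^ q ≠ ∞ := by
        intro ht
        rcases ENNReal.rpow_eq_top_iff.1 ht with ht | ht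
        · exact hx ht.1
        · exact absurd ht.2 (not_lt.2 hq.le)
      obtain ⟨i, hi⟩ := exists_nat_ge ‖x‖
      obtain ⟨k, hk⟩ := ENNReal.exists_nat_gt ht
      refine Set.mem_iUnion.2 ⟨max i k, ?_, ?_⟩
      · exact hi.trans (by exact_mod_cast le_max_left _ _)
      · exact hk.le.trans (by exact_mod_cast le_max_right _ _)
    rw [← hU, setLIntegral_iUnion_of_directed _ hmono.directed_le]
    exact iSup_le hA
  calc c = (c ^ q) ^ (1 / q) := by
        rw [← ENNReal.rpow_mul, mul_one_div_cancel hq.ne, ENNReal.rpow_one]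
    _ ≤ nrm q h := rpow_le_rpow_of_nonpos hpq.one_div_q_neg.le hall

theorem lintegral_comp_linearEquiv (T : E ≃ₗ[ℝ] E) (F : E → ℝ≥0∞) :
    ∫⁻ x, F (T x) = (ENNReal.ofReal |LinearMap.det (T : E →ₗ[ℝ] E)|)⁻¹ * ∫⁻ x, F x := by
  have hdet : LinearMap.det (T : E →ₗ[ℝ] E) ≠ 0 := (LinearEquiv.isUnit_det' T).ne_zero
  have h1 := Measure.map_linearMap_addHaar_eq_smul_addHaar (volume : Measure E) hdet
  let e : E ≃ᵐ E := T.toContinuousLinearEquiv.toHomeomorph.toMeasurableEquiv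
  have h2 : ∫⁻ x, F (T x) = ∫⁻ x, F x ∂(Measure.map e volume) := (lintegral_map_equiv F e).symm
  have h3 : Measure.map e volume = Measure.map (T : E →ₗ[ℝ] E) volume := rfl
  rw [h2, h3, h1, lintegral_smul_measure, abs_inv, smul_eq_mul,
    ENNReal.ofReal_inv_of_pos (abs_pos.2 hdet)]

/-- The quotient `‖Lf‖_q / ‖f‖_p` is invariant under scalings and linear changes of variables. -/
theorem exists_nrm_comp_linearEquiv (hpq : ReverseConjugate p q) (hf : Measurable f) {c : ℝ≥0∞}
    (hc : c ≠ 0) (hc' : c ≠ ∞) (T : E ≃ₗ[ℝ] E) :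
    ∃ K : ℝ≥0∞, K ≠ 0 ∧ K ≠ ∞ ∧ nrm p (fun x => c * f (T x)) = K * nrm p f ∧
      nrm q (lap fun x => c * f (T x)) = K * nrm q (lap f) := by
  have hp := hpq.pos
  have hq := hpq.q_neg
  set T' : E →ₗ[ℝ] E := T.toLinearMap
  have hdet : LinearMap.det T' ≠ 0 := (LinearEquiv.isUnit_det' T).ne_zero
  set d := ENNReal.ofReal |LinearMap.det T'| with hd
  have hd0 : d ≠ 0 := by simpa [hd] using hdet
  have hdt : d ≠ ∞ := ENNReal.ofReal_ne_top
  have hTm : Measurable fun x => f (T x) :=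
    hf.comp (LinearMap.continuous_of_finiteDimensional T').measurable
  have hlap : ∀ y, lap (fun x => c * f (T x)) (LinearMap.adjoint T' y) = c * d⁻¹ * lap f y := by
    intro y
    rw [lap_const_mul c hTm, mul_assoc]
    congr 1
    rw [lap, lap, ← lintegral_comp_linearEquiv T]
    refine lintegral_congr fun x => ?_
    rw [expInner, LinearMap.adjoint_inner_right]; rfl
  have hdet' : LinearMap.det (LinearMap.adjoint T') ≠ 0 := by rwa [det_adjoint]
  let S : E ≃ₗ[ℝ] E := LinearMap.equivOfDetNeZero _ hdet'
  have hS := lintegral_comp_linearEquiv S fun y => lap (fun x => c * f (T x)) y ^ q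
  have hS1 : ∀ y, S y = LinearMap.adjoint T' y := fun y => rfl
  have hS2 : LinearMap.det (S : E →ₗ[ℝ] E) = LinearMap.det T' := det_adjoint T'
  have hcd : c * d⁻¹ ≠ 0 := mul_ne_zero hc (ENNReal.inv_ne_zero.2 hdt)
  have hcd' : c * d⁻¹ ≠ ∞ := ENNReal.mul_ne_top hc' (ENNReal.inv_ne_top.2 hd0)
  rw [hS2, ← hd] at hS
  simp_rw [hS1, hlap, mul_rpow_of_left_finite hcd hcd'] at hS
  rw [lintegral_const_mul _ ((measurable_lap hf).pow_const q)] at hS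
  have hS3 : ∫⁻ y, lap (fun x => c * f (T x)) y ^ q =
      d * ((c * d⁻¹) ^ q * ∫⁻ y, lap f y ^ q) := by
    rw [hS, ← mul_assoc, ENNReal.mul_inv_cancel hd0 hdt, one_mul]
  -- On the `L^p` side the factor is `c d^(-1/p)`; on the other side it is `c d^(-1) d^(1/q)`, the
  -- same because `1/p + 1/q = 1`.
  refine ⟨c * d ^ (-(1 / p)), mul_ne_zero hc (rpow_ne_zero_of_finite hd0 hdt _),
    ENNReal.mul_ne_top hc' (rpow_ne_top_of_finite hd0 hdt _), ?_, ?_⟩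
  · rw [nrm]
    simp_rw [mul_rpow_of_left_finite hc hc']
    rw [lintegral_const_mul _ (hTm.pow_const p), lintegral_comp_linearEquiv T fun x => f x ^ p,
      ENNReal.mul_rpow_of_nonneg _ _ (one_div_pos.2 hp).le,
      ENNReal.mul_rpow_of_nonneg _ _ (one_div_pos.2 hp).le, ← ENNReal.rpow_mul,
      mul_one_div_cancel hp.ne', ENNReal.rpow_one, ENNReal.inv_rpow, ← ENNReal.rpow_neg, nrm,
      mul_assoc]
  · rw [nrm, hS3, mul_rpow_of_left_finite hd0 hdt, mul_rpow_of_left_finite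
      (rpow_ne_zero_of_finite hcd hcd' _) (rpow_ne_top_of_finite hcd hcd' _), ← ENNReal.rpow_mul,
      mul_one_div_cancel hq.ne, ENNReal.rpow_one, nrm, ← mul_assoc]
    congr 1
    rw [mul_left_comm]
    congr 1
    rw [← ENNReal.rpow_neg_one, ← ENNReal.rpow_add _ _ hd0 hdt, hpq.one_div_q]
    congr 1
    ring

end

/-! ### Exponential growth of the Laplace transform of an even function. -/

section

variable {E : Type*} [NormedAddCommGroup E] [InnerProductSpace ℝ E] [FiniteDimensional ℝ E]
  [MeasurableSpace E] [BorelSpace E] {f : E → ℝ≥0∞} {p q : ℝ}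

theorem integrable_exp_neg_mul_norm {δ : ℝ} (hδ : 0 < δ) :
    Integrable fun x : E => Real.exp (-(δ * ‖x‖)) := by
  set r : ℕ := Module.finrank ℝ E + 1 with hr
  have h1 : Integrable fun x : E => (1 + ‖x‖) ^ (-(r : ℝ)) :=
    integrable_one_add_norm (by rw [hr]; push_cast; linarith)
  refine (h1.const_mul (Real.exp δ * r.factorial / δ ^ r)).mono'
    (by fun_prop) (Filter.Eventually.of_forall fun x => ?_)
  have hx : 0 < 1 + ‖x‖ := by positivity
  have h2 := Real.pow_div_factorial_le_exp (δ * (1 + ‖x‖)) (by positivity) r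
  rw [Real.norm_of_nonneg (Real.exp_pos _).le, Real.rpow_neg hx.le, Real.rpow_natCast,
    Real.exp_neg]
  rw [mul_add, mul_one, Real.exp_add, div_le_iff₀ (by positivity), ← mul_one_add, mul_pow] at h2
  rw [inv_le_iff_one_le_mul₀ (Real.exp_pos _)]
  field_simp
  rw [mul_comm ‖x‖ δ]
  linarith

theorem lintegral_exp_neg_mul_norm_ne_top {δ : ℝ} (hδ : 0 < δ) :
    ∫⁻ x : E, ENNReal.ofReal (Real.exp (-(δ * ‖x‖))) ≠ ∞ := by
  have h := (integrable_exp_neg_mul_norm (E := E) hδ).lintegral_lt_top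
  exact h.ne

theorem volume_inner_eq_zero {y : E} (hy : y ≠ 0) : volume {x : E | inner ℝ x y = 0} = 0 := by
  have h : {x : E | inner ℝ x y = 0} = (LinearMap.ker (innerₛₗ ℝ y) : Set E) := by
    ext x
    simp [real_inner_comm]
  rw [h]
  refine Measure.addHaar_submodule _ _ fun htop => hy ?_
  have : y ∈ LinearMap.ker (innerₛₗ ℝ y) := htop ▸ Submodule.mem_top
  simpa using this

/-- The right side is positively homogeneous and continuous in `y`, and positive for `y ≠ 0` because
hyperplanes are null. Its minimum on the unit sphere serves as `m`. -/
theorem exists_pos_mul_norm_le_integral_abs_inner {S : Set E} (hSm : MeasurableSet S)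
    (hS0 : volume S ≠ 0) (hSt : volume S ≠ ∞) {R : ℝ} (hR : ∀ x ∈ S, ‖x‖ ≤ R) :
    ∃ m : ℝ, 0 < m ∧ ∀ y : E, m * ‖y‖ ≤ ∫ x in S, |inner ℝ x y| := by
  have hint : ∀ y : E, IntegrableOn (fun x => |inner ℝ x y|) S := fun y =>
    Measure.integrableOn_of_bounded (M := R * ‖y‖) hSt (by fun_prop)
      ((ae_restrict_iff' hSm).2 (Filter.Eventually.of_forall fun x hx => by
        rw [Real.norm_eq_abs, abs_abs]
        exact (abs_real_inner_le_norm x y).trans (by gcongr; exact hR x hx)))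
  have hcont : Continuous fun y : E => ∫ x in S, |inner ℝ x y| := by
    refine continuous_iff_continuousAt.2 fun y₀ => ?_
    refine continuousAt_of_dominated (bound := fun _ => |R| * (‖y₀‖ + 1))
      (Filter.Eventually.of_forall fun y => by fun_prop) ?_ ?_ ?_
    · filter_upwards [Metric.ball_mem_nhds y₀ one_pos] with y hy
      refine (ae_restrict_iff' hSm).2 (Filter.Eventually.of_forall fun x hx => ?_)
      rw [Real.norm_eq_abs, abs_abs]
      refine (abs_real_inner_le_norm x y).trans ?_
      have h1 : ‖y‖ ≤ ‖y₀‖ + 1 := by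
        have := norm_le_norm_add_norm_sub' y y₀
        rw [mem_ball_iff_norm] at hy
        linarith
      exact mul_le_mul ((hR x hx).trans (le_abs_self R)) h1 (norm_nonneg _) (abs_nonneg _)
    · exact integrableOn_const hSt
    · exact Filter.Eventually.of_forall fun x => by fun_prop
  have hpos : ∀ y : E, y ≠ 0 → 0 < ∫ x in S, |inner ℝ x y| := by
    intro y hy
    refine lt_of_le_of_ne (integral_nonneg fun x => abs_nonneg _) fun h0 => hS0 ?_
    have h1 := (integral_eq_zero_iff_of_nonneg (fun x => abs_nonneg _) (hint y)).1 h0.symm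
    have h2 := (ae_restrict_iff' hSm).1 h1
    refine measure_mono_null_ae ?_ (volume_inner_eq_zero hy)
    filter_upwards [h2] with x hx hxS
    have h3 : inner ℝ x y = 0 := by simpa using hx hxS
    exact h3
  by_cases hne : (Metric.sphere (0 : E) 1).Nonempty
  · obtain ⟨y₀, hy₀, hmin⟩ := (isCompact_sphere (0 : E) 1).exists_isMinOn hne hcont.continuousOn
    have hy₀' : ‖y₀‖ = 1 := by simpa using hy₀
    refine ⟨_, hpos y₀ (by rintro rfl; simp at hy₀'), fun y => ?_⟩
    rcases eq_or_ne y 0 with rfl | hy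
    · simp
    have hny : 0 < ‖y‖ := norm_pos_iff.2 hy
    have h1 := hmin (a := ‖y‖⁻¹ • y) (by simp [norm_smul, hny.ne'])
    have h2 : ∫ x in S, |inner ℝ x (‖y‖⁻¹ • y)| = ‖y‖⁻¹ * ∫ x in S, |inner ℝ x y| := by
      rw [← integral_const_mul]
      refine integral_congr_ae (Filter.Eventually.of_forall fun x => ?_)
      simp [inner_smul_right, abs_mul]
    have h3 : ∫ x in S, |inner ℝ x y₀| ≤ ‖y‖⁻¹ * ∫ x in S, |inner ℝ x y| := h2 ▸ h1
    rw [← div_eq_inv_mul, le_div_iff₀ hny] at h3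
    exact h3
  -- An empty unit sphere means dimension zero, where `y = 0`.
  · refine ⟨1, one_pos, fun y => ?_⟩
    rcases eq_or_ne y 0 with rfl | hy
    · simp
    · have hny : 0 < ‖y‖ := norm_pos_iff.2 hy
      exact absurd ⟨‖y‖⁻¹ • y, by simp [norm_smul, hny.ne']⟩ hne

/-- The Laplace transform of an even nonzero function grows at least exponentially. -/
theorem exists_exp_le_lap (hf : Measurable f) (heven : ∀ x, f (-x) = f x) (hp : 0 < p)
    (h0 : ∫⁻ x, f x ^ p ≠ 0) :
    ∃ c δ : ℝ, 0 < c ∧ 0 < δ ∧ ∀ y, ENNReal.ofReal (c * Real.exp (δ * ‖y‖)) ≤ lap f y := by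
  -- On some bounded set of positive measure, `f` is bounded below by a positive constant.
  obtain ⟨k, hk⟩ : ∃ k : ℕ, volume ({x | ((k : ℝ≥0∞) + 1)⁻¹ ≤ f x} ∩ {x : E | ‖x‖ ≤ k}) ≠ 0 := by
    by_contra! hcon
    apply h0
    have hnull : volume (⋃ k : ℕ, {x | ((k : ℝ≥0∞) + 1)⁻¹ ≤ f x} ∩ {x : E | ‖x‖ ≤ k}) = 0 :=
      measure_iUnion_null hcon
    rw [lintegral_eq_zero_iff (hf.pow_const p)]
    filter_upwards [measure_eq_zero_iff_ae_notMem.1 hnull] with x hx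
    have : f x = 0 := by
      by_contra hfx
      apply hx
      obtain ⟨i, hi⟩ := exists_nat_ge ‖x‖
      obtain ⟨j, hj⟩ := ENNReal.exists_inv_nat_lt hfx
      refine Set.mem_iUnion.2 ⟨max i j, ?_, hi.trans (by exact_mod_cast le_max_left _ _)⟩
      refine le_trans (ENNReal.inv_le_inv.2 ?_) hj.le
      have : (j : ℝ≥0∞) ≤ (max i j : ℕ) := by exact_mod_cast le_max_right _ _
      exact this.trans le_self_add
    simp [this, hp]
  set S := {x | ((k : ℝ≥0∞) + 1)⁻¹ ≤ f x} ∩ {x : E | ‖x‖ ≤ k} with hS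
  have hSm : MeasurableSet S := (measurableSet_le measurable_const hf).inter
    (measurableSet_le measurable_norm measurable_const)
  have hSt : volume S ≠ ∞ := by
    refine ((measure_mono (Set.inter_subset_right.trans ?_)).trans_lt
      (measure_closedBall_lt_top (x := (0 : E)) (r := k))).ne
    intro x hx
    simpa using hx
  have hSR : ∀ x ∈ S, ‖x‖ ≤ (k : ℝ) := fun x hx => hx.2
  obtain ⟨m, hm, hmS⟩ := exists_pos_mul_norm_le_integral_abs_inner hSm hk hSt hSR
  set v := (volume S).toReal with hv
  have hv0 : 0 < v := ENNReal.toReal_pos hk hSt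
  set ε : ℝ := ((k : ℝ) + 1)⁻¹ with hε
  have hε0 : 0 < ε := by positivity
  have hεe : ((k : ℝ≥0∞) + 1)⁻¹ = ENNReal.ofReal ε := by
    rw [hε, ENNReal.ofReal_inv_of_pos (by positivity), ENNReal.ofReal_add (by positivity) (by simp)]
    simp
  refine ⟨ε * v / 2, m / v, by positivity, by positivity, fun y => ?_⟩
  set a := m * ‖y‖ / v with ha
  have hint : IntegrableOn (fun x => |inner ℝ x y|) S :=
    Measure.integrableOn_of_bounded (M := k * ‖y‖) hSt (by fun_prop)
      ((ae_restrict_iff' hSm).2 (Filter.Eventually.of_forall fun x hx => by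
        rw [Real.norm_eq_abs, abs_abs]
        exact (abs_real_inner_le_norm x y).trans (by gcongr; exact hSR x hx)))
  have hint2 : IntegrableOn (fun x => Real.exp |inner ℝ x y|) S :=
    Measure.integrableOn_of_bounded (M := Real.exp (k * ‖y‖)) hSt (by fun_prop)
      ((ae_restrict_iff' hSm).2 (Filter.Eventually.of_forall fun x hx => by
        rw [Real.norm_eq_abs, Real.abs_exp]
        exact Real.exp_le_exp.2 ((abs_real_inner_le_norm x y).trans (by gcongr; exact hSR x hx))))
  -- Jensen's inequality by hand: `exp` lies above its tangent at `a`, and `a` is a lower bound for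
  -- the mean of `|x·y|` over `S`.
  have hJ : v * Real.exp a ≤ ∫ x in S, Real.exp |inner ℝ x y| := by
    have h1 : ∫ x in S, (Real.exp a * (1 - a) + Real.exp a * |inner ℝ x y|) ≤
        ∫ x in S, Real.exp |inner ℝ x y| := by
      refine integral_mono ((integrableOn_const hSt).add (hint.const_mul _)) hint2 fun x => ?_
      have := Real.add_one_le_exp (|inner ℝ x y| - a)
      have h2 := mul_le_mul_of_nonneg_left this (Real.exp_pos a).le
      rw [← Real.exp_add, add_sub_cancel] at h2
      simp only
      linarith
    have hcst : IntegrableOn (fun _ : E => Real.exp a * (1 - a)) S := integrableOn_const hSt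
    rw [integral_add hcst (hint.const_mul _),
      integral_const_mul (Real.exp a) fun x => |inner ℝ x y|,
      setIntegral_const, smul_eq_mul, Measure.real, ← hv] at h1
    have h3 : Real.exp a * (m * ‖y‖) ≤ Real.exp a * ∫ x in S, |inner ℝ x y| :=
      mul_le_mul_of_nonneg_left (hmS y) (Real.exp_pos a).le
    have h4 : m * ‖y‖ = v * a := by rw [ha]; field_simp
    rw [h4] at h3
    nlinarith [h1, h3]
  -- Since `exp |t| ≤ exp t + exp (-t)`, the bound involves `Lf(y) + Lf(-y)`, which evenness turns
  -- into `2 Lf(y)`.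
  have h2 : ENNReal.ofReal (ε * (v * Real.exp a)) ≤ lap f y + lap f (-y) := by
    calc ENNReal.ofReal (ε * (v * Real.exp a))
        ≤ ENNReal.ofReal (ε * ∫ x in S, Real.exp |inner ℝ x y|) := by gcongr
      _ = ENNReal.ofReal ε * ∫⁻ x in S, ENNReal.ofReal (Real.exp |inner ℝ x y|) := by
          rw [ENNReal.ofReal_mul hε0.le, ofReal_integral_eq_lintegral_ofReal hint2
            (Filter.Eventually.of_forall fun x => (Real.exp_pos _).le)]
      _ = ∫⁻ x in S, ENNReal.ofReal ε * ENNReal.ofReal (Real.exp |inner ℝ x y|) := by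
          rw [lintegral_const_mul']; exact ENNReal.ofReal_ne_top
      _ ≤ ∫⁻ x in S, f x * expInner x y + f x * expInner x (-y) := by
          refine setLIntegral_mono ((measurable_mul_expInner hf y).add
            (measurable_mul_expInner hf (-y))) fun x hx => ?_
          rw [← mul_add]
          refine mul_le_mul' (hεe ▸ hx.1) ?_
          rw [expInner, expInner, ← ENNReal.ofReal_add (Real.exp_pos _).le (Real.exp_pos _).le]
          refine ENNReal.ofReal_le_ofReal ?_
          rw [inner_neg_right]
          rcases abs_cases (inner ℝ x y) with ⟨h, _⟩ | ⟨h, _⟩ <;> rw [h]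
          · linarith [Real.exp_pos (-inner ℝ x y)]
          · linarith [Real.exp_pos (inner ℝ x y)]
      _ ≤ ∫⁻ x, f x * expInner x y + f x * expInner x (-y) := setLIntegral_le_lintegral _ _
      _ = _ := lintegral_add_left (measurable_mul_expInner hf y) _
  rw [lap_neg heven, ← two_mul] at h2
  have h3 : ENNReal.ofReal (ε * v / 2 * Real.exp (m / v * ‖y‖)) =
      2⁻¹ * ENNReal.ofReal (ε * (v * Real.exp a)) := by
    rw [show (2 : ℝ≥0∞)⁻¹ = ENNReal.ofReal 2⁻¹ by
      rw [ENNReal.ofReal_inv_of_pos two_pos]; simp, ← ENNReal.ofReal_mul (by norm_num)]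
    rw [show m / v * ‖y‖ = a by rw [ha]; ring]
    congr 1
    ring
  rw [h3]
  calc _ ≤ 2⁻¹ * (2 * lap f y) := by gcongr
    _ = lap f y := by
      rw [← mul_assoc, ENNReal.inv_mul_cancel two_ne_zero ENNReal.ofNat_ne_top, one_mul]

theorem exists_lap_rpow_le (hf : Measurable f) (heven : ∀ x, f (-x) = f x) (hp : 0 < p)
    (h0 : ∫⁻ x, f x ^ p ≠ 0) (hq : q < 0) :
    ∃ c δ : ℝ, 0 < c ∧ 0 < δ ∧ ∀ y, lap f y ^ q ≤ ENNReal.ofReal (c * Real.exp (-(δ * ‖y‖))) := by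
  obtain ⟨c, δ, hc, hδ, h⟩ := exists_exp_le_lap hf heven hp h0
  refine ⟨c ^ q, -q * δ, by positivity, by nlinarith, fun y => ?_⟩
  refine (rpow_le_rpow_of_nonpos hq.le (h y)).trans (le_of_eq ?_)
  rw [ENNReal.ofReal_rpow_of_pos (by positivity), Real.mul_rpow hc.le (Real.exp_pos _).le,
    ← Real.exp_mul]
  congr 3
  ring

theorem lintegral_lap_rpow_ne_top (hf : Measurable f) (heven : ∀ x, f (-x) = f x) (hp : 0 < p)
    (h0 : ∫⁻ x, f x ^ p ≠ 0) (hq : q < 0) : ∫⁻ y, lap f y ^ q ≠ ∞ := by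
  obtain ⟨c, δ, hc, hδ, h⟩ := exists_lap_rpow_le hf heven hp h0 hq
  refine ((lintegral_mono h).trans_lt ?_).ne
  simp_rw [ENNReal.ofReal_mul hc.le]
  rw [lintegral_const_mul' _ _ ENNReal.ofReal_ne_top]
  exact ENNReal.mul_lt_top ENNReal.ofReal_lt_top (lintegral_exp_neg_mul_norm_ne_top hδ).lt_top

end

/-! ### The rotation in `E × E`, twists and doubling. -/

/-- The number `1 / √2`. -/
def invSqrtTwo : ℝ := (Real.sqrt 2)⁻¹

theorem invSqrtTwo_pos : 0 < invSqrtTwo := by unfold invSqrtTwo; positivity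

theorem invSqrtTwo_mul_self : invSqrtTwo * invSqrtTwo = 1 / 2 := by
  rw [invSqrtTwo, ← mul_inv, Real.mul_self_sqrt (by norm_num)]; norm_num

section

variable {E : Type*} [NormedAddCommGroup E] [InnerProductSpace ℝ E]

/-- The involution `(x, u) ↦ ((x + u)/√2, (x - u)/√2)`. -/
def rot : E × E →ₗ[ℝ] E × E where
  toFun z := (invSqrtTwo • (z.1 + z.2), invSqrtTwo • (z.1 - z.2))
  map_add' a b := by ext <;> simp only [Prod.fst_add, Prod.snd_add] <;> module
  map_smul' c a := by ext <;> simp only [Prod.smul_fst, Prod.smul_snd, RingHom.id_apply] <;> module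

theorem rot_apply (x u : E) : rot (x, u) = (invSqrtTwo • (x + u), invSqrtTwo • (x - u)) := rfl

theorem rot_rot (z : E × E) : rot (rot z) = z := by
  have h : invSqrtTwo * invSqrtTwo + invSqrtTwo * invSqrtTwo = 1 := by
    rw [invSqrtTwo_mul_self]; norm_num
  obtain ⟨x, u⟩ := z
  rw [rot_apply, rot_apply]
  ext
  · calc _ = (invSqrtTwo * invSqrtTwo + invSqrtTwo * invSqrtTwo) • x := by simp only; module
      _ = x := by rw [h, one_smul]
  · calc _ = (invSqrtTwo * invSqrtTwo + invSqrtTwo * invSqrtTwo) • u := by simp only; module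
      _ = u := by rw [h, one_smul]

theorem expInner_rot (x u y v : E) :
    expInner (invSqrtTwo • (x + u)) (invSqrtTwo • (y + v)) *
      expInner (invSqrtTwo • (x - u)) (invSqrtTwo • (y - v)) = expInner x y * expInner u v := by
  simp only [expInner]
  rw [← ENNReal.ofReal_mul (Real.exp_pos _).le, ← ENNReal.ofReal_mul (Real.exp_pos _).le,
    ← Real.exp_add, ← Real.exp_add]
  congr 2
  simp only [inner_smul_left, inner_smul_right, inner_add_left, inner_add_right, inner_sub_left,
    inner_sub_right, RCLike.conj_to_real]
  linear_combination (2 * (inner ℝ x y + inner ℝ u v)) * invSqrtTwo_mul_self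

variable [FiniteDimensional ℝ E] [MeasurableSpace E] [BorelSpace E]

/-- A linear involution has determinant of square one, hence of absolute value one. -/
theorem measurePreserving_rot :
    MeasurePreserving (rot : E × E → E × E) (volume.prod volume) (volume.prod volume) := by
  have hdet : LinearMap.det (rot : E × E →ₗ[ℝ] E × E) * LinearMap.det (rot : E × E →ₗ[ℝ] E × E)
      = 1 := by
    rw [← LinearMap.det_comp]
    have : (rot : E × E →ₗ[ℝ] E × E) ∘ₗ rot = LinearMap.id := LinearMap.ext rot_rot
    rw [this, LinearMap.det_id]
  have hdet0 : LinearMap.det (rot : E × E →ₗ[ℝ] E × E) ≠ 0 := left_ne_zero_of_mul_eq_one hdet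
  have habs : |LinearMap.det (rot : E × E →ₗ[ℝ] E × E)| = 1 := by
    rcases mul_self_eq_one_iff.1 hdet with h | h <;> simp [h]
  refine ⟨(LinearMap.continuous_of_finiteDimensional _).measurable, ?_⟩
  rw [Measure.map_linearMap_addHaar_eq_smul_addHaar _ hdet0, abs_inv, habs]
  simp

theorem lintegral_rot {H : E → E → ℝ≥0∞} (hH : Measurable fun z : E × E => H z.1 z.2) :
    ∫⁻ x, ∫⁻ u, H (invSqrtTwo • (x + u)) (invSqrtTwo • (x - u)) = ∫⁻ a, ∫⁻ b, H a b := by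
  have h1 := lintegral_prod (μ := (volume : Measure E)) (ν := (volume : Measure E)) _
      hH.aemeasurable
  have h2 := (measurePreserving_rot (E := E)).lintegral_comp hH
  have h3 := lintegral_prod (μ := (volume : Measure E)) (ν := (volume : Measure E)) _
    (hH.comp (measurePreserving_rot (E := E)).measurable).aemeasurable
  rw [← h1, ← h2]
  exact h3.symm

/-- The function `u ↦ f((x + u)/√2) f((x - u)/√2)`. -/
def twist (f : E → ℝ≥0∞) (x u : E) : ℝ≥0∞ :=
  f (invSqrtTwo • (x + u)) * f (invSqrtTwo • (x - u))

/-- The `L^p` norm of `twist f x` as a function of `x`. -/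
def doubled (p : ℝ) (f : E → ℝ≥0∞) (x : E) : ℝ≥0∞ := nrm p (twist f x)

variable {f g : E → ℝ≥0∞} {p q : ℝ}

theorem measurable_twist_uncurry (hf : Measurable f) :
    Measurable fun z : E × E => twist f z.1 z.2 := by
  unfold twist; fun_prop

theorem measurable_twist (hf : Measurable f) (x : E) : Measurable (twist f x) := by
  unfold twist; fun_prop

theorem twist_neg (f : E → ℝ≥0∞) (x u : E) : twist f x (-u) = twist f x u := by
  unfold twist
  rw [mul_comm, sub_neg_eq_add, ← sub_eq_add_neg]

theorem twist_neg_left (heven : ∀ x, f (-x) = f x) (x u : E) : twist f (-x) u = twist f x u := by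
  unfold twist
  have h1 : invSqrtTwo • (-x + u) = -(invSqrtTwo • (x - u)) := by module
  have h2 : invSqrtTwo • (-x - u) = -(invSqrtTwo • (x + u)) := by module
  rw [h1, h2, heven, heven, mul_comm]

theorem doubled_neg (heven : ∀ x, f (-x) = f x) (x : E) : doubled p f (-x) = doubled p f x := by
  unfold doubled nrm
  simp_rw [twist_neg_left heven]

theorem measurable_doubled (hf : Measurable f) : Measurable (doubled p f) :=
  (((measurable_twist_uncurry hf).pow_const p).lintegral_prod_right').pow_const _

theorem doubled_rpow (hp : 0 < p) (f : E → ℝ≥0∞) (x : E) :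
    doubled p f x ^ p = ∫⁻ u, twist (fun z => f z ^ p) x u := by
  unfold doubled nrm twist
  rw [← ENNReal.rpow_mul, one_div_mul_cancel hp.ne', ENNReal.rpow_one]
  simp_rw [ENNReal.mul_rpow_of_nonneg _ _ hp.le]

theorem lintegral_lintegral_mul (F G : E → ℝ≥0∞) (hF : Measurable F) (hG : Measurable G) :
    ∫⁻ a, ∫⁻ b, F a * G b = (∫⁻ a, F a) * ∫⁻ b, G b := by
  simp_rw [lintegral_const_mul _ hG]
  exact lintegral_mul_const _ hF

/-- The transform of a self-convolution is a square; the rescaling by `1/√2` comes from the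
rotation. This both computes `‖doubled f‖_p` and shows that being centered survives doubling. -/
theorem lap_doubled_rpow (hp : 0 < p) (hf : Measurable f) (y : E) :
    lap (fun x => doubled p f x ^ p) y = lap (fun x => f x ^ p) (invSqrtTwo • y) ^ 2 := by
  have hF : Measurable fun x => f x ^ p := hf.pow_const p
  have hFe := measurable_mul_expInner hF (invSqrtTwo • y)
  rw [sq]
  unfold lap
  rw [← lintegral_lintegral_mul _ _ hFe hFe, ← lintegral_rot]
  · refine lintegral_congr fun x => ?_
    beta_reduce
    rw [doubled_rpow hp, ← lintegral_mul_const _ (measurable_twist hF x)]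
    refine lintegral_congr fun u => ?_
    have h := expInner_rot x u y 0
    rw [add_zero, sub_zero, expInner_zero_right, mul_one] at h
    rw [← h]
    unfold twist
    ring
  · exact (hFe.comp measurable_fst).mul (hFe.comp measurable_snd)

theorem lintegral_doubled_rpow (hp : 0 < p) (hf : Measurable f) :
    ∫⁻ x, doubled p f x ^ p = (∫⁻ x, f x ^ p) ^ 2 := by
  have := lap_doubled_rpow hp hf 0
  simpa [lap, expInner_zero_right] using this

theorem nrm_doubled (hp : 0 < p) (hf : Measurable f) : nrm p (doubled p f) = nrm p f ^ 2 := by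
  rw [nrm, lintegral_doubled_rpow hp hf, nrm, ← ENNReal.rpow_natCast, ← ENNReal.rpow_natCast,
    ← ENNReal.rpow_mul, ← ENNReal.rpow_mul, mul_comm]

theorem lintegral_lap_twist (hg : Measurable g) (x u : E) :
    ∫⁻ y, expInner x y * lap (twist g y) u =
      lap g (invSqrtTwo • (x + u)) * lap g (invSqrtTwo • (x - u)) := by
  have h1 := measurable_mul_expInner hg (invSqrtTwo • (x + u))
  have h2 := measurable_mul_expInner hg (invSqrtTwo • (x - u))
  rw [lap, lap, ← lintegral_lintegral_mul _ _ h1 h2, ← lintegral_rot]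
  · refine lintegral_congr fun y => ?_
    rw [lap, ← lintegral_const_mul _ (measurable_mul_expInner (measurable_twist hg y) u)]
    refine lintegral_congr fun v => ?_
    rw [expInner_comm v u, mul_left_comm, ← expInner_rot]
    unfold twist
    rw [expInner_comm (invSqrtTwo • (x + u)), expInner_comm (invSqrtTwo • (x - u))]
    ring
  · exact (h1.comp measurable_fst).mul (h2.comp measurable_snd)

theorem measurable_lap_twist (hg : Measurable g) :
    Measurable fun z : E × E => lap (twist g z.1) z.2 := by
  have : Measurable fun w : (E × E) × E => twist g w.1.1 w.2 * expInner w.2 w.1.2 :=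
    ((measurable_twist_uncurry hg).comp ((measurable_fst.comp measurable_fst).prodMk
      measurable_snd)).mul (measurable_expInner.comp (measurable_snd.prodMk
        (measurable_snd.comp measurable_fst)))
  exact this.lintegral_prod_right'

/-- The square is a double integral over two copies of `E`, which is rotated in the variable of `f`
and in that of `g`. By `expInner_rot` the kernel splits into `exp(x·y)` and `exp(u·v)`, and
integrating over `u, v` first leaves the form of the twists. -/
theorem form_sq (hf : Measurable f) (hg : Measurable g) :
    form f g ^ 2 = ∫⁻ x, ∫⁻ y, expInner x y * form (twist f x) (twist g y) := by
  have hfg : Measurable fun x => f x * lap g x := hf.mul (measurable_lap hg)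
  rw [sq]
  nth_rw 1 [form]
  rw [form, ← lintegral_lintegral_mul _ _ hfg hfg, ← lintegral_rot]
  · refine lintegral_congr fun x => ?_
    have hm : Measurable fun z : E × E =>
        expInner x z.1 * (twist f x z.2 * lap (twist g z.1) z.2) := by
      refine Measurable.mul ?_ (((measurable_twist hf x).comp measurable_snd).mul
        (measurable_lap_twist hg))
      exact measurable_expInner.comp (measurable_const.prodMk measurable_fst)
    calc _ = ∫⁻ u, twist f x u * ∫⁻ y, expInner x y * lap (twist g y) u := by
          refine lintegral_congr fun u => ?_
          rw [lintegral_lap_twist hg]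
          unfold twist
          ring
      _ = ∫⁻ u, ∫⁻ y, expInner x y * (twist f x u * lap (twist g y) u) := by
          refine lintegral_congr fun u => ?_
          rw [← lintegral_const_mul]
          · refine lintegral_congr fun y => ?_
            ring
          · exact (measurable_expInner.comp (measurable_const.prodMk measurable_id)).mul
              ((measurable_lap_twist hg).comp (measurable_id.prodMk measurable_const))
      _ = ∫⁻ y, ∫⁻ u, expInner x y * (twist f x u * lap (twist g y) u) :=
          (lintegral_lintegral_swap hm.aemeasurable).symm
      _ = _ := by
          refine lintegral_congr fun y => ?_
          rw [form, lintegral_const_mul']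
          exact expInner_ne_top _ _
  · exact (hfg.comp measurable_fst).mul (hfg.comp measurable_snd)

theorem measurable_form_twist (hf : Measurable f) (hg : Measurable g) :
    Measurable fun z : E × E => form (twist f z.1) (twist g z.2) := by
  have : Measurable fun w : (E × E) × E => twist f w.1.1 w.2 * lap (twist g w.1.2) w.2 :=
    ((measurable_twist_uncurry hf).comp ((measurable_fst.comp measurable_fst).prodMk
      measurable_snd)).mul ((measurable_lap_twist hg).comp
        ((measurable_snd.comp measurable_fst).prodMk measurable_snd))
  exact this.lintegral_prod_right'

end

/-! ### Log-concave functions: normal position and compactness. -/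

/-- The threshold `1/e`. -/
def thr : ℝ≥0∞ := ENNReal.ofReal (Real.exp (-1))

theorem thr_rpow (s : ℝ) : thr ^ s = ENNReal.ofReal (Real.exp (-s)) := by
  rw [thr, ENNReal.ofReal_rpow_of_pos (Real.exp_pos _), ← Real.exp_mul]
  congr 2; ring

theorem thr_ne_zero : thr ≠ 0 := by simp [thr, Real.exp_pos]

theorem thr_ne_top : thr ≠ ∞ := ENNReal.ofReal_ne_top

theorem thr_lt_one : thr < 1 := by
  rw [thr, ENNReal.ofReal_lt_one, Real.exp_lt_one_iff]; norm_num

section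

variable {E : Type*} [NormedAddCommGroup E] [InnerProductSpace ℝ E]

/-- Log-concavity of a function with values in `[0, ∞]`. -/
def LogConcave (G : E → ℝ≥0∞) : Prop :=
  ∀ (x y : E) (a b : ℝ), 0 ≤ a → 0 ≤ b → a + b = 1 → G x ^ a * G y ^ b ≤ G (a • x + b • y)

variable {G : E → ℝ≥0∞}

theorem LogConcave.le_of_even (hG : LogConcave G) (heven : ∀ x, G (-x) = G x) (x : E) :
    G x ≤ G 0 := by
  have h := hG x (-x) (1 / 2) (1 / 2) (by norm_num) (by norm_num) (by norm_num)
  rwa [heven, ← ENNReal.rpow_add_of_nonneg _ _ (by norm_num) (by norm_num),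
    show (1 / 2 : ℝ) + 1 / 2 = 1 by norm_num, ENNReal.rpow_one, smul_neg, add_neg_cancel] at h

theorem LogConcave.comp_linear (hG : LogConcave G) (T : E →ₗ[ℝ] E) :
    LogConcave fun x => G (T x) := by
  intro x y a b ha hb hab
  simp only [map_add, map_smul]
  exact hG _ _ a b ha hb hab

theorem LogConcave.const_mul (hG : LogConcave G) {c : ℝ≥0∞} (hc : c ≠ 0) (hc' : c ≠ ∞) :
    LogConcave fun x => c * G x := by
  intro x y a b ha hb hab
  calc (c * G x) ^ a * (c * G y) ^ b = (c ^ a * c ^ b) * (G x ^ a * G y ^ b) := by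
        rw [ENNReal.mul_rpow_of_nonneg _ _ ha, ENNReal.mul_rpow_of_nonneg _ _ hb]; ring
    _ = c * (G x ^ a * G y ^ b) := by
        rw [← ENNReal.rpow_add _ _ hc hc', hab, ENNReal.rpow_one]
    _ ≤ _ := mul_le_mul' le_rfl (hG _ _ a b ha hb hab)

theorem LogConcave.convex_superlevel (hG : LogConcave G) {t : ℝ≥0∞} (ht : t ≠ 0) (ht' : t ≠ ∞) :
    Convex ℝ {x | t ≤ G x} := by
  intro x hx y hy a b ha hb hab
  have hx' : t ≤ G x := hx
  have hy' : t ≤ G y := hy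
  refine le_trans ?_ (hG x y a b ha hb hab)
  calc t = t ^ a * t ^ b := by rw [← ENNReal.rpow_add _ _ ht ht', hab, ENNReal.rpow_one]
    _ ≤ _ := by gcongr

theorem LogConcave.rpow_le_smul (hG : LogConcave G) (h0 : G 0 = 1) (x : E) {t : ℝ} (ht : 0 ≤ t)
    (ht' : t ≤ 1) : G x ^ t ≤ G (t • x) := by
  have h := hG x 0 t (1 - t) ht (by linarith) (by ring)
  simpa [h0] using h

/-- On the segment from `0` to `x`, the value on the sphere of radius `R` is at least `G x ^ (R /
‖x‖)` and at most `1/e`. The additional factor `e` covers the ball of radius `R`. -/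
theorem LogConcave.le_exp (hG : LogConcave G) (h0 : G 0 = 1) (hle : ∀ x, G x ≤ 1) {R : ℝ}
    (hR : 0 < R) (h : ∀ x, R ≤ ‖x‖ → G x ≤ thr) (x : E) :
    G x ≤ ENNReal.ofReal (Real.exp (1 - ‖x‖ / R)) := by
  rcases le_or_gt ‖x‖ R with hx | hx
  · refine (hle x).trans ?_
    rw [ENNReal.one_le_ofReal, Real.one_le_exp_iff, sub_nonneg, div_le_one hR]
    exact hx
  · have hx0 : 0 < ‖x‖ := hR.trans hx
    have ht : 0 < R / ‖x‖ := by positivity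
    have h1 := hG.rpow_le_smul h0 x ht.le ((div_le_one hx0).2 hx.le)
    have h2 : ‖(R / ‖x‖) • x‖ = R := by
      rw [norm_smul, Real.norm_of_nonneg ht.le, div_mul_cancel₀ _ hx0.ne']
    have h3 := h1.trans (h _ h2.ge)
    calc G x = (G x ^ (R / ‖x‖)) ^ (‖x‖ / R) := by
          rw [← ENNReal.rpow_mul, div_mul_div_cancel₀ hx0.ne', div_self hR.ne', ENNReal.rpow_one]
      _ ≤ thr ^ (‖x‖ / R) := ENNReal.rpow_le_rpow h3 (by positivity)
      _ ≤ _ := by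
          rw [thr_rpow]
          exact ENNReal.ofReal_le_ofReal (Real.exp_le_exp.2 (by linarith))

variable [FiniteDimensional ℝ E] [MeasurableSpace E] [BorelSpace E]

/-- The transform is log-convex, and a negative power reverses this. -/
theorem logConcave_lap_rpow {f : E → ℝ≥0∞} {p q : ℝ} (hf : Measurable f) (hp : 0 < p)
    (h0 : ∫⁻ x, f x ^ p ≠ 0) (hq : q < 0) : LogConcave fun y => lap f y ^ q := by
  intro x y a b ha hb hab
  have hx := lap_ne_zero hf h0 hp x
  have hy := lap_ne_zero hf h0 hp y
  refine le_trans ?_ (rpow_le_rpow_of_nonpos hq.le (lap_logConvex hf ha hb hab x y))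
  rw [← ENNReal.rpow_mul, ← ENNReal.rpow_mul, mul_comm q a, mul_comm q b, ENNReal.rpow_mul,
    ENNReal.rpow_mul]
  by_cases hxy : lap f x ^ a = ∞ ∨ lap f y ^ b = ∞
  · rcases hxy with h | h <;> simp [h, ENNReal.top_rpow_of_neg hq]
  · push Not at hxy
    rw [ENNReal.mul_rpow_of_ne_top hxy.1 hxy.2]

/-- Cramer's rule: replacing one column by the image of `y` multiplies the determinant by a
coordinate of `y`. -/
theorem det_constr_update {n : ℕ} (b : Module.Basis (Fin n) ℝ E) (v : Fin n → E) (i : Fin n)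
    (y : E) :
    LinearMap.det (b.constr ℝ (Function.update v i (b.constr ℝ v y))) =
      LinearMap.det (b.constr ℝ v) * b.repr y i := by
  have h1 : b.constr ℝ (Function.update v i (b.constr ℝ v y)) =
      b.constr ℝ v ∘ₗ b.constr ℝ (Function.update b i y) := by
    refine b.ext fun j => ?_
    simp only [LinearMap.comp_apply, Module.Basis.constr_basis]
    by_cases hj : j = i
    · subst hj; simp
    · simp [hj]
  have h2 : LinearMap.det (b.constr ℝ (Function.update b i y)) = b.repr y i := by
    rw [← LinearMap.det_toMatrix b]
    have : LinearMap.toMatrix b b (b.constr ℝ (Function.update b i y)) =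
        b.toMatrix (Function.update b i y) := by
      ext j k
      simp [LinearMap.toMatrix_apply, Module.Basis.toMatrix_apply]
    rw [this, Module.Basis.toMatrix_update, Module.Basis.toMatrix_self, ← Matrix.cramer_apply,
      Matrix.cramer_one]
    rfl
  rw [h1, LinearMap.det_comp, h2]

/-- An even integrable log-concave function can be brought by a linear change of variables into a
position where it is bounded below on a fixed ball and small outside a fixed ball. -/
theorem LogConcave.exists_position (hG : LogConcave G) (hm : Measurable G)
    (heven : ∀ x, G (-x) = G x) (h0 : G 0 = 1) (hI0 : ∫⁻ x, G x ≠ 0) (hIt : ∫⁻ x, G x ≠ ∞) :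
    ∃ T : E ≃ₗ[ℝ] E,
      (∀ x, ‖x‖ ≤ 1 / ((Module.finrank ℝ E : ℝ) + 1) → thr ≤ G (T x)) ∧
      ∀ x, 2 * (Module.finrank ℝ E : ℝ) + 1 ≤ ‖x‖ → G (T x) ≤ thr := by
  set n := Module.finrank ℝ E with hn
  set K : Set E := {x | thr ≤ G x} with hK
  have hKc : Convex ℝ K := hG.convex_superlevel thr_ne_zero thr_ne_top
  have hK0 : (0 : E) ∈ K := by
    have : thr ≤ G 0 := by rw [h0]; exact thr_lt_one.le
    exact this
  have hKs : ∀ x ∈ K, ∀ c : ℝ, |c| ≤ 1 → c • x ∈ K := by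
    intro x hx c hc
    have hx' : -x ∈ K := by
      have : thr ≤ G (-x) := by rw [heven]; exact hx
      exact this
    have h := hKc hx hx' (a := (1 + c) / 2) (b := (1 - c) / 2)
      (by linarith [(abs_le.1 hc).1]) (by linarith [(abs_le.1 hc).2]) (by ring)
    convert h using 1
    module
  set ob := stdOrthonormalBasis ℝ E with hob
  set b := ob.toBasis with hb
  have hrepr : ∀ y i, |b.repr y i| ≤ ‖y‖ := by
    intro y i
    have : b.repr y i = inner ℝ (ob i) y := by
      rw [hb, OrthonormalBasis.coe_toBasis_repr_apply, OrthonormalBasis.repr_apply_apply]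
    rw [this]
    simpa using abs_real_inner_le_norm (ob i) y
  have hball : ∀ v : Fin n → E, (∀ i, v i ∈ K) → ∀ y, ‖y‖ ≤ 1 / ((n : ℝ) + 1) →
      b.constr ℝ v y ∈ K := by
    intro v hv y hy
    rw [Module.Basis.constr_apply_fintype]
    rcases Nat.eq_zero_or_pos n with hn0 | hn0
    · have : IsEmpty (Fin n) := by rw [hn0]; infer_instance
      simpa using hK0
    · have hn1 : (0 : ℝ) < n := by exact_mod_cast hn0
      -- The image of `y` is the average of the vectors `n y_i v_i`, which lie in the symmetric
      -- convex set `K` because `|n y_i| ≤ 1`.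
      have h := hKc.sum_mem (t := Finset.univ) (w := fun _ : Fin n => (n : ℝ)⁻¹)
        (z := fun i => ((n : ℝ) * b.repr y i) • v i) (fun _ _ => by positivity)
        (by simp [hn1.ne']) (fun i _ => hKs _ (hv i) _ (by
          rw [abs_mul, abs_of_pos hn1]
          have h1 := (hrepr y i).trans hy
          rw [le_div_iff₀ (by positivity)] at h1
          nlinarith [abs_nonneg (b.repr y i)]))
      convert h using 1
      refine Finset.sum_congr rfl fun i _ => ?_
      rw [smul_smul, inv_mul_cancel_left₀ hn1.ne']
      rfl
  -- the determinants of systems of vectors of `K` are bounded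
  have hvolK : volume K ≠ ∞ := by
    have h1 := mul_meas_ge_le_lintegral₀ (μ := volume) hm.aemeasurable thr
    intro h
    rw [hK] at h
    rw [h, ENNReal.mul_top thr_ne_zero, top_le_iff] at h1
    exact hIt h1
  set V := volume (Metric.closedBall (0 : E) (1 / ((n : ℝ) + 1))) with hV
  have hV0 : V ≠ 0 := (Metric.measure_closedBall_pos volume _ (by positivity)).ne'
  have hVt : V ≠ ∞ := measure_closedBall_lt_top.ne
  have hdet : ∀ v : Fin n → E, (∀ i, v i ∈ K) →
      |LinearMap.det (b.constr ℝ v)| ≤ (volume K / V).toReal := by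
    intro v hv
    have h1 : volume (b.constr ℝ v '' Metric.closedBall (0 : E) (1 / ((n : ℝ) + 1))) ≤
        volume K := by
      refine measure_mono ?_
      rintro _ ⟨y, hy, rfl⟩
      exact hball v hv y (by simpa using hy)
    rw [Measure.addHaar_image_linearMap] at h1
    rw [← ENNReal.ofReal_le_iff_le_toReal (ENNReal.div_ne_top hvolK hV0)]
    exact (ENNReal.le_div_iff_mul_le (Or.inl hV0) (Or.inl hVt)).2 h1
  -- there is a basis of vectors of `K`
  obtain ⟨v₀, hv₀K, hv₀⟩ : ∃ v : Fin n → E, (∀ i, v i ∈ K) ∧ LinearMap.det (b.constr ℝ v) ≠ 0 := by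
    -- If the support of `G` lay in a proper subspace, `G` would vanish almost everywhere.
    have hspan : Submodule.span ℝ {x | G x ≠ 0} = ⊤ := by
      by_contra hne
      apply hI0
      have h1 := Measure.addHaar_submodule (volume : Measure E) _ hne
      rw [lintegral_eq_zero_iff hm]
      filter_upwards [measure_eq_zero_iff_ae_notMem.1 h1] with x hx
      by_contra hx'
      exact hx (Submodule.subset_span hx')
    have h2 := Submodule.exists_fun_fin_finrank_span_eq ℝ {x | G x ≠ 0}
    rw [hspan, finrank_top, ← hn] at h2
    obtain ⟨w, hwG, hwspan, hwli⟩ := h2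
    have hscale : ∀ i, ∃ t : ℝ, 0 < t ∧ t • w i ∈ K := by
      intro i
      have h3 : G (w i) ≠ 0 := hwG i
      -- Shrinking a support vector towards `0` raises `G` above `1/e`. The factor is `1/(N+1)`
      -- rather than `1/N` since `N` may be zero.
      obtain ⟨N, hN⟩ := ((ENNReal.tendsto_pow_atTop_nhds_zero_of_lt_one thr_lt_one).eventually
        (gt_mem_nhds (pos_iff_ne_zero.2 h3))).exists
      refine ⟨1 / ((N : ℝ) + 1), by positivity, ?_⟩
      have h4 := hG.rpow_le_smul h0 (w i) (t := 1 / ((N : ℝ) + 1)) (by positivity)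
        (by rw [div_le_one (by positivity)]; linarith [N.cast_nonneg (α := ℝ)])
      have h5 : thr ^ ((N : ℝ) + 1) ≤ G (w i) := by
        refine le_trans ?_ hN.le
        rw [← ENNReal.rpow_natCast]
        exact ENNReal.rpow_le_rpow_of_exponent_ge thr_lt_one.le (by linarith)
      refine le_trans ?_ h4
      calc thr = (thr ^ ((N : ℝ) + 1)) ^ (1 / ((N : ℝ) + 1)) := by
            rw [← ENNReal.rpow_mul, mul_one_div_cancel (by positivity), ENNReal.rpow_one]
        _ ≤ _ := ENNReal.rpow_le_rpow h5 (by positivity)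
    choose t ht htK using hscale
    refine ⟨fun i => t i • w i, htK, ?_⟩
    have hli : LinearIndependent ℝ fun i => t i • w i :=
      hwli.units_smul fun i => Units.mk0 (t i) (ht i).ne'
    have hinj : Function.Injective (b.constr ℝ fun i => t i • w i) := by
      rw [← LinearMap.ker_eq_bot, LinearMap.ker_eq_bot']
      intro y hy
      rw [Module.Basis.constr_apply_fintype] at hy
      have h6 := Fintype.linearIndependent_iff.1 hli _ hy
      refine b.ext_elem fun i => ?_
      simpa using h6 i
    intro h7
    exact (LinearMap.bot_lt_ker_of_det_eq_zero h7).ne' (LinearMap.ker_eq_bot.2 hinj)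
  set D : Set ℝ := {d | ∃ v : Fin n → E, (∀ i, v i ∈ K) ∧ |LinearMap.det (b.constr ℝ v)| = d}
  have hDb : BddAbove D := ⟨_, by rintro _ ⟨v, hv, rfl⟩; exact hdet v hv⟩
  have hD0 : 0 < sSup D :=
    (abs_pos.2 hv₀).trans_le (le_csSup hDb ⟨v₀, hv₀K, rfl⟩)
  -- A system in `K` whose determinant is within a factor two of the supremum suffices, so no
  -- maximizer is needed. This loss is the `2` in the outer radius.
  obtain ⟨_, ⟨v, hvK, rfl⟩, hv⟩ := exists_lt_of_lt_csSup (s := D) ⟨_, v₀, hv₀K, rfl⟩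
    (half_lt_self hD0)
  have hvne : LinearMap.det (b.constr ℝ v) ≠ 0 := by
    intro h
    rw [h, abs_zero] at hv
    linarith
  refine ⟨LinearMap.equivOfDetNeZero _ hvne, fun x hx => hball v hvK x hx, fun y hy => ?_⟩
  by_contra hcon
  have hyK : b.constr ℝ v y ∈ K := (not_le.1 hcon).le
  -- Exchanging `v i` for the image of `y` keeps the system in `K` and multiplies the determinant by
  -- the `i`-th coordinate, which therefore cannot exceed `2`.
  have hcoord : ∀ i, |b.repr y i| ≤ 2 := by
    intro i
    have h1 : |LinearMap.det (b.constr ℝ (Function.update v i (b.constr ℝ v y)))| ≤ sSup D := by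
      refine le_csSup hDb ⟨_, fun j => ?_, rfl⟩
      by_cases hj : j = i
      · subst hj; simpa using hyK
      · simpa [hj] using hvK j
    rw [det_constr_update, abs_mul] at h1
    have h2 := abs_pos.2 hvne
    by_contra! h3
    nlinarith
  have hnorm : ‖y‖ ≤ 2 * n := by
    calc ‖y‖ = ‖∑ i, b.repr y i • b i‖ := by rw [b.sum_repr]
      _ ≤ ∑ i, ‖b.repr y i • b i‖ := norm_sum_le _ _
      _ ≤ ∑ _i : Fin n, (2 : ℝ) := by
          refine Finset.sum_le_sum fun i _ => ?_
          rw [norm_smul, hb, OrthonormalBasis.coe_toBasis, ob.orthonormal.1 i, mul_one]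
          exact hcoord i
      _ = 2 * n := by simp [mul_comm]
  linarith

/-- The point `y` is `(1 - s) x + s w` with `‖w‖ ≤ r`, where `G w ≥ 1/e`: a one-sided modulus of
continuity that is uniform over the class. -/
theorem LogConcave.thr_mul_le (hG : LogConcave G) {r : ℝ} (hr : ∀ x, ‖x‖ ≤ r → thr ≤ G x) {s : ℝ}
    (hs : 0 < s) (hs' : s < 1) {x y : E} (hxy : ‖y - (1 - s) • x‖ ≤ s * r) :
    G x ^ (1 - s) * thr ^ s ≤ G y := by
  have h := hG x (s⁻¹ • (y - (1 - s) • x)) (1 - s) s (by linarith) hs.le (by ring)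
  have h1 : (1 - s) • x + s • s⁻¹ • (y - (1 - s) • x) = y := by
    rw [smul_inv_smul₀ hs.ne']; abel
  rw [h1] at h
  refine le_trans ?_ h
  gcongr
  refine hr _ ?_
  rw [norm_smul, Real.norm_of_nonneg (by positivity), inv_mul_le_iff₀ hs]
  exact hxy

/-- A point `d i` of the dense sequence close to `(1 - s) x` mediates: `thr_mul_le` compares `x`
with `d i`, and `d i` with `(1 - s)^2 x`, while convergence at `d i` joins the upper limit to the
lower one. -/
theorem limsup_le_liminf_smul {G : ℕ → E → ℝ≥0∞} (hG : ∀ j, LogConcave (G j))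
    (hle : ∀ j x, G j x ≤ 1) {r : ℝ} (hr0 : 0 < r) (hr : ∀ j x, ‖x‖ ≤ r → thr ≤ G j x)
    {d : ℕ → E} (hd : DenseRange d) {a : ℕ → ℝ≥0∞}
    (ha : ∀ i, Tendsto (fun j => G j (d i)) atTop (𝓝 (a i))) {s : ℝ} (hs : 0 < s) (hs' : s < 1)
    (x : E) :
    thr ^ (2 * s) * limsup (fun j => G j x) atTop ≤
      liminf (fun j => G j (((1 - s) * (1 - s)) • x)) atTop := by
  obtain ⟨i, hi⟩ := hd.exists_dist_lt ((1 - s) • x) (mul_pos hs hr0)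
  rw [dist_eq_norm] at hi
  set φ : ℝ≥0∞ → ℝ≥0∞ := fun t => t ^ (1 - s) * thr ^ s with hφ
  have hs1 : 0 < 1 - s := by linarith
  have hφm : Monotone φ := fun x y hxy => by
    simp only [hφ]; gcongr
  have hφc : Continuous φ :=
    (ENNReal.continuous_mul_const (rpow_ne_top_of_finite thr_ne_zero thr_ne_top s)).comp
      ENNReal.continuous_rpow_const
  have h1 : φ (limsup (fun j => G j x) atTop) ≤ a i := by
    rw [hφm.map_limsup_of_continuousAt _ hφc.continuousAt, ← (ha i).limsup_eq]
    refine limsup_le_limsup (Eventually.of_forall fun j => ?_)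
    refine (hG j).thr_mul_le (hr j) hs hs' ?_
    rw [norm_sub_rev]; exact hi.le
  have h2 : φ (a i) ≤ liminf (fun j => G j (((1 - s) * (1 - s)) • x)) atTop := by
    rw [← (ha i).liminf_eq, hφm.map_liminf_of_continuousAt _ hφc.continuousAt]
    refine liminf_le_liminf (Eventually.of_forall fun j => ?_)
    refine (hG j).thr_mul_le (hr j) hs hs' ?_
    rw [mul_smul, ← smul_sub, norm_smul, Real.norm_of_nonneg hs1.le]
    calc (1 - s) * ‖(1 - s) • x - d i‖ ≤ 1 * ‖(1 - s) • x - d i‖ := by gcongr; linarith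
      _ ≤ s * r := by rw [one_mul]; exact hi.le
  refine le_trans ?_ ((hφm h1).trans h2)
  set u := limsup (fun j => G j x) atTop
  have hu : u ≤ 1 := limsup_le_of_le (by isBoundedDefault) (Eventually.of_forall fun j => hle j x)
  simp only [hφ]
  rw [ENNReal.mul_rpow_of_nonneg _ _ hs1.le, ← ENNReal.rpow_mul, ← ENNReal.rpow_mul, mul_assoc,
    ← ENNReal.rpow_add _ _ thr_ne_zero thr_ne_top, mul_comm]
  refine mul_le_mul' ?_ ?_
  · calc u = u ^ (1 : ℝ) := (ENNReal.rpow_one u).symm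
      _ ≤ _ := ENNReal.rpow_le_rpow_of_exponent_ge hu (by nlinarith)
  · exact ENNReal.rpow_le_rpow_of_exponent_ge thr_lt_one.le (by nlinarith)

theorem lintegral_comp_smul (F : E → ℝ≥0∞) {c : ℝ} (hc : 0 < c) :
    ENNReal.ofReal (c ^ Module.finrank ℝ E) * ∫⁻ x, F (c • x) = ∫⁻ x, F x := by
  have h := lintegral_comp_linearEquiv (LinearEquiv.smulOfNeZero ℝ E c hc.ne') F
  have h1 : ((LinearEquiv.smulOfNeZero ℝ E c hc.ne' : E ≃ₗ[ℝ] E) : E →ₗ[ℝ] E) =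
      c • LinearMap.id := rfl
  rw [h1, LinearMap.det_smul, LinearMap.det_id, mul_one, abs_of_pos (by positivity)] at h
  have h2 : ∫⁻ x, F (c • x) = ∫⁻ x, F ((LinearEquiv.smulOfNeZero ℝ E c hc.ne') x) := rfl
  rw [h2, h, ← mul_assoc, ENNReal.mul_inv_cancel, one_mul]
  · simp only [ne_eq, ENNReal.ofReal_eq_zero, not_le]; positivity
  · exact ENNReal.ofReal_ne_top

/-- A selection theorem for log-concave functions. -/
theorem exists_subseq_ae_limsup_eq_liminf {G : ℕ → E → ℝ≥0∞} (hm : ∀ j, Measurable (G j))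
    (hG : ∀ j, LogConcave (G j)) (hle : ∀ j x, G j x ≤ 1) {r : ℝ} (hr0 : 0 < r)
    (hr : ∀ j x, ‖x‖ ≤ r → thr ≤ G j x) {D : E → ℝ≥0∞} (hD : ∫⁻ x, D x ≠ ∞)
    (hGD : ∀ j x, G j x ≤ D x) :
    ∃ φ : ℕ → ℕ, StrictMono φ ∧
      ∀ᵐ x, liminf (fun j => G (φ j) x) atTop = limsup (fun j => G (φ j) x) atTop := by
  -- Compactness of the countable product of copies of `[0, ∞]` gives convergence on a dense
  -- sequence.
  obtain ⟨a, -, φ, hφ, hlim⟩ := isCompact_univ.tendsto_subseq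
    (x := fun j => fun i : ℕ => G j (TopologicalSpace.denseSeq E i)) fun _ => Set.mem_univ _
  refine ⟨φ, hφ, ?_⟩
  set l := fun x => liminf (fun j => G (φ j) x) atTop
  set u := fun x => limsup (fun j => G (φ j) x) atTop
  have hlu : ∀ x, l x ≤ u x := fun x => liminf_le_limsup
  have hlt : ∫⁻ x, l x ≠ ∞ := by
    refine ((lintegral_mono fun x => ?_).trans_lt hD.lt_top).ne
    exact (hlu x).trans (limsup_le_of_le (by isBoundedDefault)
      (Eventually.of_forall fun j => hGD _ x))
  have hum : Measurable u := Measurable.limsup fun j => hm _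
  refine ae_eq_of_ae_le_of_lintegral_le (Eventually.of_forall hlu) hlt hum.aemeasurable ?_
  -- Integrating the comparison and undoing the dilation shows, as `s` tends to `0`, that the upper
  -- limit has no larger integral than the lower one.
  have key : ∀ s ∈ Set.Ioo (0 : ℝ) 1,
      ENNReal.ofReal (((1 - s) * (1 - s)) ^ Module.finrank ℝ E * Real.exp (-(2 * s))) *
        ∫⁻ x, u x ≤ ∫⁻ x, l x := by
    intro s hs
    have hc : 0 < (1 - s) * (1 - s) := by nlinarith [hs.2]
    rw [← lintegral_comp_smul l hc, ENNReal.ofReal_mul (by positivity), ← thr_rpow, mul_assoc,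
      ← lintegral_const_mul _ hum]
    gcongr with x
    exact limsup_le_liminf_smul (fun j => hG (φ j)) (fun j => hle (φ j)) hr0 (fun j => hr (φ j))
      (TopologicalSpace.denseRange_denseSeq E) (fun i => (tendsto_pi_nhds.1 hlim) i) hs.1 hs.2 x
  have hlim2 : Tendsto (fun s : ℝ => ENNReal.ofReal (((1 - s) * (1 - s)) ^ Module.finrank ℝ E *
      Real.exp (-(2 * s))) * ∫⁻ x, u x) (𝓝[>] 0) (𝓝 (1 * ∫⁻ x, u x)) := by
    refine ENNReal.Tendsto.mul_const ?_ (Or.inl one_ne_zero)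
    have hc : Continuous fun s : ℝ => ENNReal.ofReal (((1 - s) * (1 - s)) ^ Module.finrank ℝ E *
      Real.exp (-(2 * s))) := ENNReal.continuous_ofReal.comp (by fun_prop)
    have := (hc.tendsto 0).mono_left (nhdsWithin_le_nhds (s := Set.Ioi 0))
    simpa using this
  rw [one_mul] at hlim2
  refine le_of_tendsto hlim2 ?_
  filter_upwards [Ioo_mem_nhdsGT one_pos] with s hs
  exact key s hs

end

/-! ### Gaussian integrals and the sharp constant. -/

section

variable {E : Type*} [NormedAddCommGroup E] [InnerProductSpace ℝ E]

/-- The Gaussian function `exp(-|x|² / (2σ))` with values in `[0, ∞]`. -/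
def gauss (σ : ℝ) (x : E) : ℝ≥0∞ := ENNReal.ofReal (Real.exp (-‖x‖ ^ 2 / (2 * σ)))

theorem gauss_neg (σ : ℝ) (x : E) : gauss σ (-x) = gauss σ x := by simp [gauss]

theorem gauss_rpow (σ r : ℝ) (x : E) :
    gauss σ x ^ r = ENNReal.ofReal (Real.exp (-(r / (2 * σ)) * ‖x‖ ^ 2)) := by
  rw [gauss, ENNReal.ofReal_rpow_of_pos (Real.exp_pos _), ← Real.exp_mul]
  congr 2; ring

variable [FiniteDimensional ℝ E] [MeasurableSpace E] [BorelSpace E]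

theorem measurable_gauss (σ : ℝ) : Measurable (gauss σ : E → ℝ≥0∞) := by
  unfold gauss; fun_prop

theorem lintegral_exp_neg_mul_sq {b : ℝ} (hb : 0 < b) :
    ∫⁻ x : E, ENNReal.ofReal (Real.exp (-b * ‖x‖ ^ 2)) =
      ENNReal.ofReal ((Real.pi / b) ^ ((Module.finrank ℝ E : ℝ) / 2)) := by
  have h := GaussianFourier.integral_rexp_neg_mul_sq_norm (V := E) hb
  have hi : Integrable fun x : E => Real.exp (-b * ‖x‖ ^ 2) := by
    by_contra hcon
    rw [integral_undef hcon] at h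
    have : 0 < (Real.pi / b) ^ ((Module.finrank ℝ E : ℝ) / 2) := by
      have := Real.pi_pos
      positivity
    exact this.ne h
  rw [← h, ofReal_integral_eq_lintegral_ofReal hi (Eventually.of_forall fun x =>
    (Real.exp_pos _).le)]

theorem lap_gauss {σ : ℝ} (hσ : 0 < σ) (y : E) :
    lap (gauss σ) y = ENNReal.ofReal ((2 * Real.pi * σ) ^ ((Module.finrank ℝ E : ℝ) / 2)) *
      ENNReal.ofReal (Real.exp (σ / 2 * ‖y‖ ^ 2)) := by
  have hb : 0 < 1 / (2 * σ) := by positivity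
  -- Completing the square.
  have h1 : ∀ x : E, gauss σ x * expInner x y =
      ENNReal.ofReal (Real.exp (-(1 / (2 * σ)) * ‖x - σ • y‖ ^ 2)) *
        ENNReal.ofReal (Real.exp (σ / 2 * ‖y‖ ^ 2)) := by
    intro x
    rw [gauss, expInner, ← ENNReal.ofReal_mul (Real.exp_pos _).le,
      ← ENNReal.ofReal_mul (Real.exp_pos _).le, ← Real.exp_add, ← Real.exp_add]
    congr 2
    rw [norm_sub_sq_real, inner_smul_right, norm_smul, Real.norm_of_nonneg hσ.le]
    field_simp
    ring
  unfold lap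
  simp_rw [h1]
  rw [lintegral_mul_const' _ _ ENNReal.ofReal_ne_top,
    lintegral_sub_right_eq_self (fun x : E => ENNReal.ofReal (Real.exp (-(1 / (2 * σ)) * ‖x‖ ^ 2))),
    lintegral_exp_neg_mul_sq hb]
  congr 3
  field_simp

theorem lintegral_gauss_rpow {σ r : ℝ} (hσ : 0 < σ) (hr : 0 < r) :
    ∫⁻ x : E, gauss σ x ^ r =
      ENNReal.ofReal ((2 * Real.pi * σ / r) ^ ((Module.finrank ℝ E : ℝ) / 2)) := by
  simp_rw [gauss_rpow]
  rw [lintegral_exp_neg_mul_sq (by positivity)]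
  congr 2
  field_simp

variable {p q : ℝ}

theorem lintegral_lap_gauss_rpow {σ : ℝ} (hσ : 0 < σ) (hq : q < 0) :
    ∫⁻ y : E, lap (gauss σ) y ^ q =
      ENNReal.ofReal (((2 * Real.pi * σ) ^ ((Module.finrank ℝ E : ℝ) / 2)) ^ q *
        (2 * Real.pi / (-q * σ)) ^ ((Module.finrank ℝ E : ℝ) / 2)) := by
  have hpi := Real.pi_pos
  have hpos : 0 < (2 * Real.pi * σ) ^ ((Module.finrank ℝ E : ℝ) / 2) := by positivity
  have h1 : ∀ y : E, lap (gauss σ) y ^ q =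
      ENNReal.ofReal (((2 * Real.pi * σ) ^ ((Module.finrank ℝ E : ℝ) / 2)) ^ q) *
        ENNReal.ofReal (Real.exp (-(-q * σ / 2) * ‖y‖ ^ 2)) := by
    intro y
    rw [lap_gauss hσ, ← ENNReal.ofReal_mul hpos.le, ENNReal.ofReal_rpow_of_pos (by positivity),
      Real.mul_rpow hpos.le (Real.exp_pos _).le, ENNReal.ofReal_mul (by positivity),
      ← Real.exp_mul]
    congr 3
    ring
  simp_rw [h1]
  have hqσ : 0 < -q * σ / 2 := by nlinarith
  rw [lintegral_const_mul' _ _ ENNReal.ofReal_ne_top, lintegral_exp_neg_mul_sq hqσ,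
    ← ENNReal.ofReal_mul (by positivity)]
  congr 3
  have : -q ≠ 0 := by linarith
  field_simp

theorem sharpConst_pos (hpq : ReverseConjugate p q) (n : ℕ) : 0 < sharpConst n p q := by
  have hp := hpq.pos
  have hq : 0 < -q := by linarith [hpq.q_neg]
  have hpi := Real.pi_pos
  unfold sharpConst
  positivity

/-- Both sides are explicit and scale like `σ^(n/(2p))`, so `σ` drops out of the quotient. After
taking logarithms, the identity is algebra in `1/q`. -/
theorem nrm_lap_gauss (hpq : ReverseConjugate p q) {σ : ℝ} (hσ : 0 < σ) :
    nrm q (lap (gauss σ : E → ℝ≥0∞)) =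
      ENNReal.ofReal (sharpConst (Module.finrank ℝ E) p q) * nrm p (gauss σ : E → ℝ≥0∞) := by
  have hp := hpq.pos
  have hq := hpq.q_neg
  have hq' : 0 < -q := by linarith
  have hpi := Real.pi_pos
  rw [nrm, nrm, lintegral_lap_gauss_rpow hσ hq, lintegral_gauss_rpow hσ hp]
  have h0 := sharpConst_pos hpq (Module.finrank ℝ E)
  rw [ENNReal.ofReal_rpow_of_pos (by positivity), ENNReal.ofReal_rpow_of_pos (by positivity),
    ← ENNReal.ofReal_mul h0.le]
  congr 1
  refine Real.log_injOn_pos (Set.mem_Ioi.2 (by positivity)) (Set.mem_Ioi.2 (by positivity)) ?_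
  unfold sharpConst
  rw [Real.log_rpow (by positivity), Real.log_mul (by positivity) (by positivity),
    Real.log_rpow (by positivity), Real.log_rpow (by positivity), Real.log_rpow (by positivity),
    Real.log_div (by positivity) (by positivity), Real.log_mul (by positivity) (by positivity),
    Real.log_mul hq'.ne' hσ.ne', Real.log_mul (by positivity) (by positivity),
    Real.log_mul (by positivity) (by positivity), Real.log_mul (by positivity) (by positivity),
    Real.log_rpow (by positivity),
    Real.log_mul (x := p ^ (1 / p)) (by positivity) (by positivity), Real.log_rpow hp,
    Real.log_rpow hq', Real.log_rpow (by positivity),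
    Real.log_mul (by positivity) (by positivity), Real.log_rpow (by positivity),
    Real.log_rpow (by positivity),
    Real.log_div (by positivity) hp.ne', Real.log_mul (by positivity) hσ.ne',
    Real.log_mul (by positivity) (by positivity)]
  have hq0 : q ≠ 0 := hq.ne
  have h1 : 1 / p = 1 - 1 / q := by rw [hpq.one_div_q]; ring
  rw [h1]
  field_simp
  ring

end

/-! ### Existence of a minimizer among even functions. -/

section

variable {E : Type*} [NormedAddCommGroup E] [InnerProductSpace ℝ E] [FiniteDimensional ℝ E]
  [MeasurableSpace E] [BorelSpace E] {f g : E → ℝ≥0∞} {p q : ℝ}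

/-- Even measurable functions with `0 < ‖f‖_p < ∞`. -/
structure Admissible (p : ℝ) (f : E → ℝ≥0∞) : Prop where
  meas : Measurable f
  even : ∀ x, f (-x) = f x
  ne_zero : ∫⁻ x, f x ^ p ≠ 0
  ne_top : ∫⁻ x, f x ^ p ≠ ∞

theorem Admissible.nrm_ne_zero (hf : Admissible p f) : nrm p f ≠ 0 :=
  rpow_ne_zero_of_finite hf.ne_zero hf.ne_top _

theorem Admissible.nrm_ne_top (hf : Admissible p f) : nrm p f ≠ ∞ :=
  rpow_ne_top_of_finite hf.ne_zero hf.ne_top _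

theorem Admissible.lintegral_lap_ne_top (hpq : ReverseConjugate p q) (hf : Admissible p f) :
    ∫⁻ y, lap f y ^ q ≠ ∞ :=
  lintegral_lap_rpow_ne_top hf.meas hf.even hpq.pos hf.ne_zero hpq.q_neg

theorem lintegral_lap_ne_zero (hpq : ReverseConjugate p q) (h : nrm q (lap f) ≠ ∞) :
    ∫⁻ y, lap f y ^ q ≠ 0 := by
  intro h0
  rw [nrm, h0, ENNReal.zero_rpow_of_neg hpq.one_div_q_neg] at h
  exact h rfl

/-- The function `g` for which equality holds in the reverse Hölder inequality for `g` and `Lf`. -/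
def dual (q : ℝ) (f : E → ℝ≥0∞) (y : E) : ℝ≥0∞ := lap f y ^ (q - 1)

theorem dual_rpow (hpq : ReverseConjugate p q) (f : E → ℝ≥0∞) (y : E) :
    dual q f y ^ p = lap f y ^ q := by
  rw [dual, ← ENNReal.rpow_mul, hpq.sub_one_mul]

theorem Admissible.dual_admissible (hpq : ReverseConjugate p q) (hf : Admissible p f)
    (h : nrm q (lap f) ≠ ∞) : Admissible p (dual q f) where
  meas := (measurable_lap hf.meas).pow_const _
  even x := by rw [dual, lap_neg hf.even, dual]
  ne_zero := by simp_rw [dual_rpow hpq]; exact lintegral_lap_ne_zero hpq h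
  ne_top := by simp_rw [dual_rpow hpq]; exact hf.lintegral_lap_ne_top hpq

theorem Admissible.form_dual (hpq : ReverseConjugate p q) (hf : Admissible p f)
    (h : nrm q (lap f) ≠ ∞) : form f (dual q f) = nrm p (dual q f) * nrm q (lap f) := by
  have hd := hf.dual_admissible hpq h
  rw [form_comm hf.meas hd.meas]
  have h1 : form (dual q f) f = ∫⁻ y, lap f y ^ q := by
    refine lintegral_congr fun y => ?_
    have h0 := lap_ne_zero hf.meas hf.ne_zero hpq.pos y
    have hq := hpq.q_neg
    rw [dual]
    rcases eq_or_ne (lap f y) ∞ with ht | ht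
    · rw [ht, ENNReal.top_rpow_of_neg (by linarith), ENNReal.top_rpow_of_neg hq, zero_mul]
    · conv_lhs => rw [← ENNReal.rpow_one (lap f y)]
      rw [← ENNReal.rpow_mul, one_mul, ← ENNReal.rpow_add _ _ h0 ht, sub_add_cancel]
  rw [h1, nrm, nrm]
  simp_rw [dual_rpow hpq]
  rw [← ENNReal.rpow_add _ _ (lintegral_lap_ne_zero hpq h) (hf.lintegral_lap_ne_top hpq),
    hpq.one_div_q, add_sub_cancel, ENNReal.rpow_one]

/-- The form of `f` and its dual is computed exactly on one side and bounded below by reverse Hölder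
with the roles exchanged. Thus passing to the dual does not increase the quotient, and it gains
log-concavity. -/
theorem Admissible.nrm_lap_dual_le (hpq : ReverseConjugate p q) (hf : Admissible p f)
    (h : nrm q (lap f) ≠ ∞) :
    nrm q (lap (dual q f)) * nrm p f ≤ nrm q (lap f) * nrm p (dual q f) := by
  rw [mul_comm, mul_comm (nrm q (lap f)), ← hf.form_dual hpq h]
  exact nrm_mul_nrm_le_form hpq hf.meas (hf.dual_admissible hpq h).meas

/-- The radius of a ball on which normalized functions are bounded below. -/
def innerRadius (E : Type*) [NormedAddCommGroup E] [InnerProductSpace ℝ E] : ℝ :=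
  1 / ((Module.finrank ℝ E : ℝ) + 1)

/-- The radius outside which normalized functions are small. -/
def outerRadius (E : Type*) [NormedAddCommGroup E] [InnerProductSpace ℝ E] : ℝ :=
  2 * (Module.finrank ℝ E : ℝ) + 1

theorem innerRadius_pos : 0 < innerRadius E := by unfold innerRadius; positivity

theorem outerRadius_pos : 0 < outerRadius E := by unfold outerRadius; positivity

/-- Functions in a fixed compact class, used to normalize minimizing sequences. -/
structure Normalized (G : E → ℝ≥0∞) : Prop where
  meas : Measurable G
  even : ∀ x, G (-x) = G x
  le_one : ∀ x, G x ≤ 1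
  thr_le : ∀ x, ‖x‖ ≤ innerRadius E → thr ≤ G x
  le_exp : ∀ x, G x ≤ ENNReal.ofReal (Real.exp (1 - ‖x‖ / outerRadius E))

theorem lintegral_exp_bound_ne_top :
    ∫⁻ x : E, ENNReal.ofReal (Real.exp (1 - ‖x‖ / outerRadius E)) ≠ ∞ := by
  have h1 : ∀ x : E, ENNReal.ofReal (Real.exp (1 - ‖x‖ / outerRadius E)) =
      ENNReal.ofReal (Real.exp 1) * ENNReal.ofReal (Real.exp (-((outerRadius E)⁻¹ * ‖x‖))) := by
    intro x
    rw [← ENNReal.ofReal_mul (Real.exp_pos _).le, ← Real.exp_add]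
    congr 2
    rw [div_eq_inv_mul]; ring
  simp_rw [h1]
  rw [lintegral_const_mul' _ _ ENNReal.ofReal_ne_top]
  exact ENNReal.mul_ne_top ENNReal.ofReal_ne_top
    (lintegral_exp_neg_mul_norm_ne_top (inv_pos.2 (outerRadius_pos (E := E))))

theorem indicator_ball_pow_ne_zero {r : ℝ} (hr : 0 < r) {c : ℝ≥0∞} (hc : c ≠ 0) (hp : 0 < p) :
    ∫⁻ x : E, (Metric.closedBall (0 : E) r).indicator (fun _ => c) x ^ p ≠ 0 := by
  have h1 : ∀ x : E, (Metric.closedBall (0 : E) r).indicator (fun _ => c) x ^ p =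
      (Metric.closedBall (0 : E) r).indicator (fun _ => c ^ p) x := by
    intro x
    by_cases hx : x ∈ Metric.closedBall (0 : E) r
    · simp only [Set.indicator_of_mem hx]
    · simp only [Set.indicator_of_notMem hx, ENNReal.zero_rpow_of_pos hp]
  simp_rw [h1]
  rw [lintegral_indicator Metric.isClosed_closedBall.measurableSet, setLIntegral_const]
  refine mul_ne_zero ?_ (Metric.measure_closedBall_pos volume _ hr).ne'
  rw [Ne, ENNReal.rpow_eq_zero_iff]
  rintro (h | h)
  · exact hc h.1
  · linarith [h.2]

theorem Normalized.admissible {G : E → ℝ≥0∞} (hG : Normalized G) (hp : 0 < p) :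
    Admissible p fun x => G x ^ (1 / p) := by
  have h1 : ∀ x, (G x ^ (1 / p)) ^ p = G x := fun x => by
    rw [← ENNReal.rpow_mul, one_div_mul_cancel hp.ne', ENNReal.rpow_one]
  refine ⟨hG.meas.pow_const _, fun x => by rw [hG.even], ?_, ?_⟩
  · simp_rw [h1]
    have h2 := indicator_ball_pow_ne_zero (E := E) (p := 1) (innerRadius_pos (E := E))
      thr_ne_zero one_pos
    simp only [ENNReal.rpow_one] at h2
    refine fun h3 => h2 (le_antisymm ((lintegral_mono fun x => ?_).trans h3.le) zero_le)
    by_cases hx : x ∈ Metric.closedBall (0 : E) (innerRadius E)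
    · simp only [Set.indicator_of_mem hx]
      exact hG.thr_le x (by simpa using hx)
    · simp only [Set.indicator_of_notMem hx]; exact zero_le
  · simp_rw [h1]
    exact ((lintegral_mono hG.le_exp).trans_lt (lintegral_exp_bound_ne_top (E := E)).lt_top).ne

/-- Here `G` is `(Lf)^q`, scaled to have value one at the origin and put in normal position. The
quotient ignores both changes, and `G ^ (1/p)` is a rescaled dual of `f`. -/
theorem Admissible.exists_normalized (hpq : ReverseConjugate p q) (hf : Admissible p f)
    (h : nrm q (lap f) ≠ ∞) :
    ∃ G : E → ℝ≥0∞, Normalized G ∧ LogConcave G ∧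
      nrm q (lap fun x => G x ^ (1 / p)) * nrm p f ≤
        nrm q (lap f) * nrm p fun x => G x ^ (1 / p) := by
  have hp := hpq.pos
  have hq := hpq.q_neg
  set H : E → ℝ≥0∞ := fun y => lap f y ^ q with hH
  have hHm : Measurable H := (measurable_lap hf.meas).pow_const q
  have hHl : LogConcave H := logConcave_lap_rpow hf.meas hp hf.ne_zero hq
  have hHe : ∀ y, H (-y) = H y := fun y => by simp only [hH, lap_neg hf.even]
  have hI0 : ∫⁻ y, H y ≠ 0 := lintegral_lap_ne_zero hpq h
  have hIt : ∫⁻ y, H y ≠ ∞ := hf.lintegral_lap_ne_top hpq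
  have hc0 : H 0 ≠ 0 := by
    intro h0
    apply hI0
    have : ∀ y, H y = 0 := fun y => le_antisymm (h0 ▸ hHl.le_of_even hHe y) zero_le
    simp [this]
  have hct : H 0 ≠ ∞ := by
    intro ht
    rcases ENNReal.rpow_eq_top_iff.1 ht with h1 | h1
    · exact lap_ne_zero hf.meas hf.ne_zero hp 0 h1.1
    · exact absurd h1.2 (not_lt.2 hq.le)
  set c := (H 0)⁻¹ with hc
  have hcne : c ≠ 0 := ENNReal.inv_ne_zero.2 hct
  have hcnt : c ≠ ∞ := ENNReal.inv_ne_top.2 hc0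
  have hKl : LogConcave fun x => c * H x := hHl.const_mul hcne hcnt
  have hK0 : c * H 0 = 1 := ENNReal.inv_mul_cancel hc0 hct
  obtain ⟨T, hT1, hT2⟩ := hKl.exists_position (hHm.const_mul c) (fun x => by rw [hHe]) hK0
    (by rw [lintegral_const_mul _ hHm]; exact mul_ne_zero hcne hI0)
    (by rw [lintegral_const_mul _ hHm]; exact ENNReal.mul_ne_top hcnt hIt)
  have hGl : LogConcave fun x => c * H (T x) := hKl.comp_linear (T : E →ₗ[ℝ] E)
  have hGe : ∀ x, c * H (T (-x)) = c * H (T x) := fun x => by rw [map_neg, hHe]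
  have hG0 : c * H (T 0) = 1 := by rw [map_zero, hK0]
  have hG1 : ∀ x, c * H (T x) ≤ 1 := fun x => hG0 ▸ hGl.le_of_even hGe x
  have hTm : Measurable T := (LinearMap.continuous_of_finiteDimensional (T : E →ₗ[ℝ] E)).measurable
  refine ⟨fun x => c * H (T x), ⟨(hHm.comp hTm).const_mul c, hGe, hG1, hT1,
    hGl.le_exp hG0 hG1 outerRadius_pos hT2⟩, hGl, ?_⟩
  have hd := hf.dual_admissible hpq h
  obtain ⟨K, hK0', hKt, e1, e2⟩ := exists_nrm_comp_linearEquiv hpq hd.meas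
    (rpow_ne_zero_of_finite hcne hcnt (1 / p)) (rpow_ne_top_of_finite hcne hcnt (1 / p)) T
  have e3 : (fun x => (c * H (T x)) ^ (1 / p)) =
      fun x => c ^ (1 / p) * dual q f (T x) := by
    funext x
    rw [mul_rpow_of_left_finite hcne hcnt]
    congr 1
    simp only [hH]
    rw [← dual_rpow hpq, ← ENNReal.rpow_mul, mul_one_div_cancel hp.ne', ENNReal.rpow_one]
  rw [e3, e1, e2, mul_assoc, mul_left_comm (nrm q (lap f))]
  exact mul_le_mul' le_rfl (hf.nrm_lap_dual_le hpq h)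

/-- The infimum of `‖Lf‖_q / ‖f‖_p` over even functions. -/
def evenInf (E : Type*) [NormedAddCommGroup E] [InnerProductSpace ℝ E] [FiniteDimensional ℝ E]
    [MeasurableSpace E] [BorelSpace E] (p q : ℝ) : ℝ≥0∞ :=
  ⨅ f : {f : E → ℝ≥0∞ // Admissible p f}, nrm q (lap f.1) / nrm p f.1

theorem evenInf_mul_le (hf : Admissible p f) : evenInf E p q * nrm p f ≤ nrm q (lap f) := by
  have h : evenInf E p q ≤ nrm q (lap f) / nrm p f :=
    iInf_le (fun f : {f : E → ℝ≥0∞ // Admissible p f} => nrm q (lap f.1) / nrm p f.1) ⟨f, hf⟩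
  exact (ENNReal.le_div_iff_mul_le (Or.inl hf.nrm_ne_zero) (Or.inl hf.nrm_ne_top)).1 h

theorem admissible_gauss (hp : 0 < p) : Admissible p (gauss 1 : E → ℝ≥0∞) where
  meas := measurable_gauss 1
  even := gauss_neg 1
  ne_zero := by
    rw [lintegral_gauss_rpow one_pos hp]
    have := Real.pi_pos
    simp only [ne_eq, ENNReal.ofReal_eq_zero, not_le]
    positivity
  ne_top := by rw [lintegral_gauss_rpow one_pos hp]; exact ENNReal.ofReal_ne_top

theorem evenInf_le_sharpConst (hpq : ReverseConjugate p q) :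
    evenInf E p q ≤ ENNReal.ofReal (sharpConst (Module.finrank ℝ E) p q) := by
  have hg := admissible_gauss (E := E) hpq.pos
  have h := evenInf_mul_le (q := q) hg
  rw [nrm_lap_gauss hpq one_pos] at h
  exact (ENNReal.mul_le_mul_iff_left hg.nrm_ne_zero hg.nrm_ne_top).1 h

theorem evenInf_ne_top (hpq : ReverseConjugate p q) : evenInf E p q ≠ ∞ :=
  ((evenInf_le_sharpConst hpq).trans_lt ENNReal.ofReal_lt_top).ne

theorem exists_normalized_le (hpq : ReverseConjugate p q) {ε : ℝ≥0∞} (hε : ε ≠ 0) :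
    ∃ G : E → ℝ≥0∞, Normalized G ∧ LogConcave G ∧
      nrm q (lap fun x => G x ^ (1 / p)) ≤
        (evenInf E p q + ε) * nrm p fun x => G x ^ (1 / p) := by
  obtain ⟨⟨f, hf⟩, hlt⟩ := iInf_lt_iff.1 (ENNReal.lt_add_right (evenInf_ne_top (E := E) hpq) hε)
  have hqt : nrm q (lap f) ≠ ∞ := by
    intro ht
    simp only [ht, ENNReal.top_div_of_ne_top hf.nrm_ne_top] at hlt
    exact absurd hlt (by simp)
  obtain ⟨G, hG, hGl, h⟩ := hf.exists_normalized hpq hqt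
  refine ⟨G, hG, hGl, ?_⟩
  have h1 : nrm q (lap f) ≤ (evenInf E p q + ε) * nrm p f :=
    (ENNReal.div_le_iff hf.nrm_ne_zero hf.nrm_ne_top).1 hlt.le
  refine (ENNReal.mul_le_mul_iff_left hf.nrm_ne_zero hf.nrm_ne_top).1 (h.trans ?_)
  calc _ ≤ ((evenInf E p q + ε) * nrm p f) * nrm p fun x => G x ^ (1 / p) := by gcongr
    _ = _ := by ring

/-- Lower semicontinuity of `‖Lg‖_q` along almost everywhere convergent normalized sequences. -/
theorem nrm_lap_le_liminf (hpq : ReverseConjugate p q) {G : ℕ → E → ℝ≥0∞}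
    (hG : ∀ j, Normalized (G j)) {u : E → ℝ≥0∞}
    (hu : ∀ᵐ x, Tendsto (fun j => G j x) atTop (𝓝 (u x))) :
    nrm q (lap fun x => u x ^ (1 / p)) ≤
      liminf (fun j => nrm q (lap fun x => G j x ^ (1 / p))) atTop := by
  have hp := hpq.pos
  have hq := hpq.q_neg
  set g : ℕ → E → ℝ≥0∞ := fun j x => G j x ^ (1 / p) with hg
  have hgm : ∀ j, Measurable (g j) := fun j => (hG j).meas.pow_const _
  have hanti : ∀ {r : ℝ}, r < 0 → Antitone fun t : ℝ≥0∞ => t ^ r :=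
    fun hr x y hxy => rpow_le_rpow_of_nonpos hr.le hxy
  have h1 : ∀ y, lap (fun x => u x ^ (1 / p)) y ≤ liminf (fun j => lap (g j) y) atTop := by
    intro y
    have h2 := lintegral_liminf_le (μ := volume) (u := atTop)
      fun j => measurable_mul_expInner (hgm j) y
    refine le_trans (le_of_eq (lintegral_congr_ae ?_)) h2
    filter_upwards [hu] with x hx
    have h3 : Tendsto (fun j => g j x * expInner x y) atTop
        (𝓝 (u x ^ (1 / p) * expInner x y)) := by
      refine ENNReal.Tendsto.mul_const ?_ (Or.inr (expInner_ne_top x y))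
      exact (ENNReal.continuous_rpow_const.tendsto _).comp hx
    exact h3.liminf_eq.symm
  have h2 : ∀ y, limsup (fun j => lap (g j) y ^ q) atTop ≤ lap (fun x => u x ^ (1 / p)) y ^ q := by
    intro y
    have h3 := (hanti hq).map_liminf_of_continuousAt (F := atTop) (fun j => lap (g j) y)
      ENNReal.continuous_rpow_const.continuousAt
    exact h3.symm.trans_le (hanti hq (h1 y))
  -- All `g j` dominate this multiple of a ball's indicator, so `(L low)^q` is an integrable
  -- majorant for the reverse Fatou lemma.
  set low : E → ℝ≥0∞ := (Metric.closedBall (0 : E) (innerRadius E)).indicator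
    fun _ => thr ^ (1 / p) with hlow
  have hlowm : Measurable low :=
    measurable_const.indicator Metric.isClosed_closedBall.measurableSet
  have hlowg : ∀ j x, low x ≤ g j x := by
    intro j x
    by_cases hx : x ∈ Metric.closedBall (0 : E) (innerRadius E)
    · simp only [hlow, Set.indicator_of_mem hx, hg]
      exact ENNReal.rpow_le_rpow ((hG j).thr_le x (by simpa using hx)) (one_div_pos.2 hp).le
    · simp only [hlow, Set.indicator_of_notMem hx]; exact zero_le
  have hlowe : ∀ x, low (-x) = low x := by
    intro x
    by_cases hx : x ∈ Metric.closedBall (0 : E) (innerRadius E)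
    · have hx' : -x ∈ Metric.closedBall (0 : E) (innerRadius E) := by simpa using hx
      simp only [hlow, Set.indicator_of_mem hx, Set.indicator_of_mem hx']
    · have hx' : -x ∉ Metric.closedBall (0 : E) (innerRadius E) := by simpa using hx
      simp only [hlow, Set.indicator_of_notMem hx, Set.indicator_of_notMem hx']
  have hlow0 : ∫⁻ x, low x ^ p ≠ 0 := indicator_ball_pow_ne_zero innerRadius_pos
    (rpow_ne_zero_of_finite thr_ne_zero thr_ne_top _) hp
  have h3 : limsup (fun j => ∫⁻ y, lap (g j) y ^ q) atTop ≤
      ∫⁻ y, lap (fun x => u x ^ (1 / p)) y ^ q := by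
    refine (limsup_lintegral_le (fun y => lap low y ^ q)
      (fun j => (measurable_lap (hgm j)).pow_const q)
      (fun j => Eventually.of_forall fun y =>
        rpow_le_rpow_of_nonpos hq.le (lap_mono (hlowg j) y))
      (lintegral_lap_rpow_ne_top hlowm hlowe hp hlow0 hq)).trans ?_
    exact lintegral_mono h2
  have h4 := (hanti hpq.one_div_q_neg).map_limsup_of_continuousAt (F := atTop)
    (fun j => ∫⁻ y, lap (g j) y ^ q) ENNReal.continuous_rpow_const.continuousAt
  calc nrm q (lap fun x => u x ^ (1 / p)) ≤
      (limsup (fun j => ∫⁻ y, lap (g j) y ^ q) atTop) ^ (1 / q) :=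
        hanti hpq.one_div_q_neg h3
    _ = _ := h4

/-- The infimum of `‖Lf‖_q / ‖f‖_p` over even functions is attained. -/
theorem exists_minimizer (hpq : ReverseConjugate p q) :
    ∃ g : E → ℝ≥0∞, Admissible p g ∧ nrm q (lap g) = evenInf E p q * nrm p g := by
  have hp := hpq.pos
  have hex : ∀ j : ℕ, ∃ G : E → ℝ≥0∞, Normalized G ∧ LogConcave G ∧
      nrm q (lap fun x => G x ^ (1 / p)) ≤
        (evenInf E p q + ((j : ℝ≥0∞) + 1)⁻¹) * nrm p fun x => G x ^ (1 / p) := fun j =>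
    exists_normalized_le hpq (ENNReal.inv_ne_zero.2 (by simp))
  choose G hG hGl hGle using hex
  obtain ⟨φ, hφ, hae⟩ := exists_subseq_ae_limsup_eq_liminf (fun j => (hG j).meas) hGl
    (fun j => (hG j).le_one) innerRadius_pos (fun j => (hG j).thr_le) lintegral_exp_bound_ne_top
    (fun j => (hG j).le_exp)
  -- The upper limit is defined at every point and inherits all the pointwise bounds, so it is
  -- itself normalized.
  set u : E → ℝ≥0∞ := fun x => limsup (fun j => G (φ j) x) atTop with hu
  have htend : ∀ᵐ x, Tendsto (fun j => G (φ j) x) atTop (𝓝 (u x)) := by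
    filter_upwards [hae] with x hx
    exact tendsto_of_liminf_eq_limsup hx rfl
  have huN : Normalized u := by
    refine ⟨Measurable.limsup fun j => (hG _).meas, fun x => ?_, fun x => ?_, fun x hx => ?_,
      fun x => ?_⟩
    · simp only [hu, (hG _).even]
    · exact limsup_le_of_le (by isBoundedDefault) (Eventually.of_forall fun j => (hG _).le_one x)
    · exact le_limsup_of_frequently_le
        (Eventually.of_forall fun j => (hG _).thr_le x hx).frequently (by isBoundedDefault)
    · exact limsup_le_of_le (by isBoundedDefault) (Eventually.of_forall fun j => (hG _).le_exp x)
  have huA := huN.admissible hp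
  refine ⟨_, huA, le_antisymm ?_ (evenInf_mul_le huA)⟩
  refine (nrm_lap_le_liminf hpq (fun j => hG (φ j)) htend).trans ?_
  have hpow : ∀ t : ℝ≥0∞, (t ^ (1 / p)) ^ p = t := fun t => by
    rw [← ENNReal.rpow_mul, one_div_mul_cancel hp.ne', ENNReal.rpow_one]
  have hnrm : Tendsto (fun j => nrm p fun x => G (φ j) x ^ (1 / p)) atTop
      (𝓝 (nrm p fun x => u x ^ (1 / p))) := by
    unfold nrm
    simp_rw [hpow]
    refine (ENNReal.continuous_rpow_const.tendsto _).comp ?_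
    exact tendsto_lintegral_of_dominated_convergence _ (fun j => (hG _).meas)
      (fun j => Eventually.of_forall (hG _).le_exp) lintegral_exp_bound_ne_top htend
  have heps : Tendsto (fun j => evenInf E p q + ((φ j : ℝ≥0∞) + 1)⁻¹) atTop
      (𝓝 (evenInf E p q + 0)) := by
    refine tendsto_const_nhds.add ?_
    have h1 : Tendsto (fun j : ℕ => ((j : ℝ≥0∞) + 1)⁻¹) atTop (𝓝 0) := by
      have := (tendsto_add_atTop_iff_nat 1).2 ENNReal.tendsto_inv_nat_nhds_zero
      simpa using this
    exact h1.comp hφ.tendsto_atTop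
  rw [add_zero] at heps
  have hprod := ENNReal.Tendsto.mul heps (Or.inr huA.nrm_ne_top) hnrm
    (Or.inr (evenInf_ne_top hpq))
  rw [← hprod.liminf_eq]
  exact liminf_le_liminf (Eventually.of_forall fun j => hGle (φ j))

end

/-! ### The doubling inequality and its equality case. -/

section

variable {E : Type*} [NormedAddCommGroup E] [InnerProductSpace ℝ E] [FiniteDimensional ℝ E]
  [MeasurableSpace E] [BorelSpace E] {f g : E → ℝ≥0∞} {p q : ℝ}

/-- Reverse Hölder is used with the transform on `F`, so only `F` has to be even. -/
theorem evenInf_mul_nrm_le_form (hpq : ReverseConjugate p q) {F G : E → ℝ≥0∞} (hF : Measurable F)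
    (hFe : ∀ x, F (-x) = F x) (hFt : ∫⁻ x, F x ^ p ≠ ∞) (hG : Measurable G) :
    evenInf E p q * (nrm p F * nrm p G) ≤ form F G := by
  by_cases h0 : ∫⁻ x, F x ^ p = 0
  · have : nrm p F = 0 := by rw [nrm, h0, ENNReal.zero_rpow_of_pos (one_div_pos.2 hpq.pos)]
    rw [this, zero_mul, mul_zero]
    exact zero_le
  · rw [form_comm hF hG]
    refine le_trans ?_ (nrm_mul_nrm_le_form hpq hG hF)
    rw [← mul_assoc, mul_comm]
    gcongr
    exact evenInf_mul_le ⟨hF, hFe, h0, hFt⟩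

theorem ae_lintegral_twist_ne_top (hp : 0 < p) (hf : Measurable f) (hft : ∫⁻ x, f x ^ p ≠ ∞) :
    ∀ᵐ x, ∫⁻ u, twist f x u ^ p ≠ ∞ := by
  have h1 : ∫⁻ x, doubled p f x ^ p ≠ ∞ := by
    rw [lintegral_doubled_rpow hp hf]; exact ENNReal.pow_ne_top hft
  filter_upwards [ae_lt_top ((measurable_doubled hf).pow_const p) h1] with x hx
  rw [doubled, nrm, ← ENNReal.rpow_mul, one_div_mul_cancel hp.ne', ENNReal.rpow_one] at hx
  exact hx.ne

/-- A twist is even in its second variable for arbitrary `f`; this is what later carries the bound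
beyond even functions. -/
theorem ae_evenInf_mul_doubled_le (hpq : ReverseConjugate p q) (hf : Measurable f)
    (hft : ∫⁻ x, f x ^ p ≠ ∞) (hg : Measurable g) :
    ∀ᵐ x, ∀ y, evenInf E p q * (doubled p f x * doubled p g y) ≤ form (twist f x) (twist g y) := by
  filter_upwards [ae_lintegral_twist_ne_top hpq.pos hf hft] with x hx y
  exact evenInf_mul_nrm_le_form hpq (measurable_twist hf x) (twist_neg f x) hx
    (measurable_twist hg y)

theorem lintegral_evenInf_mul_doubled (f : E → ℝ≥0∞) (hg : Measurable g) :
    ∫⁻ x, ∫⁻ y, expInner x y * (evenInf E p q * (doubled p f x * doubled p g y)) =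
      ∫⁻ x, evenInf E p q * (doubled p f x * lap (doubled p g) x) := by
  refine lintegral_congr fun x => ?_
  have h := measurable_mul_expInner (measurable_doubled (p := p) hg) x
  rw [lap, ← lintegral_const_mul _ h, ← lintegral_const_mul _ (h.const_mul _)]
  refine lintegral_congr fun y => ?_
  rw [expInner_comm]
  ring

/-- The doubling inequality. -/
theorem evenInf_mul_form_doubled_le (hpq : ReverseConjugate p q) (hf : Measurable f)
    (hft : ∫⁻ x, f x ^ p ≠ ∞) (hg : Measurable g) :
    evenInf E p q * form (doubled p f) (doubled p g) ≤ form f g ^ 2 := by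
  rw [form_sq hf hg, form, ← lintegral_const_mul' _ _ (evenInf_ne_top hpq),
    ← lintegral_evenInf_mul_doubled f hg]
  refine lintegral_mono_ae ?_
  filter_upwards [ae_evenInf_mul_doubled_le hpq hf hft hg] with x hx
  exact lintegral_mono fun y => by gcongr; exact hx y

theorem Admissible.doubled (hp : 0 < p) (hf : Admissible p f) : Admissible p (doubled p f) where
  meas := measurable_doubled hf.meas
  even := doubled_neg hf.even
  ne_zero := by rw [lintegral_doubled_rpow hp hf.meas]; exact pow_ne_zero _ hf.ne_zero
  ne_top := by rw [lintegral_doubled_rpow hp hf.meas]; exact ENNReal.pow_ne_top hf.ne_top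

/-- Since the doubled functions are even, the even bound can be applied once more after doubling,
and it returns `I^2 ‖f‖^2 ‖g‖^2 = form f g ^ 2`. Every inequality in the chain is thus an equality,
first for the outer and then for the inner integral. -/
theorem ae_form_twist_eq (hpq : ReverseConjugate p q) (hf : Admissible p f) (hg : Admissible p g)
    (heq : form f g = evenInf E p q * (nrm p f * nrm p g)) :
    ∀ᵐ x, ∀ᵐ y, form (twist f x) (twist g y) =
      evenInf E p q * (LaplaceLp.doubled p f x * LaplaceLp.doubled p g y) := by
  have hp := hpq.pos
  have hI := evenInf_ne_top (E := E) hpq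
  have hDm := measurable_doubled (p := p) hf.meas
  have hDm' := measurable_doubled (p := p) hg.meas
  have hfin : form f g ^ 2 ≠ ∞ := by
    rw [heq]
    exact ENNReal.pow_ne_top (ENNReal.mul_ne_top hI
      (ENNReal.mul_ne_top hf.nrm_ne_top hg.nrm_ne_top))
  have hle : form f g ^ 2 ≤
      ∫⁻ x, ∫⁻ y, expInner x y *
        (evenInf E p q * (LaplaceLp.doubled p f x * LaplaceLp.doubled p g y)) := by
    rw [lintegral_evenInf_mul_doubled f hg.meas, lintegral_const_mul' _ _ hI, ← form]
    have h1 := evenInf_mul_nrm_le_form hpq hDm (doubled_neg hf.even) (hf.doubled hp).ne_top hDm'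
    rw [nrm_doubled hp hf.meas, nrm_doubled hp hg.meas] at h1
    calc _ = evenInf E p q * (evenInf E p q * (nrm p f ^ 2 * nrm p g ^ 2)) := by rw [heq]; ring
      _ ≤ _ := by gcongr
  have hlow := ae_evenInf_mul_doubled_le hpq hf.meas hf.ne_top hg.meas
  rw [form_sq hf.meas hg.meas] at hle hfin
  have hm1 : Measurable fun z : E × E =>
      expInner z.1 z.2 * form (twist f z.1) (twist g z.2) :=
    measurable_expInner.mul (measurable_form_twist hf.meas hg.meas)
  have hm2 : Measurable fun z : E × E => expInner z.1 z.2 *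
      (evenInf E p q * (LaplaceLp.doubled p f z.1 * LaplaceLp.doubled p g z.2)) :=
    measurable_expInner.mul
      (((hDm.comp measurable_fst).mul (hDm'.comp measurable_snd)).const_mul _)
  have hle1 : ∀ᵐ x, ∫⁻ y, expInner x y *
      (evenInf E p q * (LaplaceLp.doubled p f x * LaplaceLp.doubled p g y)) ≤
      ∫⁻ y, expInner x y * form (twist f x) (twist g y) := by
    filter_upwards [hlow] with x hx
    exact lintegral_mono fun y => by gcongr; exact hx y
  have hout := ae_eq_of_ae_le_of_lintegral_le hle1
    ((lintegral_mono_ae hle1).trans_lt hfin.lt_top).ne hm1.lintegral_prod_right'.aemeasurable hle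
  filter_upwards [hout, hlow, ae_lt_top hm1.lintegral_prod_right' hfin] with x hx hlx hxt
  have hx' := ae_eq_of_ae_le_of_lintegral_le
    (f := fun y => expInner x y *
      (evenInf E p q * (LaplaceLp.doubled p f x * LaplaceLp.doubled p g y)))
    (g := fun y => expInner x y * form (twist f x) (twist g y))
    (Eventually.of_forall fun y => by beta_reduce; gcongr; exact hlx y)
    (by rw [hx]; exact hxt.ne) (hm1.comp measurable_prodMk_left).aemeasurable hx.ge
  filter_upwards [hx'] with y hy
  exact ((ENNReal.mul_right_inj (expInner_ne_zero x y) (expInner_ne_top x y)).1 hy).symm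

/-- For an extremal pair, the function `g ^ p` satisfies the functional equation of Gaussian
functions almost everywhere. -/
theorem exists_ae_twist_eq_mul (hpq : ReverseConjugate p q) (hf : Admissible p f)
    (hg : Admissible p g) (heq : form f g = evenInf E p q * (nrm p f * nrm p g)) :
    ∃ A B : E → ℝ≥0∞, ∀ᵐ y, ∀ᵐ v, twist (fun x => g x ^ p) y v = A y * B v := by
  have hp := hpq.pos
  have hfreq : ∃ᶠ x in ae (volume : Measure E), LaplaceLp.doubled p f x ≠ 0 := by
    intro hcon
    apply (hf.doubled hp).ne_zero
    rw [lintegral_eq_zero_iff ((measurable_doubled hf.meas).pow_const p)]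
    filter_upwards [hcon] with x hx
    simp [not_not.1 hx, hp]
  obtain ⟨x₀, hx0, hxt, hx⟩ := (hfreq.and_eventually
    ((ae_lintegral_twist_ne_top hp hf.meas hf.ne_top).and
      (ae_form_twist_eq hpq hf hg heq))).exists
  have hpow : ∀ t : ℝ≥0∞, (t ^ (1 / p)) ^ p = t := fun t => by
    rw [← ENNReal.rpow_mul, one_div_mul_cancel hp.ne', ENNReal.rpow_one]
  have hF : Admissible p (twist f x₀) := by
    refine ⟨measurable_twist hf.meas x₀, twist_neg f x₀, fun h0 => hx0 ?_, hxt⟩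
    rw [LaplaceLp.doubled, nrm, h0, ENNReal.zero_rpow_of_pos (one_div_pos.2 hp)]
  refine ⟨fun y => (∫⁻ v, twist g y v ^ p) / ∫⁻ v, lap (twist f x₀) v ^ q,
    fun v => lap (twist f x₀) v ^ q, ?_⟩
  filter_upwards [hx, ae_lintegral_twist_ne_top hp hg.meas hg.ne_top] with y hy hyt
  have htw : ∀ v, twist (fun x => g x ^ p) y v = twist g y v ^ p := fun v => by
    unfold twist; rw [ENNReal.mul_rpow_of_nonneg _ _ hp.le]
  have hGm := measurable_twist hg.meas y
  by_cases hy0 : ∫⁻ v, twist g y v ^ p = 0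
  · have h1 := hy0
    rw [lintegral_eq_zero_iff (hGm.pow_const p)] at h1
    filter_upwards [h1] with v hv
    rw [htw, hv, hy0]
    simp
  have hG0 : nrm p (twist g y) ≠ 0 := rpow_ne_zero_of_finite hy0 hyt _
  have hGt : nrm p (twist g y) ≠ ∞ := rpow_ne_top_of_finite hy0 hyt _
  have h1 := nrm_mul_nrm_le_form hpq hGm hF.meas
  rw [form_comm hGm hF.meas, hy, mul_comm] at h1
  -- Cancelling the norm of `twist g y` shows that `twist f x₀` is itself extremal, so reverse
  -- Hölder for `twist g y` and `L (twist f x₀)` is an equality. The profile in `v` then does not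
  -- depend on `y`.
  have h2 : nrm q (lap (twist f x₀)) ≤ evenInf E p q * nrm p (twist f x₀) := by
    refine (ENNReal.mul_le_mul_iff_left hG0 hGt).1 (h1.trans (le_of_eq ?_))
    rw [LaplaceLp.doubled, LaplaceLp.doubled, mul_assoc]
  have h3 := le_antisymm h2 (evenInf_mul_le hF)
  have hLt : nrm q (lap (twist f x₀)) ≠ ∞ := by
    rw [h3]; exact ENNReal.mul_ne_top (evenInf_ne_top hpq) hF.nrm_ne_top
  have h4 := ae_eq_of_reverse_holder_eq hpq hGm.aemeasurable (measurable_lap hF.meas).aemeasurable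
    hy0 hyt (lintegral_lap_ne_zero hpq hLt) (hF.lintegral_lap_ne_top hpq) (by
      have h5 := hy
      rw [form_comm hF.meas hGm] at h5
      refine h5.trans ?_
      change _ = nrm p (twist g y) * nrm q (lap (twist f x₀))
      rw [h3, LaplaceLp.doubled, LaplaceLp.doubled]
      ring)
  filter_upwards [h4] with v hv
  rw [htw]
  calc twist g y v ^ p = twist g y v ^ p / (∫⁻ v, twist g y v ^ p) * ∫⁻ v, twist g y v ^ p :=
        (ENNReal.div_mul_cancel hy0 hyt).symm
    _ = _ := by
        rw [hv]
        simp only [div_eq_mul_inv]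
        ring

end

/-! ### Quadratic forms and the support of solutions of the functional equation. -/

section

variable {E : Type*} [NormedAddCommGroup E] [InnerProductSpace ℝ E]

theorem LogConcave.convex_support {G : E → ℝ≥0∞} (hG : LogConcave G) (hGt : ∀ x, G x ≠ ∞) :
    Convex ℝ {x | G x ≠ 0} := by
  intro x hx y hy a b ha hb hab h0
  have h := hG x y a b ha hb hab
  rw [h0, nonpos_iff_eq_zero, mul_eq_zero] at h
  rcases h with h | h
  · exact rpow_ne_zero_of_finite hx (hGt x) a h
  · exact rpow_ne_zero_of_finite hy (hGt y) b h

/-- A continuous even solution of the parallelogram law defines a bilinear form. -/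
theorem exists_bilinForm_of_parallelogram {Q : E → ℝ} (hc : Continuous Q)
    (hQ : ∀ x z, Q (x + z) + Q (x - z) = 2 * Q x + 2 * Q z) :
    ∃ B : LinearMap.BilinForm ℝ E, LinearMap.IsSymm B ∧ ∀ x, B x x = Q x := by
  have h0 : Q 0 = 0 := by have := hQ 0 0; simp at this; linarith
  have heven : ∀ x, Q (-x) = Q x := fun x => by have := hQ 0 x; simp [h0] at this; linarith
  set M : E → E → ℝ := fun x z => (Q (x + z) - Q (x - z)) / 4 with hM
  have hsymm : ∀ x z, M x z = M z x := fun x z => by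
    simp only [hM]
    rw [add_comm, ← heven (x - z), neg_sub]
  have hadd : ∀ x y z, M (x + y) z = M x z + M y z := fun x y z => by
    have h1 := hQ (x + z) y
    have h2 := hQ (x - z) y
    have h3 := hQ (y + z) x
    have h4 := hQ (y - z) x
    have e1 : Q (x + z - y) = Q (y - z - x) := by rw [← heven]; congr 1; abel
    have e2 : Q (x - z - y) = Q (y + z - x) := by rw [← heven]; congr 1; abel
    rw [show x + z + y = x + y + z by abel] at h1
    rw [show x - z + y = x + y - z by abel] at h2
    rw [show y + z + x = x + y + z by abel] at h3
    rw [show y - z + x = x + y - z by abel] at h4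
    simp only [hM]
    linarith
  have hadd' : ∀ x y z, M x (y + z) = M x y + M x z := fun x y z => by
    rw [hsymm, hadd, hsymm y, hsymm z]
  have hcont : ∀ z, Continuous fun x => M x z := fun z => by simp only [hM]; fun_prop
  -- An additive continuous map between real vector spaces is real linear.
  have hsmul : ∀ (c : ℝ) x z, M (c • x) z = c * M x z := fun c x z =>
    map_real_smul (AddMonoidHom.mk' (fun x => M x z) fun x y => hadd x y z) (hcont z) c x
  refine ⟨LinearMap.mk₂ ℝ M hadd hsmul hadd' fun c x z => ?_, ⟨fun x y => ?_⟩, fun x => ?_⟩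
  · rw [hsymm, hsmul, hsymm, smul_eq_mul]
  · simp [hsymm x y]
  · have := hQ x x
    simp only [LinearMap.mk₂_apply, hM]
    simp only [sub_self, h0] at this ⊢
    linarith

theorem neg_mem_interior_support {G : E → ℝ≥0∞} (hsymm : ∀ x, G (-x) = G x) {a : E}
    (ha : a ∈ interior {x | G x ≠ 0}) : -a ∈ interior {x | G x ≠ 0} := by
  have h := (Homeomorph.neg E).preimage_interior {x | G x ≠ 0}
  have h1 : (Homeomorph.neg E) ⁻¹' {x | G x ≠ 0} = {x | G x ≠ 0} := by
    ext x
    simp [hsymm]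
  rw [h1] at h
  rw [← h] at ha
  exact ha

variable [FiniteDimensional ℝ E]

/-- A positive definite quadratic form is a multiple of the square of the norm in suitable linear
coordinates. -/
theorem exists_linearEquiv_apply_eq_norm_sq {B : LinearMap.BilinForm ℝ E} (hB : LinearMap.IsSymm B)
    (hpos : ∀ x, x ≠ 0 → 0 < B x x) :
    ∃ T : E ≃ₗ[ℝ] E, ∀ x, B (T x) (T x) = ‖x‖ ^ 2 / 2 := by
  obtain ⟨v, hv⟩ := LinearMap.BilinForm.exists_orthogonal_basis hB
  have hvp : ∀ i, 0 < B (v i) (v i) := fun i => hpos _ (v.ne_zero i)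
  have hu : ∀ i, (Real.sqrt (2 * B (v i) (v i)))⁻¹ ≠ 0 := fun i =>
    inv_ne_zero (Real.sqrt_pos.2 (by linarith [hvp i])).ne'
  set w := v.unitsSMul fun i => Units.mk0 _ (hu i) with hw
  have hwa : ∀ i, w i = (Real.sqrt (2 * B (v i) (v i)))⁻¹ • v i := fun i => by
    rw [hw, Module.Basis.unitsSMul_apply]; rfl
  have hww : ∀ i, B (w i) (w i) = 1 / 2 := fun i => by
    have h := Real.mul_self_sqrt (show 0 ≤ 2 * B (v i) (v i) by linarith [hvp i])
    have h' := hvp i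
    rw [hwa]
    simp only [map_smul, LinearMap.smul_apply, smul_eq_mul]
    have hs : Real.sqrt (2 * B (v i) (v i)) ≠ 0 := fun h => hu i (by rw [h, inv_zero])
    field_simp
    nlinarith
  have hwo : ∀ i j, i ≠ j → B (w i) (w j) = 0 := fun i j hij => by
    have h : B (v i) (v j) = 0 := hv hij
    rw [hwa, hwa]
    simp [h]
  set b := stdOrthonormalBasis ℝ E
  refine ⟨b.toBasis.equiv w (Equiv.refl _), fun x => ?_⟩
  have hT : b.toBasis.equiv w (Equiv.refl _) x = ∑ i, b.repr x i • w i := by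
    conv_lhs => rw [← b.sum_repr x]
    rw [map_sum]
    refine Finset.sum_congr rfl fun i _ => ?_
    rw [map_smul, ← b.coe_toBasis, Module.Basis.equiv_apply]
    rfl
  rw [hT, ← b.repr.norm_map x, EuclideanSpace.norm_sq_eq, Finset.sum_div]
  simp only [map_sum, LinearMap.sum_apply, map_smul, LinearMap.smul_apply, smul_eq_mul]
  refine Finset.sum_congr rfl fun i _ => ?_
  rw [Finset.sum_eq_single i (fun j _ hj => by rw [hwo _ _ hj]; ring) (by simp), hww,
    Real.norm_eq_abs, sq_abs]
  ring

variable [MeasurableSpace E] [BorelSpace E] {G : E → ℝ≥0∞} {A B : E → ℝ≥0∞}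

theorem invSqrtTwo_smul_smul_sqrt (a : E) :
    invSqrtTwo • Real.sqrt 2 • a = a := by
  rw [smul_smul, invSqrtTwo, inv_mul_cancel₀ (by positivity), one_smul]

/-- With `c = √2 a`, the twist is nonzero near `(c, 0)` and, by symmetry, near `(0, c)`. Hence `A`
and `B` are nonzero near `c`, almost everywhere in the sense needed, and so is the twist near `(c,
c)`, where one factor is `G` near `2a`. -/
theorem two_smul_mem_closure_support (hsymm : ∀ x, G (-x) = G x)
    (hAB : ∀ᵐ y, ∀ᵐ v, twist G y v = A y * B v)
    {a : E} (ha : a ∈ interior {x | G x ≠ 0}) :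
    (2 : ℝ) • a ∈ closure {x | G x ≠ 0} := by
  set U : Set E := {x | G x ≠ 0} with hU
  have hna : -a ∈ interior U := neg_mem_interior_support hsymm ha
  have hcp : Continuous fun z : E × E => invSqrtTwo • (z.1 + z.2) := by fun_prop
  have hcm : Continuous fun z : E × E => invSqrtTwo • (z.1 - z.2) := by fun_prop
  set c := Real.sqrt 2 • a with hc
  have hsc : invSqrtTwo • c = a := invSqrtTwo_smul_smul_sqrt a
  have hev : ∀ᶠ z : E × E in 𝓝 (c, 0), twist G z.1 z.2 ≠ 0 := by
    have h1 : ∀ᶠ z : E × E in 𝓝 (c, 0), invSqrtTwo • (z.1 + z.2) ∈ U :=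
      hcp.continuousAt.eventually_mem (by simpa [hsc] using mem_interior_iff_mem_nhds.1 ha)
    have h2 : ∀ᶠ z : E × E in 𝓝 (c, 0), invSqrtTwo • (z.1 - z.2) ∈ U :=
      hcm.continuousAt.eventually_mem (by simpa [hsc] using mem_interior_iff_mem_nhds.1 ha)
    filter_upwards [h1, h2] with z h1 h2
    exact mul_ne_zero h1 h2
  have hev' : ∀ᶠ z : E × E in 𝓝 (0, c), twist G z.1 z.2 ≠ 0 := by
    have h1 : ∀ᶠ z : E × E in 𝓝 (0, c), invSqrtTwo • (z.1 + z.2) ∈ U :=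
      hcp.continuousAt.eventually_mem (by simpa [hsc] using mem_interior_iff_mem_nhds.1 ha)
    have h2 : ∀ᶠ z : E × E in 𝓝 (0, c), invSqrtTwo • (z.1 - z.2) ∈ U :=
      hcm.continuousAt.eventually_mem (by simpa [hsc] using mem_interior_iff_mem_nhds.1 hna)
    filter_upwards [h1, h2] with z h1 h2
    exact mul_ne_zero h1 h2
  rw [nhds_prod_eq] at hev hev'
  obtain ⟨P1, hP1, R1, hR1, hPR1⟩ := eventually_prod_iff.1 hev
  obtain ⟨R2, hR2, P2, hP2, hPR2⟩ := eventually_prod_iff.1 hev'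
  have hfreq : ∀ {P : E → Prop} {x : E}, (∀ᵐ y, P y) → ∀ {R : E → Prop}, (∀ᶠ y in 𝓝 x, R y) →
      ∃ y, R y ∧ P y := fun hP _ hR =>
    (mem_closure_iff_nhds.1 ((Measure.dense_of_ae hP) _) _ hR).imp fun _ h => h
  rw [mem_closure_iff_nhds]
  intro N hN
  have hN' : ∀ᶠ z : E × E in 𝓝 (c, c), invSqrtTwo • (z.1 + z.2) ∈ N :=
    hcp.continuousAt.eventually_mem (by
      simp only [smul_add, hsc]; rwa [← two_smul ℝ a])
  rw [nhds_prod_eq] at hN'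
  obtain ⟨P3, hP3, P4, hP4, hPN⟩ := eventually_prod_iff.1 hN'
  have hBv : ∀ᵐ v, P2 v → B v ≠ 0 := by
    obtain ⟨y, hy, hyv⟩ := hfreq hAB hR2
    filter_upwards [hyv] with v hv h2 hB
    exact hPR2 hy h2 (by rw [hv, hB, mul_zero])
  obtain ⟨y, ⟨hy1, hy3⟩, hyv⟩ := hfreq hAB (hP1.and hP3)
  have hAy : A y ≠ 0 := by
    obtain ⟨v, hv1, hv⟩ := hfreq hyv hR1
    intro hA
    exact hPR1 hy1 hv1 (by rw [hv, hA, zero_mul])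
  obtain ⟨v, ⟨hv2, hv4⟩, hv, hvB⟩ := hfreq (hyv.and hBv) (hP2.and hP4)
  refine ⟨_, hPN hy3 hv4, ?_⟩
  have h := mul_ne_zero hAy (hvB hv2)
  rw [← hv, twist] at h
  exact left_ne_zero_of_mul h

/-- The interior of the convex support contains `0` and is stable under doubling, so it is the whole
space. -/
theorem LogConcave.ne_zero_of_twist (hG : LogConcave G) (hGt : ∀ x, G x ≠ ∞)
    (hsymm : ∀ x, G (-x) = G x) (hI : ∫⁻ x, G x ≠ 0)
    (hAB : ∀ᵐ y, ∀ᵐ v, twist G y v = A y * B v) (x : E) : G x ≠ 0 := by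
  set U : Set E := {x | G x ≠ 0} with hU
  have hconv : Convex ℝ U := hG.convex_support hGt
  have hne : (interior U).Nonempty := by
    by_contra hcon
    rw [Set.not_nonempty_iff_eq_empty] at hcon
    -- A convex set with empty interior lies in its frontier, which is null.
    have h1 := hconv.addHaar_frontier (volume : Measure E)
    have h2 : volume U = 0 := measure_mono_null (fun y hy => by
      rw [frontier, hcon, Set.sdiff_empty]; exact subset_closure hy) h1
    apply hI
    have h3 : ∀ᵐ y, G y = 0 := by
      rw [ae_iff]; exact h2
    rw [lintegral_congr_ae h3, lintegral_zero]
  have h0 : (0 : E) ∈ interior U := by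
    obtain ⟨a, ha⟩ := hne
    have hna : -a ∈ interior U := neg_mem_interior_support hsymm ha
    have := hconv.interior ha hna (a := 1 / 2) (b := 1 / 2) (by norm_num) (by norm_num)
      (by norm_num)
    simpa using this
  have hdouble : ∀ a ∈ interior U, (2 : ℝ) • a ∈ interior U := by
    intro a ha
    rw [← hconv.interior_closure_eq_interior_of_nonempty_interior hne]
    have hopen : IsOpen ((fun x : E => (2 : ℝ) • x) '' interior U) :=
      isOpenMap_smul₀ (two_ne_zero' ℝ) _ isOpen_interior
    refine interior_maximal ?_ hopen ⟨a, ha, rfl⟩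
    rintro _ ⟨b, hb, rfl⟩
    exact two_smul_mem_closure_support hsymm hAB hb
  have hiter : ∀ (k : ℕ), ∀ a ∈ interior U, (2 : ℝ) ^ k • a ∈ interior U := by
    intro k
    induction k with
    | zero => simp
    | succ k ih => intro a ha; rw [pow_succ, mul_smul]; exact ih _ (hdouble a ha)
  have hlim : Tendsto (fun k : ℕ => ((2 : ℝ)⁻¹ ^ k) • x) atTop (𝓝 ((0 : ℝ) • x)) :=
    (tendsto_pow_atTop_nhds_zero_of_lt_one (by norm_num) (by norm_num)).smul_const x
  rw [zero_smul] at hlim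
  obtain ⟨k, hk⟩ := (hlim.eventually (isOpen_interior.mem_nhds h0)).exists
  have := hiter k _ hk
  rw [smul_smul, ← mul_pow, mul_inv_cancel₀ two_ne_zero, one_pow, one_smul] at this
  exact interior_subset this

end

/-! ### Gaussian solutions and the value of the even constant. -/

section

variable {E : Type*} [NormedAddCommGroup E] [InnerProductSpace ℝ E]

theorem LogConcave.concaveOn_log {G : E → ℝ≥0∞} (hG : LogConcave G) (hGt : ∀ x, G x ≠ ∞)
    (hG0 : ∀ x, G x ≠ 0) : ConcaveOn ℝ Set.univ fun x => Real.log (G x).toReal := by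
  have hpos : ∀ x, 0 < (G x).toReal := fun x => ENNReal.toReal_pos (hG0 x) (hGt x)
  refine ⟨convex_univ, fun x _ y _ a b ha hb hab => ?_⟩
  have h := ENNReal.toReal_mono (hGt _) (hG x y a b ha hb hab)
  rw [ENNReal.toReal_mul, ← ENNReal.toReal_rpow, ← ENNReal.toReal_rpow] at h
  have h1 := Real.log_le_log (by have := hpos x; have := hpos y; positivity) h
  rwa [Real.log_mul (Real.rpow_pos_of_pos (hpos x) a).ne' (Real.rpow_pos_of_pos (hpos y) b).ne',
    Real.log_rpow (hpos x), Real.log_rpow (hpos y)] at h1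

variable [FiniteDimensional ℝ E] [MeasurableSpace E] [BorelSpace E] {G : E → ℝ≥0∞}
  {A B : E → ℝ≥0∞}

/-- An almost everywhere product decomposition of a continuous function is a cross-ratio identity
everywhere. -/
theorem mul_eq_mul_of_ae_eq_mul {F : E → E → ℝ} (hF : Continuous fun z : E × E => F z.1 z.2)
    {A B : E → ℝ} (hAB : ∀ᵐ y, ∀ᵐ v, F y v = A y * B v) (y y' v v' : E) :
    F y v * F y' v' = F y v' * F y' v := by
  have hFl : ∀ y, Continuous (F y) := fun y =>
    hF.comp (Continuous.prodMk continuous_const continuous_id)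
  have hFr : ∀ v, Continuous fun y => F y v := fun v =>
    hF.comp (Continuous.prodMk continuous_id continuous_const)
  have h1 : ∀ y, (∀ᵐ v, F y v = A y * B v) → ∀ y', (∀ᵐ v, F y' v = A y' * B v) → ∀ v v',
      F y v * F y' v' = F y v' * F y' v := by
    intro y hy y' hy' v v'
    have hd := Measure.dense_of_ae (hy.and hy')
    have h2 : Continuous fun z : E × E => F y z.1 * F y' z.2 :=
      ((hFl y).comp continuous_fst).mul ((hFl y').comp continuous_snd)
    have h3 : Continuous fun z : E × E => F y z.2 * F y' z.1 :=
      ((hFl y).comp continuous_snd).mul ((hFl y').comp continuous_fst)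
    have h4 := Continuous.ext_on (hd.prod hd) h2 h3 (by
      rintro ⟨a, b⟩ ⟨⟨ha, ha'⟩, ⟨hb, hb'⟩⟩
      simp only at ha ha' hb hb' ⊢
      rw [ha, ha', hb, hb']
      ring)
    exact congrFun h4 (v, v')
  have hd := Measure.dense_of_ae hAB
  have h2 : Continuous fun z : E × E => F z.1 v * F z.2 v' :=
    ((hFr v).comp continuous_fst).mul ((hFr v').comp continuous_snd)
  have h3 : Continuous fun z : E × E => F z.1 v' * F z.2 v :=
    ((hFr v').comp continuous_fst).mul ((hFr v).comp continuous_snd)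
  exact congrFun (Continuous.ext_on (hd.prod hd) h2 h3 fun z hz => h1 z.1 hz.1 z.2 hz.2 v v')
    (y, y')

/-- An even log-concave function which decays at infinity and satisfies the functional equation of
Gaussian functions is a Gaussian function in suitable linear coordinates. -/
theorem LogConcave.exists_comp_eq_gauss (hG : LogConcave G) (hGt : ∀ x, G x ≠ ∞)
    (hsymm : ∀ x, G (-x) = G x) (hI : ∫⁻ x, G x ≠ 0)
    (hdecay : ∀ x, x ≠ 0 → Tendsto (fun k : ℕ => G ((2 : ℝ) ^ k • x)) atTop (𝓝 0))
    (hAB : ∀ᵐ y, ∀ᵐ v, twist G y v = A y * B v) :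
    ∃ T : E ≃ₗ[ℝ] E, ∀ x, G (T x) = G 0 * gauss 1 x := by
  have hG0 := hG.ne_zero_of_twist hGt hsymm hI hAB
  have hpos : ∀ x, 0 < (G x).toReal := fun x => ENNReal.toReal_pos (hG0 x) (hGt x)
  have hψ := hG.concaveOn_log hGt hG0
  set ψ : E → ℝ := fun x => Real.log (G x).toReal with hψd
  -- A finite concave function on the whole finite-dimensional space is continuous, which upgrades
  -- almost everywhere identities to everywhere.
  have hψc : Continuous ψ := hψ.locallyLipschitz.continuous
  have hexp : ∀ x, (G x).toReal = Real.exp (ψ x) := fun x => (Real.exp_log (hpos x)).symm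
  have hψn : ∀ x, ψ (-x) = ψ x := fun x => by simp only [hψd, hsymm]
  have hle : ∀ x, ψ x ≤ ψ 0 := fun x =>
    Real.log_le_log (hpos x) (ENNReal.toReal_mono (hGt 0) (hG.le_of_even hsymm x))
  have hcross := mul_eq_mul_of_ae_eq_mul
    (F := fun y v => Real.exp (ψ (invSqrtTwo • (y + v)) + ψ (invSqrtTwo • (y - v))))
    (A := fun y => (A y).toReal) (B := fun v => (B v).toReal) (by fun_prop) (by
      filter_upwards [hAB] with y hy
      filter_upwards [hy] with v hv
      rw [← ENNReal.toReal_mul, ← hv, twist, ENNReal.toReal_mul, hexp, hexp, Real.exp_add])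
  have hfe : ∀ x z, ψ (x + z) + ψ (x - z) + 2 * ψ 0 = 2 * ψ x + 2 * ψ z := by
    intro x z
    -- The cross-ratio identity based at the origin; with `ψ` even it is the parallelogram law for
    -- `ψ 0 - ψ`.
    have h := hcross (Real.sqrt 2 • x) 0 (Real.sqrt 2 • z) 0
    simp only [← Real.exp_add, Real.exp_eq_exp, ← smul_add, ← smul_sub, invSqrtTwo_smul_smul_sqrt,
      add_zero, sub_zero, zero_add, zero_sub, smul_zero, smul_neg, hψn] at h
    linarith
  obtain ⟨M, hM, hMQ⟩ := exists_bilinForm_of_parallelogram (Q := fun x => ψ 0 - ψ x)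
    (by fun_prop) fun x z => by linarith [hfe x z]
  have hMpos : ∀ x, x ≠ 0 → 0 < M x x := by
    intro x hx
    rw [hMQ]
    refine lt_of_le_of_ne (by linarith [hle x]) fun h0 => ?_
    -- On a null direction of the form, `G` would be constant along `2^k x`, against the decay.
    have hk : ∀ k : ℕ, G ((2 : ℝ) ^ k • x) = G 0 := by
      intro k
      have h1 := hMQ ((2 : ℝ) ^ k • x)
      simp only [map_smul, LinearMap.smul_apply, hMQ, ← h0, smul_zero] at h1
      rw [← ENNReal.toReal_eq_toReal_iff' (hGt _) (hGt _), hexp, hexp]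
      congr 1
      linarith
    have h2 := hdecay x hx
    simp only [hk] at h2
    exact hG0 0 (tendsto_nhds_unique tendsto_const_nhds h2)
  obtain ⟨T, hT⟩ := exists_linearEquiv_apply_eq_norm_sq hM hMpos
  refine ⟨T, fun x => ?_⟩
  have h1 := hT x
  rw [hMQ] at h1
  rw [← ENNReal.ofReal_toReal (hGt (T x)), ← ENNReal.ofReal_toReal (hGt 0), gauss,
    ← ENNReal.ofReal_mul ENNReal.toReal_nonneg, hexp, hexp, ← Real.exp_add]
  congr 2
  linarith

variable {p q : ℝ}

/-- The sharp inequality for even functions. -/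
theorem evenInf_eq_sharpConst (hpq : ReverseConjugate p q) :
    evenInf E p q = ENNReal.ofReal (sharpConst (Module.finrank ℝ E) p q) := by
  refine le_antisymm (evenInf_le_sharpConst hpq) ?_
  have hp := hpq.pos
  obtain ⟨f, hf, hmin⟩ := exists_minimizer (E := E) hpq
  have hfin : nrm q (lap f) ≠ ∞ := by
    rw [hmin]; exact ENNReal.mul_ne_top (evenInf_ne_top hpq) hf.nrm_ne_top
  have hd := hf.dual_admissible hpq hfin
  obtain ⟨A, B, hAB⟩ := exists_ae_twist_eq_mul hpq hf hd (by
    rw [hf.form_dual hpq hfin, hmin]; ring)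
  obtain ⟨c, δ, -, hδ, hdec⟩ := exists_lap_rpow_le hf.meas hf.even hp hf.ne_zero hpq.q_neg
  have hGt : ∀ y, lap f y ^ q ≠ ∞ := fun y => ((hdec y).trans_lt ENNReal.ofReal_lt_top).ne
  simp only [dual_rpow hpq] at hAB
  obtain ⟨T, hT⟩ := (logConcave_lap_rpow hf.meas hp hf.ne_zero hpq.q_neg).exists_comp_eq_gauss hGt
    (fun x => by rw [lap_neg hf.even]) (lintegral_lap_ne_zero hpq hfin) (fun x hx => by
      refine tendsto_of_tendsto_of_tendsto_of_le_of_le tendsto_const_nhds ?_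
        (fun _ => zero_le) (fun k => hdec _)
      rw [← ENNReal.ofReal_zero]
      refine ENNReal.tendsto_ofReal ?_
      rw [← mul_zero c]
      refine Tendsto.const_mul c (Real.tendsto_exp_neg_atTop_nhds_zero.comp ?_)
      refine Tendsto.const_mul_atTop hδ ?_
      simp only [norm_smul, norm_pow, Real.norm_ofNat]
      exact (tendsto_pow_atTop_atTop_of_one_lt one_lt_two).atTop_mul_const (norm_pos_iff.2 hx))
    hAB
  have hG0 : lap f 0 ^ q ≠ 0 := by
    intro h0
    refine lintegral_lap_ne_zero hpq hfin ?_
    have : ∀ x, lap f x ^ q = 0 := fun x => by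
      rw [← T.apply_symm_apply x, hT, h0, zero_mul]
    simp [this]
  set k := (lap f 0 ^ q) ^ (1 / p) with hk
  have hk0 : k ≠ 0 := rpow_ne_zero_of_finite hG0 (hGt 0) _
  have hkt : k ≠ ∞ := rpow_ne_top_of_finite hG0 (hGt 0) _
  -- In the new coordinates `(Lf)^q` is a multiple of the Gaussian of variance `1`; its power `1/p`
  -- has variance `p`.
  have hgauss : (fun x => k⁻¹ * dual q f (T x)) = gauss p := by
    funext x
    have h1 : dual q f (T x) = (dual q f (T x) ^ p) ^ (1 / p) := by
      rw [← ENNReal.rpow_mul, mul_one_div_cancel hp.ne', ENNReal.rpow_one]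
    rw [h1, dual_rpow hpq, hT, mul_rpow_of_left_finite hG0 (hGt 0), ← hk, ← mul_assoc,
      ENNReal.inv_mul_cancel hk0 hkt, one_mul, gauss_rpow, gauss]
    congr 2
    field_simp
  obtain ⟨K, hK0, hKt, e1, e2⟩ := exists_nrm_comp_linearEquiv hpq hd.meas
    (ENNReal.inv_ne_zero.2 hkt) (ENNReal.inv_ne_top.2 hk0) T
  rw [hgauss] at e1 e2
  have h1 := nrm_lap_gauss (E := E) hpq hp
  rw [e1, e2, mul_left_comm] at h1
  have h2 := (ENNReal.mul_right_inj hK0 hKt).1 h1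
  -- The dual has the Gaussian quotient, and its quotient is at most the infimum.
  have h3 := hf.nrm_lap_dual_le hpq hfin
  rw [h2, hmin] at h3
  refine (ENNReal.mul_le_mul_iff_left (mul_ne_zero hd.nrm_ne_zero hf.nrm_ne_zero)
    (ENNReal.mul_ne_top hd.nrm_ne_top hf.nrm_ne_top)).1 ?_
  calc _ = _ := (mul_assoc _ _ _).symm
    _ ≤ _ := h3
    _ = _ := by ring

end

/-! ### From even to arbitrary functions by iterating the doubling inequality. -/

/-- The factor `b ^ k` is at most a fixed power of `2 ^ k`, and cannot compensate the decay of `(y /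
x) ^ 2 ^ k` if `y < x`. -/
theorem le_of_forall_pow_two_pow_le {x y K b : ℝ≥0∞} (hx : x ≠ ∞) (hK : K ≠ ∞) (hb : b ≠ ∞)
    (h : ∀ k : ℕ, x ^ 2 ^ k ≤ y ^ 2 ^ k * (K * b ^ k)) : x ≤ y := by
  by_contra! hlt
  have hy : y ≠ ∞ := (hlt.trans_le le_top).ne
  have hx0 : 0 < x.toReal := ENNReal.toReal_pos (zero_le.trans_lt hlt).ne' hx
  set r := y.toReal / x.toReal with hr
  have hr0 : 0 ≤ r := by positivity
  have hr1 : r < 1 := by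
    rw [hr, div_lt_one hx0]; exact (ENNReal.toReal_lt_toReal hy hx).2 hlt
  obtain ⟨m, hm⟩ := pow_unbounded_of_one_lt b.toReal (one_lt_two (α := ℝ))
  have hk : ∀ k : ℕ, 1 ≤ K.toReal * (((2 ^ k : ℕ) : ℝ) ^ m * r ^ 2 ^ k) := by
    intro k
    have h1 := ENNReal.toReal_mono (ENNReal.mul_ne_top (ENNReal.pow_ne_top hy)
      (ENNReal.mul_ne_top hK (ENNReal.pow_ne_top hb))) (h k)
    simp only [ENNReal.toReal_mul, ENNReal.toReal_pow] at h1
    have h2 : y.toReal = r * x.toReal := by rw [hr, div_mul_cancel₀ _ hx0.ne']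
    have h3 : b.toReal ^ k ≤ ((2 ^ k : ℕ) : ℝ) ^ m := by
      push_cast
      rw [pow_right_comm]
      exact pow_le_pow_left₀ ENNReal.toReal_nonneg hm.le k
    rw [h2, mul_pow] at h1
    have h4 : x.toReal ^ 2 ^ k * 1 ≤
        x.toReal ^ 2 ^ k * (K.toReal * (((2 ^ k : ℕ) : ℝ) ^ m * r ^ 2 ^ k)) := by
      calc _ ≤ r ^ 2 ^ k * x.toReal ^ 2 ^ k * (K.toReal * b.toReal ^ k) := by rwa [mul_one]
        _ ≤ r ^ 2 ^ k * x.toReal ^ 2 ^ k * (K.toReal * ((2 ^ k : ℕ) : ℝ) ^ m) := by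
            gcongr
        _ = _ := by ring
    exact le_of_mul_le_mul_left h4 (by positivity)
  have hlim := ((tendsto_pow_const_mul_const_pow_of_abs_lt_one m
    (by rwa [abs_of_nonneg hr0])).comp
      (tendsto_pow_atTop_atTop_of_one_lt (one_lt_two (α := ℕ)))).const_mul K.toReal
  rw [mul_zero] at hlim
  obtain ⟨k, hk'⟩ := (hlim.eventually (gt_mem_nhds one_pos)).exists
  exact absurd (hk k) (not_le.2 hk')

section

variable {E : Type*} [NormedAddCommGroup E] [InnerProductSpace ℝ E] [FiniteDimensional ℝ E]
  [MeasurableSpace E] [BorelSpace E] {f g : E → ℝ≥0∞} {p q R : ℝ}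

/-- Hölder on the ball containing the support bounds the integral of `f ^ p` by that of `f`. -/
theorem one_le_lintegral_mul_volume (hp : 0 < p) (hp1 : p < 1) (hf : Measurable f)
    (hR : ∀ x, f x ≠ 0 → ‖x‖ ≤ R) (h1 : 1 ≤ ∫⁻ x, f x ^ p) :
    1 ≤ (∫⁻ x, f x) * volume (Metric.closedBall (0 : E) R) ^ ((1 - p) / p) := by
  have h := ENNReal.lintegral_mul_norm_pow_le (μ := (volume : Measure E)) (f := f)
    (g := (Metric.closedBall (0 : E) R).indicator fun _ => 1) (p := p) (q := 1 - p)
    hf.aemeasurable (measurable_const.indicator measurableSet_closedBall).aemeasurable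
    hp.le (by linarith) (by ring)
  rw [lintegral_indicator_const measurableSet_closedBall, one_mul] at h
  have h2 : ∀ x, f x ^ p *
      (Metric.closedBall (0 : E) R).indicator (fun _ => (1 : ℝ≥0∞)) x ^ (1 - p) = f x ^ p := by
    intro x
    by_cases hx : f x = 0
    · simp [hx, hp]
    · rw [Set.indicator_of_mem (by simpa using hR x hx), ENNReal.one_rpow, mul_one]
  simp only [h2] at h
  have h3 := ENNReal.rpow_le_rpow (h1.trans h) (one_div_nonneg.2 hp.le)
  rwa [ENNReal.one_rpow, ENNReal.mul_rpow_of_nonneg _ _ (one_div_nonneg.2 hp.le),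
    ← ENNReal.rpow_mul, ← ENNReal.rpow_mul, mul_one_div_cancel hp.ne', ENNReal.rpow_one,
    mul_one_div] at h3

theorem norm_le_of_doubled_ne_zero (hp : 0 < p) (hR : ∀ x, f x ≠ 0 → ‖x‖ ≤ R) {x : E}
    (hx : doubled p f x ≠ 0) : ‖x‖ ≤ Real.sqrt 2 * R := by
  have h : ∃ u, twist f x u ≠ 0 := by
    by_contra! hcon
    apply hx
    rw [doubled, nrm]
    simp [hcon, hp]
  obtain ⟨u, hu⟩ := h
  have h1 := hR _ (left_ne_zero_of_mul hu)
  have h2 := hR _ (right_ne_zero_of_mul hu)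
  have h3 : ‖(2 * invSqrtTwo) • x‖ ≤ R + R := by
    have : (2 * invSqrtTwo) • x = invSqrtTwo • (x + u) + invSqrtTwo • (x - u) := by module
    rw [this]
    exact (norm_add_le _ _).trans (add_le_add h1 h2)
  have h4 := invSqrtTwo_pos
  rw [norm_smul, Real.norm_of_nonneg (by positivity)] at h3
  have h5 : invSqrtTwo * Real.sqrt 2 = 1 := inv_mul_cancel₀ (by positivity)
  have h6 : invSqrtTwo * ‖x‖ ≤ invSqrtTwo * (Real.sqrt 2 * R) := by
    rw [← mul_assoc, h5]; linarith
  exact le_of_mul_le_mul_left h6 h4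

/-- The lower bound for `form f g` from which the iteration of the doubling inequality starts. -/
theorem one_le_form_mul_volume (hp : 0 < p) (hp1 : p < 1) (hf : Measurable f) (hg : Measurable g)
    (hfR : ∀ x, f x ≠ 0 → ‖x‖ ≤ R) (hgR : ∀ x, g x ≠ 0 → ‖x‖ ≤ R)
    (hlap : ∀ y, 1 ≤ lap (fun x => f x ^ p) y) (h1 : 1 ≤ ∫⁻ x, g x ^ p) :
    1 ≤ form f g * (volume (Metric.closedBall (0 : E) R) ^ ((1 - p) / p)) ^ 2 := by
  set V := volume (Metric.closedBall (0 : E) R) ^ ((1 - p) / p) with hV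
  have hVt : V ≠ ∞ := ENNReal.rpow_ne_top_of_nonneg (div_nonneg (by linarith) hp.le)
    measure_closedBall_lt_top.ne
  -- The tilted function `f exp(x·y)` keeps its support, and its `p`-mass is the transform of `f ^
  -- p` at `p y`, which is at least one.
  have h2 : ∀ y, 1 ≤ lap f y * V := by
    intro y
    refine one_le_lintegral_mul_volume hp hp1 (measurable_mul_expInner hf y)
      (fun x hx => hfR x (left_ne_zero_of_mul hx)) ((hlap (p • y)).trans (le_of_eq ?_))
    refine lintegral_congr fun x => ?_
    rw [ENNReal.mul_rpow_of_nonneg _ _ hp.le, expInner_rpow]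
  have hgle : ∫⁻ x, g x ≤ ∫⁻ x, g x * lap f x * V :=
    lintegral_mono fun x => by
      rw [mul_assoc]; exact le_mul_of_one_le_right' (h2 x)
  rw [lintegral_mul_const' _ _ hVt] at hgle
  rw [form_comm hf hg, form, sq, ← mul_assoc]
  exact (one_le_lintegral_mul_volume hp hp1 hg hgR h1).trans (by gcongr)

/-- Induction with `f`, `g` and `R` free: the hypotheses pass to the doubled functions with radius
`√2 R`. Each step costs only the growth of the ball's volume, while the doubling inequality absorbs
one factor `I ^ 2 ^ k`. -/
theorem evenInf_pow_le (hpq : ReverseConjugate p q) (k : ℕ) :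
    ∀ {f g : E → ℝ≥0∞} {R : ℝ}, 0 ≤ R → Measurable f → Measurable g →
      (∀ x, f x ≠ 0 → ‖x‖ ≤ R) → (∀ x, g x ≠ 0 → ‖x‖ ≤ R) → (∀ y, 1 ≤ lap (fun x => f x ^ p) y) →
      ∫⁻ x, f x ^ p = 1 → ∫⁻ x, g x ^ p = 1 →
      evenInf E p q ^ 2 ^ k ≤ form f g ^ 2 ^ k *
        (evenInf E p q * (volume (Metric.closedBall (0 : E) R) ^ ((1 - p) / p)) ^ 2 *
          ((ENNReal.ofReal (Real.sqrt 2 ^ Module.finrank ℝ E) ^ ((1 - p) / p)) ^ 2) ^ k) := by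
  have hp := hpq.pos
  have hp1 := hpq.lt_one
  have hexp : 0 ≤ (1 - p) / p := div_nonneg (by linarith) hp.le
  induction k with
  | zero =>
    intro f g R hR hf hg hfR hgR hlap hf1 hg1
    have h := one_le_form_mul_volume hp hp1 hf hg hfR hgR hlap hg1.ge
    simp only [pow_zero, pow_one, mul_one]
    calc evenInf E p q = evenInf E p q * 1 := (mul_one _).symm
      _ ≤ evenInf E p q * _ := mul_le_mul' le_rfl h
      _ = _ := mul_left_comm _ _ _
  | succ k ih =>
    intro f g R hR hf hg hfR hgR hlap hf1 hg1
    have h := ih (f := doubled p f) (g := doubled p g) (R := Real.sqrt 2 * R) (by positivity)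
      (measurable_doubled hf) (measurable_doubled hg)
      (fun x => norm_le_of_doubled_ne_zero hp hfR) (fun x => norm_le_of_doubled_ne_zero hp hgR)
      (fun y => by rw [lap_doubled_rpow hp hf]; exact one_le_pow₀ (hlap _))
      (by rw [lintegral_doubled_rpow hp hf, hf1, one_pow])
      (by rw [lintegral_doubled_rpow hp hg, hg1, one_pow])
    rw [Measure.addHaar_closedBall_mul _ _ (Real.sqrt_nonneg 2) hR,
      ENNReal.mul_rpow_of_nonneg _ _ hexp] at h
    set a := ENNReal.ofReal (Real.sqrt 2 ^ Module.finrank ℝ E) ^ ((1 - p) / p)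
    set W := volume (Metric.closedBall (0 : E) R) ^ ((1 - p) / p)
    have hd := evenInf_mul_form_doubled_le hpq hf (by rw [hf1]; exact ENNReal.one_ne_top) hg
    calc evenInf E p q ^ 2 ^ (k + 1) = evenInf E p q ^ 2 ^ k * evenInf E p q ^ 2 ^ k := by
          rw [← pow_add, ← two_mul, pow_succ']
      _ ≤ evenInf E p q ^ 2 ^ k * _ := mul_le_mul' le_rfl h
      _ = (evenInf E p q * form (doubled p f) (doubled p g)) ^ 2 ^ k *
          (evenInf E p q * W ^ 2 * (a ^ 2) ^ (k + 1)) := by rw [mul_pow]; ring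
      _ ≤ (form f g ^ 2) ^ 2 ^ k * (evenInf E p q * W ^ 2 * (a ^ 2) ^ (k + 1)) := by gcongr
      _ = _ := by rw [← pow_mul, ← pow_succ']

theorem form_const_mul (hf : Measurable f) (hg : Measurable g) (a b : ℝ≥0∞) :
    form (fun x => a * f x) (fun x => b * g x) = a * b * form f g := by
  have hm : Measurable fun x => f x * lap g x := hf.mul (measurable_lap hg)
  rw [form, form, ← lintegral_const_mul _ hm]
  refine lintegral_congr fun x => ?_
  rw [lap_const_mul _ hg]
  ring

theorem inv_nrm_mul_rpow (hp : 0 < p) (f : E → ℝ≥0∞) (x : E) :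
    ((nrm p f)⁻¹ * f x) ^ p = (∫⁻ x, f x ^ p)⁻¹ * f x ^ p := by
  rw [ENNReal.mul_rpow_of_nonneg _ _ hp.le, ENNReal.inv_rpow, nrm, ← ENNReal.rpow_mul,
    one_div_mul_cancel hp.ne', ENNReal.rpow_one]

/-- The sharp inequality for functions of bounded support, in bilinear form. -/
theorem evenInf_mul_le_form (hpq : ReverseConjugate p q) (hf : Measurable f) (hg : Measurable g)
    (hfR : ∀ x, f x ≠ 0 → ‖x‖ ≤ R) (hgR : ∀ x, g x ≠ 0 → ‖x‖ ≤ R) (hft : ∫⁻ x, f x ^ p ≠ ∞)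
    (hgt : ∫⁻ x, g x ^ p ≠ ∞) (hlap : ∀ y, ∫⁻ x, f x ^ p ≤ lap (fun x => f x ^ p) y) :
    evenInf E p q * (nrm p f * nrm p g) ≤ form f g := by
  have hp := hpq.pos
  have hnrm0 : ∀ {h : E → ℝ≥0∞}, ∫⁻ x, h x ^ p = 0 → nrm p h = 0 := fun h0 => by
    rw [nrm, h0, ENNReal.zero_rpow_of_pos (one_div_pos.2 hp)]
  by_cases hf0 : ∫⁻ x, f x ^ p = 0
  · rw [hnrm0 hf0, zero_mul, mul_zero]; exact zero_le
  by_cases hg0 : ∫⁻ x, g x ^ p = 0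
  · rw [hnrm0 hg0, mul_zero, mul_zero]; exact zero_le
  have hnf : nrm p f ≠ 0 := rpow_ne_zero_of_finite hf0 hft _
  have hnft : nrm p f ≠ ∞ := rpow_ne_top_of_finite hf0 hft _
  have hng : nrm p g ≠ 0 := rpow_ne_zero_of_finite hg0 hgt _
  have hngt : nrm p g ≠ ∞ := rpow_ne_top_of_finite hg0 hgt _
  have hpf := inv_nrm_mul_rpow hp f
  have hpg := inv_nrm_mul_rpow hp g
  have hexp : 0 ≤ (1 - p) / p := div_nonneg (by linarith [hpq.lt_one]) hp.le
  have hI := evenInf_ne_top (E := E) hpq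
  have h := le_of_forall_pow_two_pow_le (y := form (fun x => (nrm p f)⁻¹ * f x)
      fun x => (nrm p g)⁻¹ * g x) hI
    (ENNReal.mul_ne_top hI (ENNReal.pow_ne_top
      (ENNReal.rpow_ne_top_of_nonneg hexp measure_closedBall_lt_top.ne)))
    (ENNReal.pow_ne_top (ENNReal.rpow_ne_top_of_nonneg hexp ENNReal.ofReal_ne_top))
    -- The functions are normalized to `p`-mass one; `max R 0` supplies a nonnegative radius.
    fun k => evenInf_pow_le (E := E) hpq k (R := max R 0) (le_max_right _ _) (hf.const_mul _)
      (hg.const_mul _)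
      (fun x hx => (hfR x (right_ne_zero_of_mul hx)).trans (le_max_left _ _))
      (fun x hx => (hgR x (right_ne_zero_of_mul hx)).trans (le_max_left _ _))
      (fun y => by
        simp only [hpf]
        rw [lap_const_mul _ (hf.pow_const p), ← ENNReal.inv_mul_cancel hf0 hft]
        gcongr
        exact hlap y)
      (by simp only [hpf]
          rw [lintegral_const_mul _ (hf.pow_const p), ENNReal.inv_mul_cancel hf0 hft])
      (by simp only [hpg]
          rw [lintegral_const_mul _ (hg.pow_const p), ENNReal.inv_mul_cancel hg0 hgt])
  rw [form_const_mul hf hg] at h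
  calc _ ≤ (nrm p f)⁻¹ * (nrm p g)⁻¹ * form f g * (nrm p f * nrm p g) := by gcongr
    _ = ((nrm p f)⁻¹ * nrm p f) * ((nrm p g)⁻¹ * nrm p g) * form f g := by ring
    _ = form f g := by
      rw [ENNReal.inv_mul_cancel hnf hnft, ENNReal.inv_mul_cancel hng hngt, one_mul, one_mul]

/-- The sharp inequality for functions `f` of bounded support such that `f ^ p` is centered. -/
theorem evenInf_mul_nrm_le_of_le_lap (hpq : ReverseConjugate p q) (hf : Measurable f)
    (hfR : ∀ x, f x ≠ 0 → ‖x‖ ≤ R) (hft : ∫⁻ x, f x ^ p ≠ ∞)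
    (hlap : ∀ y, ∫⁻ x, f x ^ p ≤ lap (fun x => f x ^ p) y) :
    evenInf E p q * nrm p f ≤ nrm q (lap f) := by
  refine le_nrm_of_forall_le hpq (measurable_lap hf) fun g hg hgt hgR => ?_
  obtain ⟨R', hgR⟩ := hgR
  rw [mul_assoc]
  refine (evenInf_mul_le_form hpq hf hg (R := max R R') (fun x hx => (hfR x hx).trans
    (le_max_left _ _)) (fun x hx => (hgR x hx).trans (le_max_right _ _)) hft hgt hlap).trans ?_
  rw [form_comm hf hg, form]

/-- Jensen's inequality for the Laplace transform. -/
theorem lintegral_mul_expInner_le_lap {F : E → ℝ≥0∞} (hF : Measurable F) (hFt : ∀ x, F x ≠ ∞)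
    (hI : ∫⁻ x, F x ≠ ∞) (hint : Integrable fun x => (F x).toReal • x) {b : E}
    (hb : ∫ x, (F x).toReal • x = (∫⁻ x, F x).toReal • b) (y : E) :
    (∫⁻ x, F x) * expInner b y ≤ lap F y := by
  have hFi : Integrable fun x => (F x).toReal := integrable_toReal_of_lintegral_ne_top
    hF.aemeasurable hI
  have hI' : ∫ x, (F x).toReal = (∫⁻ x, F x).toReal :=
    integral_toReal hF.aemeasurable (Eventually.of_forall fun x => (hFt x).lt_top)
  have hin : Integrable fun x => inner ℝ ((F x).toReal • x) y :=
    hint.inner_const y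
  -- The tangent to `exp` at `b·y`, weighted by `F`. It is integrable even where the transform of
  -- `F` is infinite.
  set u : E → ℝ := fun x => Real.exp (inner ℝ b y) *
    ((1 - inner ℝ b y) * (F x).toReal + inner ℝ ((F x).toReal • x) y) with hu
  have hui : Integrable u := ((hFi.const_mul _).add hin).const_mul _
  have hue : ∫ x, u x = Real.exp (inner ℝ b y) * (∫⁻ x, F x).toReal := by
    rw [hu, integral_const_mul, integral_add (hFi.const_mul _) hin, integral_const_mul, hI']
    have : ∫ x, inner ℝ ((F x).toReal • x) y = inner ℝ ((∫⁻ x, F x).toReal • b) y := by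
      rw [← hb, real_inner_comm, ← integral_inner (𝕜 := ℝ) hint y]
      exact integral_congr_ae (Eventually.of_forall fun x => real_inner_comm _ _)
    rw [this, real_inner_smul_left]
    ring
  have hle : ENNReal.ofReal (∫ x, u x) ≤ ∫⁻ x, ENNReal.ofReal (u x) := by
    rw [integral_eq_lintegral_pos_part_sub_lintegral_neg_part hui]
    refine (ENNReal.ofReal_le_ofReal (sub_le_self _ ENNReal.toReal_nonneg)).trans ?_
    exact ENNReal.ofReal_toReal_le
  rw [hue, ENNReal.ofReal_mul (Real.exp_pos _).le, ENNReal.ofReal_toReal hI, mul_comm] at hle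
  refine hle.trans (lintegral_mono fun x => ?_)
  rw [expInner]
  conv_rhs => rw [← ENNReal.ofReal_toReal (hFt x)]
  rw [← ENNReal.ofReal_mul ENNReal.toReal_nonneg]
  refine ENNReal.ofReal_le_ofReal ?_
  have h1 := Real.add_one_le_exp (inner ℝ x y - inner ℝ b y)
  have h2 : Real.exp (inner ℝ x y) =
      Real.exp (inner ℝ b y) * Real.exp (inner ℝ x y - inner ℝ b y) := by
    rw [← Real.exp_add]; congr 1; ring
  simp only [hu, real_inner_smul_left]
  rw [h2]
  calc _ = Real.exp (inner ℝ b y) * ((F x).toReal * (inner ℝ x y - inner ℝ b y + 1)) := by ring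
    _ ≤ Real.exp (inner ℝ b y) * ((F x).toReal * Real.exp (inner ℝ x y - inner ℝ b y)) := by
        gcongr
    _ = _ := by ring

/-- The two reversals of order, by `q` and by `1 / q`, cancel. -/
theorem nrm_antitone (hq : q < 0) {g h : E → ℝ≥0∞} (hgh : ∀ x, g x ≤ h x) :
    nrm q g ≤ nrm q h :=
  rpow_le_rpow_of_nonpos (one_div_nonpos.2 hq.le)
    (lintegral_mono fun x => rpow_le_rpow_of_nonpos hq.le (hgh x))

/-- The translation moves the barycenter `b` of `f ^ p` to the origin; Jensen's inequality then
supplies the centering hypothesis. -/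
theorem exists_evenInf_mul_nrm_le (hpq : ReverseConjugate p q) (hf : Measurable f) {c : ℝ≥0∞}
    (hc : c ≠ ∞) (hfc : ∀ x, f x ≤ c) (hfR : ∀ x, f x ≠ 0 → ‖x‖ ≤ R) :
    ∃ z, evenInf E p q * nrm p f ≤ nrm q (lap fun x => f (x - z)) := by
  have hp := hpq.pos
  have hFm := hf.pow_const p
  have hle : ∀ x, f x ^ p ≤ (Metric.closedBall (0 : E) R).indicator (fun _ => c ^ p) x := by
    intro x
    by_cases hx : f x = 0
    · rw [hx, ENNReal.zero_rpow_of_pos hp]; exact zero_le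
    · rw [Set.indicator_of_mem (by simpa using hfR x hx)]
      exact ENNReal.rpow_le_rpow (hfc x) hp.le
  have hcp : c ^ p ≠ ∞ := ENNReal.rpow_ne_top_of_nonneg hp.le hc
  have hft : ∫⁻ x, f x ^ p ≠ ∞ := by
    refine ((lintegral_mono hle).trans_lt ?_).ne
    rw [lintegral_indicator_const measurableSet_closedBall]
    exact ENNReal.mul_lt_top hcp.lt_top measure_closedBall_lt_top
  have hFt : ∀ x, f x ^ p ≠ ∞ := fun x =>
    ENNReal.rpow_ne_top_of_nonneg hp.le ((hfc x).trans_lt hc.lt_top).ne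
  by_cases h0 : ∫⁻ x, f x ^ p = 0
  · refine ⟨0, ?_⟩
    rw [nrm, h0, ENNReal.zero_rpow_of_pos (one_div_pos.2 hp), mul_zero]
    exact zero_le
  set a := (∫⁻ x, f x ^ p).toReal with ha
  have ha0 : a ≠ 0 := (ENNReal.toReal_pos h0 hft).ne'
  have hint : Integrable fun x => (f x ^ p).toReal • x := by
    have hFi : Integrable fun x => (f x ^ p).toReal := integrable_toReal_of_lintegral_ne_top
      hFm.aemeasurable hft
    refine (hFi.const_mul R).mono' (hFm.ennreal_toReal.smul measurable_id).aestronglyMeasurable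
      (Eventually.of_forall fun x => ?_)
    rw [norm_smul, Real.norm_of_nonneg ENNReal.toReal_nonneg]
    by_cases hx : f x = 0
    · simp [hx, hp]
    · rw [mul_comm]; gcongr; exact hfR x hx
  set b := a⁻¹ • ∫ x, (f x ^ p).toReal • x with hb
  have hJ := lintegral_mul_expInner_le_lap hFm hFt hft hint (b := b)
    (by rw [hb, ← ha, smul_inv_smul₀ ha0])
  have htr : ∫⁻ x, f (x - -b) ^ p = ∫⁻ x, f x ^ p :=
    lintegral_sub_right_eq_self (fun x => f x ^ p) (-b)
  refine ⟨-b, ?_⟩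
  have h := evenInf_mul_nrm_le_of_le_lap (f := fun x => f (x - -b)) (R := R + ‖b‖) hpq
    (hf.comp (measurable_id.sub_const _)) (fun x hx => by
      have h1 := hfR _ hx
      have h2 := norm_sub_le (x - -b) b
      rw [sub_neg_eq_add, add_sub_cancel_right] at h2
      rw [sub_neg_eq_add] at h1
      linarith) (by rw [htr]; exact hft) (fun y => by
      rw [htr, lap_translate fun x => f x ^ p]
      calc _ = expInner b y * expInner (-b) y * ∫⁻ x, f x ^ p := by
            rw [expInner_mul_neg, one_mul]
        _ = expInner (-b) y * ((∫⁻ x, f x ^ p) * expInner b y) := by ring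
        _ ≤ _ := by gcongr; exact hJ y)
  rwa [nrm, htr] at h

/-- The sharp inequality for the supremum over translations. -/
theorem evenInf_mul_nrm_le_iSup (hpq : ReverseConjugate p q) (hf : Measurable f) :
    evenInf E p q * nrm p f ≤ ⨆ z, nrm q (lap fun x => f (x - z)) := by
  have hp := hpq.pos
  -- Truncation in height and support. It may move the barycenter, which is harmless under a
  -- supremum over translations.
  set φ : ℕ → E → ℝ≥0∞ := fun j =>
    (Metric.closedBall (0 : E) j).indicator fun x => min (f x) j with hφ
  have hφm : ∀ j, Measurable (φ j) := fun j =>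
    (hf.min measurable_const).indicator measurableSet_closedBall
  have hφle : ∀ j x, φ j x ≤ f x := fun j x =>
    Set.indicator_le (fun x _ => min_le_left _ _) x
  have hmono : Monotone φ := by
    classical
    intro i j hij x
    have hij' : (i : ℝ) ≤ j := by exact_mod_cast hij
    simp only [hφ, Set.indicator_apply, Metric.mem_closedBall, dist_zero_right]
    split_ifs with h1 h2
    · exact min_le_min_left _ (by exact_mod_cast hij)
    · exact absurd (h1.trans hij') h2
    · exact zero_le
    · exact le_rfl
  have hlim : ∀ x, Tendsto (fun j => φ j x) atTop (𝓝 (f x)) := by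
    intro x
    have h1 : Tendsto (fun j : ℕ => min (f x) (j : ℝ≥0∞)) atTop (𝓝 (min (f x) ∞)) :=
      tendsto_const_nhds.min ENNReal.tendsto_nat_nhds_top
    rw [min_eq_left le_top] at h1
    refine h1.congr' ?_
    obtain ⟨N, hN⟩ := exists_nat_ge ‖x‖
    filter_upwards [eventually_ge_atTop N] with j hj
    have : ‖x‖ ≤ j := hN.trans (by exact_mod_cast hj)
    rw [hφ]
    simp [this]
  have hI : Tendsto (fun j => nrm p (φ j)) atTop (𝓝 (nrm p f)) := by
    refine (ENNReal.continuous_rpow_const.tendsto _).comp ?_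
    refine lintegral_tendsto_of_tendsto_of_monotone
      (fun j => ((hφm j).pow_const p).aemeasurable)
      (Eventually.of_forall fun x i j hij => ENNReal.rpow_le_rpow (hmono hij x) hp.le)
      (Eventually.of_forall fun x => (ENNReal.continuous_rpow_const.tendsto _).comp (hlim x))
  refine le_of_tendsto (ENNReal.Tendsto.const_mul hI (Or.inr (evenInf_ne_top hpq)))
    (Eventually.of_forall fun j => ?_)
  obtain ⟨z, hz⟩ := exists_evenInf_mul_nrm_le (R := j) hpq (hφm j) (ENNReal.natCast_ne_top j)
    (fun x => Set.indicator_le' (fun x _ => min_le_right _ _) (fun _ _ => zero_le) x)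
    (fun x hx => by
      have := Set.mem_of_indicator_ne_zero hx
      simpa using this)
  refine (hz.trans ?_).trans (le_iSup _ z)
  exact nrm_antitone hpq.q_neg (lap_mono fun x => hφle j _)

/-- The sharp inequality for centered functions. -/
theorem evenInf_mul_nrm_le_nrm_lap (hpq : ReverseConjugate p q) (hf : Measurable f)
    (hlap : ∀ y, ∫⁻ x, f x ^ p ≤ lap (fun x => f x ^ p) y) :
    evenInf E p q * nrm p f ≤ nrm q (lap f) := by
  have hp := hpq.pos
  refine le_nrm_of_forall_le hpq (measurable_lap hf) fun g hg _ _ => ?_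
  -- Truncating `f` would destroy its centering. Instead `g` is translated by `z` and `f` tilted by
  -- `exp(-x·z)`: the form is unchanged, and by `hlap` the tilt does not decrease the `L^p` norm.
  have h1 : ∀ z, nrm p f * nrm q (lap fun x => g (x - z)) ≤ form f g := by
    intro z
    have hgz : Measurable fun x => g (x - z) := hg.comp (measurable_id.sub_const _)
    have hfz : Measurable fun x => f x * expInner x (-z) :=
      measurable_mul_expInner hf (-z)
    calc _ ≤ nrm p (fun x => f x * expInner x (-z)) * nrm q (lap fun x => g (x - z)) := by
          gcongr
          refine ENNReal.rpow_le_rpow ((hlap (p • -z)).trans (le_of_eq ?_))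
            (one_div_nonneg.2 hp.le)
          refine lintegral_congr fun x => ?_
          rw [ENNReal.mul_rpow_of_nonneg _ _ hp.le, expInner_rpow]
      _ ≤ form (fun x => f x * expInner x (-z)) fun x => g (x - z) :=
          nrm_mul_nrm_le_form hpq hfz hgz
      _ = form f g := by
          refine lintegral_congr fun x => ?_
          beta_reduce
          rw [lap_translate, expInner_comm x]
          calc _ = expInner z x * expInner (-z) x * (f x * lap g x) := by ring
            _ = _ := by rw [expInner_mul_neg, one_mul]
  calc evenInf E p q * nrm p f * nrm p g = nrm p f * (evenInf E p q * nrm p g) := by ring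
    _ ≤ nrm p f * ⨆ z, nrm q (lap fun x => g (x - z)) := by
        gcongr; exact evenInf_mul_nrm_le_iSup hpq hg
    _ ≤ form f g := by rw [ENNReal.mul_iSup]; exact iSup_le h1
    _ = ∫⁻ x, g x * lap f x := by rw [form_comm hf hg, form]

end

/-! ### The unique minimum of a Laplace transform and the optimal translation. -/

section

variable {E : Type*} [NormedAddCommGroup E] [InnerProductSpace ℝ E] [FiniteDimensional ℝ E]
  [MeasurableSpace E] [BorelSpace E] {f G : E → ℝ≥0∞} {p q : ℝ} {w₀ : E}

theorem ae_inner_ne_zero {θ : E} (hθ : θ ≠ 0) : ∀ᵐ y : E, inner ℝ y θ ≠ 0 := by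
  rw [ae_iff]
  simpa using volume_inner_eq_zero hθ

/-- A Laplace transform which is bounded below is not carried by a closed half-space. -/
theorem not_ae_eq_zero_of_inner_pos (hG : Measurable G) (hw₀ : lap G w₀ ≠ ∞) {ε : ℝ≥0∞}
    (hε : ε ≠ 0) (hlow : ∀ w, ε ≤ lap G w) {θ : E} (hθ : θ ≠ 0) :
    ¬ ∀ᵐ y, 0 < inner ℝ y θ → G y = 0 := by
  intro hH
  -- Moving from `w₀` in the direction `θ` would make the transform tend to zero by dominated
  -- convergence.
  have hlim : Tendsto (fun j : ℕ => lap G (w₀ + (j : ℝ) • θ)) atTop (𝓝 (∫⁻ _ : E, 0)) := by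
    refine tendsto_lintegral_of_dominated_convergence (fun y => G y * expInner y w₀)
      (fun j => measurable_mul_expInner hG _) (fun j => ?_) hw₀ ?_
    · filter_upwards [hH] with y hy
      rcases le_or_gt (inner ℝ y θ) 0 with h | h
      · gcongr
        refine ENNReal.ofReal_le_ofReal (Real.exp_le_exp.2 ?_)
        rw [inner_add_right, inner_smul_right]
        have : (j : ℝ) * inner ℝ y θ ≤ 0 := mul_nonpos_of_nonneg_of_nonpos (by positivity) h
        linarith
      · rw [hy h, zero_mul]; exact zero_le
    · have hfin := ae_lt_top (measurable_mul_expInner hG w₀) hw₀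
      filter_upwards [hH, ae_inner_ne_zero hθ, hfin] with y hy hyθ hyt
      rcases lt_or_gt_of_ne hyθ with h | h
      · have h1 : ∀ j : ℕ, G y * expInner y (w₀ + (j : ℝ) • θ) =
            G y * expInner y w₀ * ENNReal.ofReal (Real.exp (j * inner ℝ y θ)) := fun j => by
          rw [expInner_add_right, expInner, expInner, inner_smul_right, mul_assoc]
        simp only [h1]
        rw [← mul_zero (G y * expInner y w₀)]
        refine ENNReal.Tendsto.const_mul ?_ (Or.inr hyt.ne)
        rw [← ENNReal.ofReal_zero]
        refine ENNReal.tendsto_ofReal (Real.tendsto_exp_atBot.comp ?_)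
        exact tendsto_natCast_atTop_atTop.atTop_mul_const_of_neg h
      · simp [hy h]
  rw [lintegral_zero] at hlim
  exact hε (nonpos_iff_eq_zero.1 (ge_of_tendsto' hlim fun j => hlow _))

/-- Along an unbounded sequence in the sublevel set, the directions accumulate at some `θ`. Fatou's
lemma then forces `G = 0` almost everywhere where `y·θ > 0`, which the preceding lemma excludes. -/
theorem exists_norm_le_of_lap_le (hG : Measurable G) (hw₀ : lap G w₀ ≠ ∞) {ε : ℝ≥0∞}
    (hε : ε ≠ 0) (hlow : ∀ w, ε ≤ lap G w) {M : ℝ≥0∞} (hM : M ≠ ∞) :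
    ∃ R, ∀ w, lap G w ≤ M → ‖w‖ ≤ R := by
  by_contra! hcon
  choose w hw hwk using fun k : ℕ => hcon (k + 1)
  have hpos : ∀ k, 0 < ‖w k‖ := fun k => lt_trans (by positivity) (hwk k)
  have hsph : ∀ k, ‖w k‖⁻¹ • w k ∈ Metric.sphere (0 : E) 1 := fun k => by
    rw [mem_sphere_zero_iff_norm, norm_smul, norm_inv, norm_norm, inv_mul_cancel₀ (hpos k).ne']
  obtain ⟨θ, hθ, ψ, hψ, hlim⟩ := (isCompact_sphere (0 : E) 1).tendsto_subseq hsph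
  have hθ0 : θ ≠ 0 := by
    rintro rfl
    simp at hθ
  have hinf : Tendsto (fun k => ‖w (ψ k)‖) atTop atTop := by
    refine tendsto_atTop_mono (fun k => ?_) tendsto_natCast_atTop_atTop
    have h1 := hwk (ψ k)
    have h2 : (k : ℝ) ≤ ψ k := by exact_mod_cast hψ.id_le k
    linarith
  refine not_ae_eq_zero_of_inner_pos hG hw₀ hε hlow hθ0 ?_
  have hm : ∀ k, Measurable fun y => G y * expInner y (w (ψ k)) := fun k =>
    measurable_mul_expInner hG _
  have hF : ∫⁻ y, liminf (fun k => G y * expInner y (w (ψ k))) atTop ≤ M :=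
    (lintegral_liminf_le hm).trans
      (liminf_le_of_frequently_le' (Frequently.of_forall fun k => hw (ψ k)))
  filter_upwards [ae_lt_top (Measurable.liminf hm) (hF.trans_lt hM.lt_top).ne] with y hy hyθ
  by_contra hGy
  have h1 : Tendsto (fun k => inner ℝ y (w (ψ k))) atTop atTop := by
    have h2 : Tendsto (fun k => inner ℝ y (‖w (ψ k)‖⁻¹ • w (ψ k))) atTop (𝓝 (inner ℝ y θ)) :=
      Tendsto.inner tendsto_const_nhds hlim
    refine (hinf.atTop_mul_pos hyθ h2).congr fun k => ?_
    rw [inner_smul_right, mul_inv_cancel_left₀ (hpos _).ne']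
  have h3 : Tendsto (fun k => G y * expInner y (w (ψ k))) atTop (𝓝 (G y * ∞)) :=
    ENNReal.Tendsto.const_mul
      (ENNReal.tendsto_ofReal_atTop.comp (Real.tendsto_exp_atTop.comp h1))
      (Or.inl ENNReal.top_ne_zero)
  rw [ENNReal.mul_top hGy] at h3
  rw [h3.liminf_eq] at hy
  exact lt_irrefl _ hy

/-- Strict convexity of `exp` is lost only where `y` is orthogonal to `v - w`, a null set. -/
theorem lap_midpoint_lt (hG : Measurable G) (hGt : ∀ x, G x ≠ ∞) {v w : E} (hvw : v ≠ w)
    (hv : lap G v ≠ ∞) (hv0 : lap G v ≠ 0) (heq : lap G w = lap G v) :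
    lap G ((1 / 2 : ℝ) • (v + w)) < lap G v := by
  have hpt : ∀ a b : ℝ, Real.exp ((a + b) / 2) ≤ Real.exp a / 2 + Real.exp b / 2 ∧
      (Real.exp ((a + b) / 2) = Real.exp a / 2 + Real.exp b / 2 → a = b) := by
    intro a b
    have h1 : Real.exp a = Real.exp (a / 2) * Real.exp (a / 2) := by
      rw [← Real.exp_add, add_halves]
    have h2 : Real.exp b = Real.exp (b / 2) * Real.exp (b / 2) := by
      rw [← Real.exp_add, add_halves]
    have h3 : Real.exp ((a + b) / 2) = Real.exp (a / 2) * Real.exp (b / 2) := by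
      rw [← Real.exp_add, add_div]
    rw [h1, h2, h3]
    refine ⟨by nlinarith [sq_nonneg (Real.exp (a / 2) - Real.exp (b / 2))], fun h => ?_⟩
    have h4 : (Real.exp (a / 2) - Real.exp (b / 2)) ^ 2 = 0 := by linarith
    have h5 := Real.exp_injective (sub_eq_zero.1 (pow_eq_zero_iff two_ne_zero |>.1 h4))
    linarith
  have hmid : ∀ y, expInner y ((1 / 2 : ℝ) • (v + w)) =
      ENNReal.ofReal (Real.exp ((inner ℝ y v + inner ℝ y w) / 2)) := fun y => by
    rw [expInner, inner_smul_right, inner_add_right]; congr 2; ring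
  have havg : ∀ y, expInner y v / 2 + expInner y w / 2 =
      ENNReal.ofReal (Real.exp (inner ℝ y v) / 2 + Real.exp (inner ℝ y w) / 2) := fun y => by
    rw [ENNReal.ofReal_add (by positivity) (by positivity), ENNReal.ofReal_div_of_pos two_pos,
      ENNReal.ofReal_div_of_pos two_pos, expInner, expInner, ENNReal.ofReal_ofNat]
  have hsum : ∫⁻ y, G y * (expInner y v / 2 + expInner y w / 2) = lap G v := by
    have h1 : ∀ y, G y * (expInner y v / 2 + expInner y w / 2) =
        2⁻¹ * (G y * expInner y v) + 2⁻¹ * (G y * expInner y w) := fun y => by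
      simp only [div_eq_mul_inv]; ring
    simp only [h1]
    rw [lintegral_add_left ((measurable_mul_expInner hG v).const_mul _),
      lintegral_const_mul _ (measurable_mul_expInner hG v),
      lintegral_const_mul _ (measurable_mul_expInner hG w), ← lap, ← lap, heq, ← add_mul,
      ENNReal.inv_two_add_inv_two, one_mul]
  have hle : ∀ y, G y * expInner y ((1 / 2 : ℝ) • (v + w)) ≤
      G y * (expInner y v / 2 + expInner y w / 2) := fun y => by
    rw [hmid, havg]
    gcongr
    exact (hpt _ _).1
  by_contra! hcon
  have hcon' : ∫⁻ y, G y * (expInner y v / 2 + expInner y w / 2) ≤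
      ∫⁻ y, G y * expInner y ((1 / 2 : ℝ) • (v + w)) := by rw [hsum]; exact hcon
  have hae := ae_eq_of_ae_le_of_lintegral_le (Eventually.of_forall hle)
    (((lintegral_mono hle).trans hsum.le).trans_lt hv.lt_top).ne
    (by
      have h1 := (measurable_expInner_left v).div_const (2 : ℝ≥0∞)
      have h2 := (measurable_expInner_left w).div_const (2 : ℝ≥0∞)
      exact (hG.mul (h1.add h2)).aemeasurable) hcon'
  apply hv0
  have hzero : ∀ᵐ y, G y * expInner y v = 0 := by
    filter_upwards [hae, ae_inner_ne_zero (sub_ne_zero.2 hvw)] with y hy hyn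
    by_contra hne
    have hGy : G y ≠ 0 := left_ne_zero_of_mul hne
    rw [ENNReal.mul_right_inj hGy (hGt y), hmid, havg,
      ENNReal.ofReal_eq_ofReal_iff (Real.exp_pos _).le (by positivity)] at hy
    apply hyn
    rw [inner_sub_right, (hpt _ _).2 hy, sub_self]
  rw [lap, lintegral_congr_ae hzero, lintegral_zero]

/-- A Laplace transform which is bounded below and not identically infinite has a unique minimum
point. -/
theorem exists_unique_lap_min (hG : Measurable G) (hGt : ∀ x, G x ≠ ∞) (hw₀ : lap G w₀ ≠ ∞)
    {ε : ℝ≥0∞} (hε : ε ≠ 0) (hlow : ∀ w, ε ≤ lap G w) :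
    ∃ v, (∀ w, lap G v ≤ lap G w) ∧ ∀ w, lap G w = lap G v → w = v := by
  obtain ⟨R, hR⟩ := exists_norm_le_of_lap_le hG hw₀ hε hlow hw₀
  obtain ⟨u, -, hu, humem⟩ := exists_seq_tendsto_sInf (S := Set.range fun w => lap G w)
    (Set.range_nonempty _) (OrderBot.bddBelow _)
  have hmin : ∃ v, ∀ w, lap G v ≤ lap G w := by
    -- Unless `w₀` is already a minimum point, a minimizing sequence ends up in the compact ball;
    -- Fatou's lemma gives lower semicontinuity.
    rcases eq_or_ne (sInf (Set.range fun w => lap G w)) (lap G w₀) with h | h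
    · exact ⟨w₀, fun w => by rw [← h]; exact sInf_le (Set.mem_range_self w)⟩
    have hlt : sInf (Set.range fun w => lap G w) < lap G w₀ :=
      lt_of_le_of_ne (sInf_le (Set.mem_range_self w₀)) h
    choose x hx using humem
    simp only at hx
    have hball : ∃ᶠ k in atTop, x k ∈ Metric.closedBall (0 : E) R := by
      refine Eventually.frequently ?_
      filter_upwards [hu.eventually (gt_mem_nhds hlt)] with k hk
      rw [mem_closedBall_zero_iff]
      exact hR _ (by rw [hx]; exact hk.le)
    obtain ⟨v, -, ψ, hψ, hlim⟩ := (isCompact_closedBall (0 : E) R).tendsto_subseq' hball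
    refine ⟨v, fun w => le_trans ?_ (sInf_le (Set.mem_range_self w))⟩
    have hm : ∀ k, Measurable fun y => G y * expInner y (x (ψ k)) := fun k =>
      measurable_mul_expInner hG _
    have hpt : ∀ y, liminf (fun k => G y * expInner y (x (ψ k))) atTop = G y * expInner y v := by
      intro y
      refine Tendsto.liminf_eq (ENNReal.Tendsto.const_mul ?_ (Or.inr (hGt y)))
      exact ENNReal.tendsto_ofReal
        ((Real.continuous_exp.tendsto _).comp (Tendsto.inner tendsto_const_nhds hlim))
    calc lap G v = ∫⁻ y, liminf (fun k => G y * expInner y (x (ψ k))) atTop := by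
          simp only [hpt]; rfl
      _ ≤ liminf (fun k => lap G (x (ψ k))) atTop := lintegral_liminf_le hm
      _ = _ := by
          refine Tendsto.liminf_eq ?_
          simp only [hx]
          exact hu.comp hψ.tendsto_atTop
  obtain ⟨v, hv⟩ := hmin
  refine ⟨v, hv, fun w hw => ?_⟩
  by_contra hne
  have hvt : lap G v ≠ ∞ := ((hv w₀).trans_lt hw₀.lt_top).ne
  have hv0 : lap G v ≠ 0 := fun h => hε (nonpos_iff_eq_zero.1 ((hlow v).trans h.le))
  exact absurd (hv _) (not_le.2 (lap_midpoint_lt hG hGt (Ne.symm hne) hvt hv0 hw))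

/-- For `‖x‖ > 1` the moment controls `G`; on the unit ball the weight `exp(x·w₀)` is at least
`exp(-‖w₀‖)`. -/
theorem lintegral_ne_top_of_integrable_smul (hGt : ∀ x, G x ≠ ∞) (hw₀ : lap G w₀ ≠ ∞)
    (hint : Integrable fun x => (G x).toReal • x) : ∫⁻ x, G x ≠ ∞ := by
  have hle : ∀ x, G x ≤ ENNReal.ofReal (Real.exp ‖w₀‖) * (G x * expInner x w₀) +
      ‖(G x).toReal • x‖ₑ := by
    intro x
    rcases le_or_gt ‖x‖ 1 with hx | hx
    · refine le_trans ?_ le_self_add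
      have h1 : 1 ≤ ENNReal.ofReal (Real.exp ‖w₀‖) * expInner x w₀ := by
        rw [expInner, ← ENNReal.ofReal_mul (Real.exp_pos _).le, ← Real.exp_add,
          ENNReal.one_le_ofReal, Real.one_le_exp_iff]
        have h2 := abs_real_inner_le_norm x w₀
        have h3 := neg_abs_le (inner ℝ x w₀)
        nlinarith [norm_nonneg w₀]
      calc G x = G x * 1 := (mul_one _).symm
        _ ≤ G x * (ENNReal.ofReal (Real.exp ‖w₀‖) * expInner x w₀) := by gcongr
        _ = _ := by ring
    · refine le_trans ?_ le_add_self
      rw [← ofReal_norm, norm_smul, Real.norm_of_nonneg ENNReal.toReal_nonneg]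
      conv_lhs => rw [← ENNReal.ofReal_toReal (hGt x)]
      exact ENNReal.ofReal_le_ofReal (le_mul_of_one_le_right ENNReal.toReal_nonneg hx.le)
  refine ((lintegral_mono hle).trans_lt ?_).ne
  rw [lintegral_add_right' _ hint.1.enorm, lintegral_const_mul' _ _ ENNReal.ofReal_ne_top]
  exact ENNReal.add_lt_top.2 ⟨ENNReal.mul_lt_top ENNReal.ofReal_lt_top hw₀.lt_top, hint.2⟩

/-- Translation multiplies `Lf` by `exp(z·y)`, whose `q`-th power is a Laplace kernel again. -/
theorem nrm_lap_translate (q : ℝ) (f : E → ℝ≥0∞) (z : E) :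
    nrm q (lap fun x => f (x - z)) = lap (fun y => lap f y ^ q) (q • z) ^ (1 / q) := by
  rw [nrm, lap]
  congr 1
  refine lintegral_congr fun y => ?_
  rw [lap_translate, mul_rpow_of_left_finite (expInner_ne_zero z y) (expInner_ne_top z y),
    mul_comm, expInner_comm z y, expInner_rpow]

/-- A finite supremum of `‖L(τ_z f)‖_q` is attained at exactly one point. -/
theorem exists_unique_translate (hpq : ReverseConjugate p q) (hf : Measurable f)
    (h0 : ∫⁻ x, f x ^ p ≠ 0) (ht : ∫⁻ x, f x ^ p ≠ ∞)
    (hS : (⨆ z, nrm q (lap fun x => f (x - z))) ≠ ∞) :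
    ∃ z₀, (∀ w, nrm q (lap fun x => f (x - w)) = (⨆ z, nrm q (lap fun x => f (x - z))) ↔
        w = z₀) ∧
      (Integrable (fun x => (lap f x ^ q).toReal • x) →
        (∫ x, (lap f x ^ q).toReal • x) = 0 → z₀ = 0) := by
  have hq := hpq.q_neg
  have hq' : 1 / q < 0 := one_div_neg.2 hq
  set G : E → ℝ≥0∞ := fun y => lap f y ^ q with hGd
  set S := ⨆ z, nrm q (lap fun x => f (x - z)) with hSd
  have hG : Measurable G := (measurable_lap hf).pow_const q
  have hGt : ∀ y, G y ≠ ∞ := fun y h => by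
    rcases ENNReal.rpow_eq_top_iff.1 h with h | h
    · exact lap_ne_zero hf h0 hpq.pos y h.1
    · linarith [h.2]
  have hqz : ∀ w : E, q • q⁻¹ • w = w := fun w => smul_inv_smul₀ hq.ne w
  have hpow : ∀ t : ℝ≥0∞, (t ^ (1 / q)) ^ q = t := fun t => by
    rw [← ENNReal.rpow_mul, one_div_mul_cancel hq.ne, ENNReal.rpow_one]
  have hlow : ∀ w, S ^ q ≤ lap G w := fun w => by
    rw [← hpow (lap G w), ← hqz w, ← nrm_lap_translate]
    exact rpow_le_rpow_of_nonpos hq.le (le_iSup (fun z => nrm q (lap fun x => f (x - z))) _)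
  have hSq : S ^ q ≠ 0 := fun h => by
    rcases ENNReal.rpow_eq_zero_iff.1 h with h | h
    · linarith [h.2]
    · exact hS h.1
  -- The sharp inequality makes the supremum positive, so the transform of `(Lf)^q` is finite
  -- somewhere.
  have hS0 : S ≠ 0 := by
    intro h
    have h1 := evenInf_mul_nrm_le_iSup hpq hf
    rw [← hSd, h, nonpos_iff_eq_zero, mul_eq_zero, evenInf_eq_sharpConst hpq] at h1
    rcases h1 with h1 | h1
    · exact absurd (ENNReal.ofReal_eq_zero.1 h1) (not_le.2 (sharpConst_pos hpq _))
    · exact rpow_ne_zero_of_finite h0 ht _ h1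
  obtain ⟨w₀, hw₀⟩ : ∃ w₀, lap G w₀ ≠ ∞ := by
    by_contra! hcon
    apply hS0
    rw [hSd]
    simp only [nrm_lap_translate, ← hGd, hcon, ENNReal.top_rpow_of_neg hq', ciSup_const]
  obtain ⟨v, hv, huniq⟩ := exists_unique_lap_min hG hGt hw₀ hSq hlow
  have hmax : nrm q (lap fun x => f (x - q⁻¹ • v)) = S := by
    refine le_antisymm (le_iSup (fun z => nrm q (lap fun x => f (x - z))) _) (iSup_le fun z => ?_)
    rw [nrm_lap_translate, nrm_lap_translate, hqz]
    exact rpow_le_rpow_of_nonpos hq'.le (hv _)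
  refine ⟨q⁻¹ • v, fun w => ⟨fun hw => ?_, fun hw => hw ▸ hmax⟩, fun hint hz => ?_⟩
  · rw [← hmax, nrm_lap_translate, nrm_lap_translate, hqz] at hw
    have h1 := congrArg (fun t => t ^ q) hw
    simp only [hpow] at h1
    rw [← huniq _ h1, inv_smul_smul₀ hq.ne]
  · have hI := lintegral_ne_top_of_integrable_smul hGt hw₀ hint
    -- With barycenter zero, Jensen's inequality says that the minimum is at the origin.
    have hJ := lintegral_mul_expInner_le_lap hG hGt hI hint (b := 0) (by rw [smul_zero]; exact hz) v
    have hG0 : lap G 0 = ∫⁻ x, G x := by simp [lap, expInner_zero_right]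
    rw [expInner_zero_left, mul_one, ← hG0] at hJ
    rw [← huniq 0 (le_antisymm hJ (hv 0)), smul_zero]

end

/-! ### Even functions and Gaussians under translation. -/

section

variable {E : Type*} [NormedAddCommGroup E] [InnerProductSpace ℝ E] [FiniteDimensional ℝ E]
  [MeasurableSpace E] [BorelSpace E] {f : E → ℝ≥0∞} {p q : ℝ}

/-- The transform of the even function `(Lf)^q` is even and log-convex, so it is smallest at the
origin. -/
theorem nrm_lap_translate_le (hq : q < 0) (hf : Measurable f) (heven : ∀ x, f (-x) = f x) (z : E) :
    nrm q (lap fun x => f (x - z)) ≤ nrm q (lap f) := by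
  have hG : Measurable fun y => lap f y ^ q := (measurable_lap hf).pow_const q
  have h0 : nrm q (lap f) = lap (fun y => lap f y ^ q) 0 ^ (1 / q) := by
    simp [nrm, lap, expInner_zero_right]
  rw [h0, nrm_lap_translate]
  refine rpow_le_rpow_of_nonpos (one_div_nonpos.2 hq.le) ?_
  have h := lap_logConvex hG (a := 1 / 2) (b := 1 / 2) (by norm_num) (by norm_num) (by norm_num)
    (q • z) (-(q • z))
  rwa [smul_neg, add_neg_cancel, lap_neg (f := fun y => lap f y ^ q)
    (fun y => by rw [lap_neg heven]), ← ENNReal.rpow_add_of_nonneg _ _ (by norm_num) (by norm_num),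
    show (1 / 2 : ℝ) + 1 / 2 = 1 by norm_num, ENNReal.rpow_one] at h

theorem nrm_lap_const_mul_gauss (hpq : ReverseConjugate p q) {σ : ℝ} (hσ : 0 < σ) {c : ℝ≥0∞}
    (hc : c ≠ 0) (hc' : c ≠ ∞) :
    nrm q (lap fun x : E => c * gauss σ x) =
      ENNReal.ofReal (sharpConst (Module.finrank ℝ E) p q) * nrm p fun x : E => c * gauss σ x := by
  obtain ⟨K, -, -, e1, e2⟩ := exists_nrm_comp_linearEquiv hpq (measurable_gauss (E := E) σ) hc hc'
    (LinearEquiv.refl ℝ E)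
  simp only [LinearEquiv.refl_apply] at e1 e2
  rw [e1, e2, nrm_lap_gauss hpq hσ, mul_left_comm]

end

/-! ### Passage to real-valued functions and the theorem. -/

section

variable {n : ℕ} {f : EuclideanSpace ℝ (Fin n) → ℝ} {p q : ℝ}

theorem laplace_eq_lap (hf : ∀ x, 0 ≤ f x) : laplace f = lap fun x => ENNReal.ofReal (f x) := by
  funext y
  refine lintegral_congr fun x => ?_
  rw [ENNReal.ofReal_mul (hf x), expInner]

theorem lqNorm_laplace_translate (hf : ∀ x, 0 ≤ f x) (z : EuclideanSpace ℝ (Fin n)) :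
    lqNorm q (laplace (translate z f)) = nrm q (lap fun x => ENNReal.ofReal (f (x - z))) := by
  rw [laplace_eq_lap (f := translate z f) fun x => hf _]
  rfl

theorem eLpNorm_eq_nrm (hp : 0 < p) (hf : ∀ x, 0 ≤ f x) :
    eLpNorm f (ENNReal.ofReal p) volume = nrm p fun x => ENNReal.ofReal (f x) := by
  rw [eLpNorm_eq_lintegral_rpow_enorm_toReal (by simpa using hp) ENNReal.ofReal_ne_top,
    ENNReal.toReal_ofReal hp.le]
  simp only [Real.enorm_of_nonneg (hf _)]
  rfl

/-- A measurable representative with values in `[0, ∞]`. -/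
theorem exists_measurable_representative (hp : 0 < p) (hf : ∀ x, 0 ≤ f x)
    (hfp : MemLp f (ENNReal.ofReal p) volume) :
    ∃ F : EuclideanSpace ℝ (Fin n) → ℝ≥0∞, Measurable F ∧ (∀ x, F x ≠ ∞) ∧
      (fun x => ENNReal.ofReal (f x)) =ᵐ[volume] F ∧ ∫⁻ x, F x ^ p ≠ ∞ ∧
      eLpNorm f (ENNReal.ofReal p) volume = nrm p F ∧ laplace f = lap F ∧
      ∀ z, lqNorm q (laplace (translate z f)) = nrm q (lap fun x => F (x - z)) := by
  have hm := hfp.1.aemeasurable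
  have hae : (fun x => ENNReal.ofReal (f x)) =ᵐ[volume] fun x => ENNReal.ofReal (hm.mk f x) := by
    filter_upwards [hm.ae_eq_mk] with x hx
    rw [← hx]
  have hlap : lap (fun x => ENNReal.ofReal (f x)) = lap fun x => ENNReal.ofReal (hm.mk f x) := by
    funext y
    refine lintegral_congr_ae ?_
    filter_upwards [hae] with x hx
    rw [hx]
  have hint : ∫⁻ x, ENNReal.ofReal (f x) ^ p = ∫⁻ x, ENNReal.ofReal (hm.mk f x) ^ p := by
    refine lintegral_congr_ae ?_
    filter_upwards [hae] with x hx
    rw [hx]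
  have hnrm := eLpNorm_eq_nrm hp hf
  rw [nrm, hint] at hnrm
  refine ⟨_, hm.measurable_mk.ennreal_ofReal, fun _ => ENNReal.ofReal_ne_top, hae, fun h => ?_,
    hnrm, by rw [laplace_eq_lap hf, hlap], fun z => ?_⟩
  · have h1 := hfp.2
    rw [hnrm, h, ENNReal.top_rpow_of_pos (one_div_pos.2 hp)] at h1
    exact lt_irrefl _ h1
  · rw [lqNorm_laplace_translate hf]
    congr 1
    funext y
    rw [lap_translate fun x => ENNReal.ofReal (f x), hlap,
      lap_translate fun x => ENNReal.ofReal (hm.mk f x)]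

theorem smul_gaussian_nonneg {c : ℝ} (hc : 0 < c) (σ : ℝ) (x : EuclideanSpace ℝ (Fin n)) :
    0 ≤ (c • gaussian n σ) x :=
  mul_nonneg hc.le (Real.exp_pos _).le

theorem ofReal_smul_gaussian {c : ℝ} (hc : 0 < c) (σ : ℝ) (x : EuclideanSpace ℝ (Fin n)) :
    ENNReal.ofReal ((c • gaussian n σ) x) = ENNReal.ofReal c * gauss σ x := by
  rw [Pi.smul_apply, smul_eq_mul, ENNReal.ofReal_mul hc.le, gaussian, gauss]

theorem eLpNorm_translate_smul_gaussian (hp : 0 < p) {c : ℝ} (hc : 0 < c) (σ : ℝ)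
    (a : EuclideanSpace ℝ (Fin n)) :
    eLpNorm (translate a (c • gaussian n σ)) (ENNReal.ofReal p) volume =
      nrm p fun x : EuclideanSpace ℝ (Fin n) => ENNReal.ofReal c * gauss σ x := by
  rw [eLpNorm_eq_nrm (f := translate a (c • gaussian n σ)) hp
    fun x => smul_gaussian_nonneg hc σ _]
  simp only [translate, ofReal_smul_gaussian hc]
  rw [nrm, lintegral_sub_right_eq_self
    (fun x : EuclideanSpace ℝ (Fin n) => (ENNReal.ofReal c * gauss σ x) ^ p) a, nrm]

end

end LaplaceLp

end

theorem theorem1p1 (n : ℕ) (p q : ℝ) (hp0 : 0 < p) (hp1 : p < 1) (hq : q = p / (p - 1)) :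
    -- the inequality for the supremum over translations
    (∀ f : EuclideanSpace ℝ (Fin n) → ℝ, (∀ x, 0 ≤ f x) → MemLp f (ENNReal.ofReal p) volume →
      ENNReal.ofReal (LaplaceLp.sharpConst n p q) * eLpNorm f (ENNReal.ofReal p) volume ≤
        ⨆ z, LaplaceLp.lqNorm q (LaplaceLp.laplace (LaplaceLp.translate z f))) ∧
    -- equality for Gaussian functions
    (∀ (c σ : ℝ) (a : EuclideanSpace ℝ (Fin n)), 0 < c → 0 < σ →
      (⨆ z, LaplaceLp.lqNorm q (LaplaceLp.laplace (LaplaceLp.translate z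
          (LaplaceLp.translate a (c • LaplaceLp.gaussian n σ))))) =
        ENNReal.ofReal (LaplaceLp.sharpConst n p q) *
          eLpNorm (LaplaceLp.translate a (c • LaplaceLp.gaussian n σ))
            (ENNReal.ofReal p) volume) ∧
    -- a finite supremum is attained at a unique point, and where this point is zero
    (∀ f : EuclideanSpace ℝ (Fin n) → ℝ, (∀ x, 0 ≤ f x) → MemLp f (ENNReal.ofReal p) volume →
      ¬ f =ᵐ[volume] 0 →
      (⨆ z, LaplaceLp.lqNorm q (LaplaceLp.laplace (LaplaceLp.translate z f))) < ∞ →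
      ∃ z₀,
        (∀ w, LaplaceLp.lqNorm q (LaplaceLp.laplace (LaplaceLp.translate w f)) =
          (⨆ z, LaplaceLp.lqNorm q (LaplaceLp.laplace (LaplaceLp.translate z f))) ↔ w = z₀) ∧
        (Integrable (fun x => (LaplaceLp.laplace f x ^ q).toReal • x) volume →
          (∫ x, (LaplaceLp.laplace f x ^ q).toReal • x) = 0 → z₀ = 0)) ∧
    -- the inequality without translation when `f ^ p` is centered at the origin
    (∀ f : EuclideanSpace ℝ (Fin n) → ℝ, (∀ x, 0 ≤ f x) → MemLp f (ENNReal.ofReal p) volume →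
      Integrable (fun x => f x ^ p • x) volume → (∫ x, f x ^ p • x) = 0 →
      ENNReal.ofReal (LaplaceLp.sharpConst n p q) * eLpNorm f (ENNReal.ofReal p) volume ≤
        LaplaceLp.lqNorm q (LaplaceLp.laplace f)) ∧
    -- equality for centered Gaussian functions
    (∀ c σ : ℝ, 0 < c → 0 < σ →
      LaplaceLp.lqNorm q (LaplaceLp.laplace (c • LaplaceLp.gaussian n σ)) =
        ENNReal.ofReal (LaplaceLp.sharpConst n p q) *
          eLpNorm (c • LaplaceLp.gaussian n σ) (ENNReal.ofReal p) volume) := by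
  have hpq : LaplaceLp.ReverseConjugate p q := ⟨hp0, hp1, hq⟩
  have hC : LaplaceLp.evenInf (EuclideanSpace ℝ (Fin n)) p q =
      ENNReal.ofReal (LaplaceLp.sharpConst n p q) := by
    rw [LaplaceLp.evenInf_eq_sharpConst hpq, finrank_euclideanSpace_fin]
  have hgauss : ∀ c σ : ℝ, 0 < c → 0 < σ →
      LaplaceLp.nrm q (LaplaceLp.lap fun x : EuclideanSpace ℝ (Fin n) =>
          ENNReal.ofReal c * LaplaceLp.gauss σ x) =
        ENNReal.ofReal (LaplaceLp.sharpConst n p q) *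
          LaplaceLp.nrm p fun x : EuclideanSpace ℝ (Fin n) =>
            ENNReal.ofReal c * LaplaceLp.gauss σ x := fun c σ hc hσ => by
    have h := LaplaceLp.nrm_lap_const_mul_gauss (E := EuclideanSpace ℝ (Fin n)) hpq hσ
      (ENNReal.ofReal_pos.2 hc).ne' ENNReal.ofReal_ne_top
    rwa [finrank_euclideanSpace_fin] at h
  refine ⟨fun f hf hfp => ?_, fun c σ a hc hσ => ?_, fun f hf hfp hne hS => ?_,
    fun f hf hfp hint hz => ?_, fun c σ hc hσ => ?_⟩
  · obtain ⟨F, hF, -, -, -, e1, -, e2⟩ :=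
      LaplaceLp.exists_measurable_representative (q := q) hp0 hf hfp
    simp only [e1, e2, ← hC]
    exact LaplaceLp.evenInf_mul_nrm_le_iSup hpq hF
  · rw [LaplaceLp.eLpNorm_translate_smul_gaussian hp0 hc, ← hgauss c σ hc hσ]
    have h1 : ∀ z : EuclideanSpace ℝ (Fin n), LaplaceLp.lqNorm q (LaplaceLp.laplace
        (LaplaceLp.translate z (LaplaceLp.translate a (c • LaplaceLp.gaussian n σ)))) =
        LaplaceLp.nrm q (LaplaceLp.lap fun x =>
          ENNReal.ofReal c * LaplaceLp.gauss σ (x - (z + a))) := fun z => by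
      rw [LaplaceLp.lqNorm_laplace_translate
        (f := LaplaceLp.translate a (c • LaplaceLp.gaussian n σ))
        fun x => LaplaceLp.smul_gaussian_nonneg hc σ _]
      simp only [LaplaceLp.translate, LaplaceLp.ofReal_smul_gaussian hc, sub_sub]
    simp only [h1]
    refine le_antisymm (iSup_le fun z => ?_) ?_
    · exact LaplaceLp.nrm_lap_translate_le hpq.q_neg
        (f := fun x => ENNReal.ofReal c * LaplaceLp.gauss σ x)
        ((LaplaceLp.measurable_gauss σ).const_mul _)
        (fun x => by rw [LaplaceLp.gauss_neg]) (z + a)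
    -- The translation by `-a` recenters the Gaussian and attains the supremum.
    · refine le_trans (le_of_eq ?_) (le_iSup _ (-a))
      simp only [neg_add_cancel, sub_zero]
  · obtain ⟨F, hF, -, hae, hFt, -, e1, e2⟩ :=
      LaplaceLp.exists_measurable_representative (q := q) hp0 hf hfp
    simp only [e1, e2] at hS ⊢
    refine LaplaceLp.exists_unique_translate hpq hF (fun h0 => hne ?_) hFt hS.ne
    rw [lintegral_eq_zero_iff (hF.pow_const p)] at h0
    filter_upwards [hae, h0] with x hx hx0
    have h1 : ENNReal.ofReal (f x) = 0 := by
      rw [hx]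
      simpa [hp0, hp0.le, hp0.not_gt] using hx0
    exact le_antisymm (ENNReal.ofReal_eq_zero.1 h1) (hf x)
  · obtain ⟨F, hF, hFne, hae, hFt, e1, e2, -⟩ :=
      LaplaceLp.exists_measurable_representative (q := q) hp0 hf hfp
    rw [e1, e2, ← hC]
    have hae' : (fun x => f x ^ p • x) =ᵐ[volume] fun x => (F x ^ p).toReal • x := by
      filter_upwards [hae] with x hx
      rw [← hx, ← ENNReal.toReal_rpow, ENNReal.toReal_ofReal (hf x)]
    refine LaplaceLp.evenInf_mul_nrm_le_nrm_lap hpq hF fun y => ?_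
    -- Jensen's inequality with barycenter zero turns the vanishing first moment into the centering
    -- hypothesis.
    have h := LaplaceLp.lintegral_mul_expInner_le_lap (hF.pow_const p)
      (fun x => ENNReal.rpow_ne_top_of_nonneg hp0.le (hFne x)) hFt (hint.congr hae') (b := 0)
      (by rw [← integral_congr_ae hae', hz, smul_zero]) y
    rwa [LaplaceLp.expInner_zero_left, mul_one] at h
  · have h1 := LaplaceLp.eLpNorm_translate_smul_gaussian hp0 hc σ (0 : EuclideanSpace ℝ (Fin n))
    have h2 : LaplaceLp.translate 0 (c • LaplaceLp.gaussian n σ) = c • LaplaceLp.gaussian n σ := by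
      funext x
      simp only [LaplaceLp.translate, sub_zero]
    rw [h2] at h1
    rw [h1, ← hgauss c σ hc hσ, LaplaceLp.laplace_eq_lap (LaplaceLp.smul_gaussian_nonneg hc σ)]
    simp only [LaplaceLp.ofReal_smul_gaussian hc]
    rfl
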